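/- **Lemma.** The problem Longest Induced Path parameterized by modular-width has a polynomial Turing compression. Here the terms have the following meaning. * A module of a finite graph $G=(V,E)$ is a set $M\subseteq V$ such that for every $v\in V\setminus M$ either $M\cap N(v)=\emptyset$ or $M\subseteq N(v)$. The graph $G$ is prime if its only modules are $\emptyset$, $V$ and the singletons. The modular-width $mw(G)$ is the number of vertices of the largest prime induced subgraph of $G$. * Longest Induced Path$(mw)$ is the parameterized problem that consists of all pairs $(x,k)\in\{0,1\}^*\times\mathbb N$ such that $x$ is the encoding $\langle G,\ell\rangle$ of a finite graph $G$ (given by its adjacency matrix) and a number $\ell\in\mathbb N$ (in binary), $k=mw(G)$, and $G$ contains the path on $\ell$ vertices as an induced subgraph. * A parameterized problem $Q\subseteq\{0,1\}^*\times\mathbb N$ has a polynomial Turing compression if there are a language $L$ over some finite alphabet, polynomials $p$ and $T$, and a deterministic oracle Turing machine which, with an oracle for $L$, on every input $(x,k)$ (with $k$ given in unary) decides within $T(|x|+k)$ steps whether $(x,k)\in Q$, where an oracle call counts as one step, and sends only queries of length at most $p(k)$ to the oracle. The language $L$ need not be decidable. -/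

import Mathlib

/-! ### Modules, prime graphs, modular-width -/

namespace SimpleGraph

/-- A module of `G`: a set `M` of vertices such that every vertex outside `M` is adjacent to no
vertex of `M` or to all vertices of `M`. -/
def IsModularSet {V : Type*} (G : SimpleGraph V) (M : Set V) : Prop :=
  ∀ v, v ∉ M → M ∩ G.neighborSet v = ∅ ∨ M ⊆ G.neighborSet v

/-- A prime graph: its only modules are the trivial ones, namely the empty set, the set of all
vertices, and the singletons. -/
def IsPrimeGraph {V : Type*} (G : SimpleGraph V) : Prop :=
  ∀ M : Set V, G.IsModularSet M → M = ∅ ∨ M = Set.univ ∨ ∃ v, M = {v}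

/-- The modular-width of a finite graph: the number of vertices of its largest prime induced
subgraph. -/
noncomputable def modularWidth {V : Type*} (G : SimpleGraph V) : ℕ :=
  sSup {m | ∃ S : Set V, (G.induce S).IsPrimeGraph ∧ S.ncard = m}

end SimpleGraph

/-! ### Oracle Turing machines -/

/-- A (deterministic, multi-stack) oracle Turing machine over a finite work alphabet `Γ` that
contains the two input symbols. Its program is a program of Mathlib's machine model `Turing.TM2`
with finitely many stacks, labels and internal states. Besides, there is a query stack `qry` and
there are three special labels: when the machine is at the label `ask`, the next step is an oracle
call, which leads to the label `yes` or `no`. -/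
structure OracleTM where
  /-- the stacks -/
  K : Type
  [decK : DecidableEq K]
  [finK : Fintype K]
  /-- the work alphabet -/
  Γ : Type
  [finΓ : Fintype Γ]
  /-- the labels of the program -/
  Λ : Type
  [finΛ : Fintype Λ]
  /-- the internal states -/
  σ : Type
  [finσ : Fintype σ]
  /-- the input symbols `0` and `1` within the work alphabet -/
  bit : Bool ↪ Γ
  /-- the input stack -/
  inp : K
  /-- the query stack -/
  qry : K
  /-- the label where the computation starts -/
  main : Λ
  /-- the internal state in which the computation starts -/
  start : σ
  /-- the label of an oracle call, and the two labels for the answer -/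
  ask : Λ
  yes : Λ
  no : Λ
  /-- the program -/
  prog : Λ → Turing.TM2.Stmt (fun _ : K => Γ) Λ σ
  /-- the accepting internal states -/
  accept : σ → Bool

namespace OracleTM

attribute [instance] decK finK finΓ finΛ finσ

/-- Configurations: a label (`none` once the machine has halted), an internal state, and the
contents of the stacks. -/
abbrev Cfg (M : OracleTM) : Type :=
  Turing.TM2.Cfg (fun _ : M.K => M.Γ) M.Λ M.σ

/-- The initial configuration on the input word `w`: the word is on the input stack, its first
symbol on top, and all the other stacks are empty. -/
def init (M : OracleTM) (w : List Bool) : M.Cfg where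
  l := some M.main
  var := M.start
  stk := Function.update (fun _ => []) M.inp (w.map M.bit)

open Classical in
/-- One step of the machine with an oracle for the language `L`. At the label `ask` the content of
the query stack is the query; it is answered in one step, which also empties the query stack.
A configuration in which the machine has halted does not change any more. -/
noncomputable def next (M : OracleTM) (L : Language M.Γ) (c : M.Cfg) : M.Cfg :=
  if c.l = some M.ask then
    { l := some (if c.stk M.qry ∈ L then M.yes else M.no)
      var := c.var
      stk := Function.update c.stk M.qry [] }
  else
    (Turing.TM2.step M.prog c).getD c

/-- The configuration after `t` steps on the input word `w`. -/
noncomputable def run (M : OracleTM) (L : Language M.Γ) (w : List Bool) (t : ℕ) : M.Cfg :=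
  (M.next L)^[t] (M.init w)

end OracleTM

/-! ### Parameterized problems and Turing compressions -/

/-- A parameterized problem over the alphabet `{0, 1}`: a set of pairs `(x, k)` of a word and a
parameter. -/
abbrev ParamProblem : Type := Set (List Bool × ℕ)

/-- The input word for an instance `(x, k)`: the parameter in unary, a separator, and `x`. -/
def instanceWord (x : List Bool) (k : ℕ) : List Bool :=
  List.replicate k true ++ false :: x

/-- `Q` has a Turing compression of size `f`: there are a language `L` and an oracle machine that,
with an oracle for `L`, on every input `(x, k)` decides whether `(x, k) ∈ Q`, in a number of steps
that is polynomial in `|x| + k`, and sends only queries of length at most `f k` to the oracle. -/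
def HasTuringCompression (Q : ParamProblem) (f : ℕ → ℕ) : Prop :=
  ∃ (M : OracleTM) (L : Language M.Γ) (T : Polynomial ℕ), ∀ (x : List Bool) (k : ℕ),
    (∃ t ≤ T.eval (x.length + k),
      (M.run L (instanceWord x k) t).l = none ∧
      (M.accept (M.run L (instanceWord x k) t).var = true ↔ (x, k) ∈ Q)) ∧
    ∀ t, (M.run L (instanceWord x k) t).l = some M.ask →
      ((M.run L (instanceWord x k) t).stk M.qry).length ≤ f k

/-- `Q` has a polynomial Turing compression (PTC). -/
def HasPTC (Q : ParamProblem) : Prop :=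
  ∃ p : Polynomial ℕ, HasTuringCompression Q (fun k => p.eval k)

/-! ### Longest Induced Path parameterized by modular-width -/

open Classical in
/-- The encoding of a pair of a graph on `n` vertices and a number `ℓ`: the word `1ⁿ0`, then the
adjacency matrix, row by row, then `ℓ` in binary (least significant bit first). -/
noncomputable def encodeGraphNat {n : ℕ} (G : SimpleGraph (Fin n)) (ℓ : ℕ) : List Bool :=
  List.replicate n true ++ false ::
    ((List.finRange n).flatMap (fun i => (List.finRange n).map fun j => decide (G.Adj i j))
      ++ ℓ.bits)

/-- Longest Induced Path(mw): the instances `((G, ℓ), mw(G))` such that `G` contains the path on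
`ℓ` vertices as an induced subgraph. -/
def longestInducedPathMW : ParamProblem :=
  {I | ∃ (n : ℕ) (G : SimpleGraph (Fin n)) (ℓ : ℕ),
    I = (encodeGraphNat G ℓ, G.modularWidth) ∧ (SimpleGraph.pathGraph ℓ).IsIndContained G}

/-! The oracle `queryLang` answers two questions about a small graph: does it contain the path, and
is it prime with exactly `k` vertices. The machine shrinks a set `S` of vertices, at first the whole
vertex set. For two vertices `u`, `v` of `S` it computes the smallest module `M` of the subgraph
induced on `S` that contains both. If `M` has at most `k` vertices, it asks about `M` and deletes
`v` from `S`.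

No prime graph is lost in this way (`IndIn.prime_split`). A copy of a prime graph in `S` meets `M`
in a module of that graph, hence not at all, in one vertex, or entirely. In the last case the copy
lies in `M`, where the oracle sees it. If it meets `M` in `v` alone, then `u` can replace `v`, since
no vertex of `S` outside `M` distinguishes the two. The path on `l ≥ 4` vertices is prime
(`isPrimeGraph_pathGraph`), so this applies to the path itself. Shorter paths and small values of
`k` are handled by asking about all sets of at most three vertices.

The equation `k = mw(G)` has to be verified as well. If no prime set has more than `k` vertices,
then `S`, as long as it has two vertices, contains a prime module with at least two vertices
(`exists_isPrimeSet_module`). This module has at most `k` vertices, so some pair allows a deletion,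
and polynomially many rounds leave at most one vertex. Conversely, once at most one vertex is left,
a prime set with more than `k` vertices would have a copy in `S`; this is possible only for `k = 0`
in a nonempty graph, which is tested separately. That some prime set has exactly `k` vertices is
learned from the answers.

The queries are short because `M` has at most `k + 3` vertices and `l` has at most `k + 2` binary
digits: an induced path on `l ≥ 4` vertices forces `l ≤ mw(G)` (`length_bits_le`), so longer numbers
are rejected without a query.

To obtain a machine, the algorithm is written in a language of loops that run from `0` to `N - 1`,
where `N` is linear in the input length. Such programs are compiled to structured stack programs in
polynomial time (`exec_comp`), and these to oracle machines (`reach_of_exec`). By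
`hasTuringCompression_of_eval` it then suffices to evaluate the loop program, which is done in
`Sound.eval_work` and `eval_algorithm`. -/

set_option linter.unusedSectionVars false

/-! ### A structured language for stack machines -/

namespace StackLang

open Turing

variable {K σ : Type}

/-- A state of a stack program: the internal state and the contents of the stacks. -/
abbrev St (K σ : Type) : Type := σ × (K → List Bool)

/-- Elementary stack operations. -/
inductive Op (K σ : Type) : Type
  | push (k : K) (f : σ → Bool)
  | pop (k : K) (f : σ → Option Bool → σ)
  | peek (k : K) (f : σ → Option Bool → σ)
  | load (f : σ → σ)

/-- The effect of an elementary operation. -/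
def Op.run [DecidableEq K] : Op K σ → St K σ → St K σ
  | .push k f, s => (s.1, Function.update s.2 k (f s.1 :: s.2 k))
  | .pop k f, s => (f s.1 (s.2 k).head?, Function.update s.2 k (s.2 k).tail)
  | .peek k f, s => (f s.1 (s.2 k).head?, s.2)
  | .load f, s => (f s.1, s.2)

/-- The effect of a list of elementary operations. -/
def runOps [DecidableEq K] : List (Op K σ) → St K σ → St K σ
  | [], s => s
  | o :: l, s => runOps l (o.run s)

/-- Structured stack programs with oracle calls. -/
inductive Prog (K σ : Type) : Type
  | ops (l : List (Op K σ))
  | seq (p q : Prog K σ)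
  | cond (l : List (Op K σ)) (b : σ → Bool) (p q : Prog K σ)
  | loop (l : List (Op K σ)) (b : σ → Bool) (p : Prog K σ)
  | ask

/-- Fixed data of a program: the query stack, and how the answer of an oracle call enters the
internal state. -/
structure Iface (K σ : Type) where
  qry : K
  ans : Bool → σ → σ

open Classical in
/-- Big-step semantics with the number of steps; all queries have length at most `B`. -/
inductive Exec [DecidableEq K] (A : Iface K σ) (L : Language Bool) (B : ℕ) :
    Prog K σ → St K σ → St K σ → ℕ → Prop
  | ops (l s) : Exec A L B (.ops l) s (runOps l s) 1
  | seq {p q s s' s'' t t'} : Exec A L B p s s' t → Exec A L B q s' s'' t' →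
      Exec A L B (.seq p q) s s'' (t + t')
  | condT {l b p q s s' t} : b (runOps l s).1 = true → Exec A L B p (runOps l s) s' t →
      Exec A L B (.cond l b p q) s s' (1 + t)
  | condF {l b p q s s' t} : b (runOps l s).1 = false → Exec A L B q (runOps l s) s' t →
      Exec A L B (.cond l b p q) s s' (1 + t)
  | loopT {l b p s s' s'' t t'} : b (runOps l s).1 = true → Exec A L B p (runOps l s) s' t →
      Exec A L B (.loop l b p) s' s'' t' → Exec A L B (.loop l b p) s s'' (1 + t + t')
  | loopF {l b p s} : b (runOps l s).1 = false → Exec A L B (.loop l b p) s (runOps l s) 1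
  | ask (s) : (s.2 A.qry).length ≤ B →
      Exec A L B .ask s (A.ans (decide (s.2 A.qry ∈ L)) s.1, Function.update s.2 A.qry []) 3

theorem Exec.of_eq [DecidableEq K] {A : Iface K σ} {L : Language Bool} {B : ℕ} {p : Prog K σ}
    {s s' s'' : St K σ} {t : ℕ} (h : Exec A L B p s s' t) (e : s' = s'') : Exec A L B p s s'' t :=
  e ▸ h

theorem Exec.mono [DecidableEq K] {A : Iface K σ} {L : Language Bool} {B B' : ℕ} (hB : B ≤ B') {p : Prog K σ}
    {s s' : St K σ} {t : ℕ} (h : Exec A L B p s s' t) : Exec A L B' p s s' t := by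
  induction h with
  | ops l s => exact .ops l s
  | seq _ _ h1 h2 => exact .seq h1 h2
  | condT hb _ h => exact .condT hb h
  | condF hb _ h => exact .condF hb h
  | loopT hb _ _ h1 h2 => exact .loopT hb h1 h2
  | loopF hb => exact .loopF hb
  | ask s h => exact .ask s (h.trans hB)

/-- The labels of a program. -/
def Lab : Prog K σ → Type
  | .ops _ => Unit
  | .seq p q => Lab p ⊕ Lab q
  | .cond _ _ p q => Option (Lab p ⊕ Lab q)
  | .loop _ _ p => Option (Lab p)
  | .ask => Unit

theorem finite_lab (p : Prog K σ) : Finite (Lab p) := by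
  induction p with
  | ops l => exact inferInstanceAs (Finite Unit)
  | seq p q hp hq => exact inferInstanceAs (Finite (Lab p ⊕ Lab q))
  | cond l b p q hp hq => exact inferInstanceAs (Finite (Option (Lab p ⊕ Lab q)))
  | loop l b p hp => exact inferInstanceAs (Finite (Option (Lab p)))
  | ask => exact inferInstanceAs (Finite Unit)

/-- The label where a program starts. -/
def entry : (p : Prog K σ) → Lab p
  | .ops _ => ()
  | .seq p _ => Sum.inl (entry p)
  | .cond _ _ _ _ => none
  | .loop _ _ _ => none
  | .ask => ()

/-! ### Translation of structured programs into machine statements. -/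

section Code

variable {Λ : Type}

/-- The machine statement that performs some elementary operations first. -/
def opsStmt (Λ : Type) : List (Op K σ) → TM2.Stmt (fun _ : K => Bool) Λ (σ × Λ) →
    TM2.Stmt (fun _ : K => Bool) Λ (σ × Λ)
  | [], q => q
  | .push k f :: l, q => .push k (fun v => f v.1) (opsStmt Λ l q)
  | .pop k f :: l, q => .pop k (fun v o => (f v.1 o, v.2)) (opsStmt Λ l q)
  | .peek k f :: l, q => .peek k (fun v o => (f v.1 o, v.2)) (opsStmt Λ l q)
  | .load f :: l, q => .load (fun v => (f v.1, v.2)) (opsStmt Λ l q)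

/-- The machine code of a program, whose labels are embedded by `e`, that exits to the label `x`.
The second component of the internal state is the return label of an oracle call. -/
def code (ask : Λ) : (p : Prog K σ) → (Lab p → Λ) → Λ → Lab p →
    TM2.Stmt (fun _ : K => Bool) Λ (σ × Λ)
  | .ops l, _, x => fun _ => opsStmt Λ l (.goto fun _ => x)
  | .seq p q, e, x => Sum.elim (code ask p (e ∘ Sum.inl) (e (Sum.inr (entry q))))
      (code ask q (e ∘ Sum.inr) x)
  | .cond l b p q, e, x => fun
      | none => opsStmt Λ l (.branch (fun v => b v.1)
          (.goto fun _ => e (some (Sum.inl (entry p)))) (.goto fun _ => e (some (Sum.inr (entry q)))))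
      | some (Sum.inl y) => code ask p (e ∘ some ∘ Sum.inl) x y
      | some (Sum.inr y) => code ask q (e ∘ some ∘ Sum.inr) x y
  | .loop l b p, e, x => fun
      | none => opsStmt Λ l (.branch (fun v => b v.1)
          (.goto fun _ => e (some (entry p))) (.goto fun _ => x))
      | some y => code ask p (e ∘ some) (e none) y
  | .ask, _, x => fun _ => .load (fun v => (v.1, x)) (.goto fun _ => ask)

theorem stepAux_opsStmt [DecidableEq K] (l : List (Op K σ)) (q : TM2.Stmt (fun _ : K => Bool) Λ (σ × Λ))
    (s : St K σ) (r : Λ) :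
    TM2.stepAux (opsStmt Λ l q) (s.1, r) s.2 =
      TM2.stepAux q ((runOps l s).1, r) (runOps l s).2 := by
  induction l generalizing s with
  | nil => rfl
  | cons o l ih =>
    cases o with
    | push k f => exact ih (Op.run (.push k f) s)
    | pop k f => exact ih (Op.run (.pop k f) s)
    | peek k f => exact ih (Op.run (.peek k f) s)
    | load f => exact ih (Op.run (.load f) s)

end Code

/-- The labels of the machine of a program: those of the program, and the labels for halting, for
an oracle call, and for its two answers. -/
abbrev MLab (p : Prog K σ) : Type := Lab p ⊕ (Unit ⊕ Option Bool)

/-- The oracle machine of a program. -/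
noncomputable def machine [DecidableEq K] [Fintype K] [Fintype σ] (A : Iface K σ) (p : Prog K σ) (inp : K)
    (start : σ) (accept : σ → Bool) : OracleTM :=
  haveI := finite_lab p
  haveI := Fintype.ofFinite (Lab p)
  { K := K
    Γ := Bool
    Λ := MLab p
    σ := σ × MLab p
    bit := Function.Embedding.refl Bool
    inp := inp
    qry := A.qry
    main := Sum.inl (entry p)
    -- The return label is a dummy here; every oracle call overwrites it before it is used.
    start := (start, Sum.inr (Sum.inl ()))
    ask := Sum.inr (Sum.inr none)
    yes := Sum.inr (Sum.inr (some true))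
    no := Sum.inr (Sum.inr (some false))
    prog := Sum.elim (code (Sum.inr (Sum.inr none)) p Sum.inl (Sum.inr (Sum.inl ())))
      (Sum.elim (fun _ => .halt) fun
        -- This statement is never executed: at the label `ask` the function `OracleTM.next`
        -- performs the oracle call instead.
        | none => .halt
        | some b => .load (fun v => (A.ans b v.1, v.2)) (.goto fun v => v.2))
    accept := fun v => accept v.1 }

/-- The machine `M` gets from `c` to `c'` in `t` steps, with queries of length at most `B`. -/
def Reach (M : OracleTM) (L : Language M.Γ) (B : ℕ) (c c' : M.Cfg) (t : ℕ) : Prop :=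
  (M.next L)^[t] c = c' ∧ ∀ i < t, ((M.next L)^[i] c).l = some M.ask →
    (((M.next L)^[i] c).stk M.qry).length ≤ B

theorem next_of_mem {M : OracleTM} {L : Language M.Γ} {c : M.Cfg} (h : c.l = some M.ask)
    (hc : c.stk M.qry ∈ L) :
    M.next L c = ⟨some M.yes, c.var, Function.update c.stk M.qry []⟩ := by
  rw [OracleTM.next, if_pos h, if_pos hc]

theorem next_of_notMem {M : OracleTM} {L : Language M.Γ} {c : M.Cfg} (h : c.l = some M.ask)
    (hc : c.stk M.qry ∉ L) :
    M.next L c = ⟨some M.no, c.var, Function.update c.stk M.qry []⟩ := by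
  rw [OracleTM.next, if_pos h, if_neg hc]

theorem next_of_ne_ask {M : OracleTM} {L : Language M.Γ} {c : M.Cfg} (h : c.l ≠ some M.ask) :
    M.next L c = (TM2.step M.prog c).getD c := by
  rw [OracleTM.next, if_neg h]

theorem Reach.trans {M : OracleTM} {L : Language M.Γ} {B : ℕ} {c c' c'' : M.Cfg} {t t' : ℕ}
    (h : Reach M L B c c' t) (h' : Reach M L B c' c'' t') : Reach M L B c c'' (t + t') := by
  refine ⟨?_, fun i hi => ?_⟩
  · rw [Nat.add_comm, Function.iterate_add_apply, h.1, h'.1]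
  · rcases lt_or_ge i t with hit | hit
    · exact h.2 i hit
    · obtain ⟨j, rfl⟩ := Nat.exists_eq_add_of_le hit
      have := h'.2 j (by omega)
      rw [← h.1, ← Function.iterate_add_apply, Nat.add_comm] at this
      exact this

theorem Reach.one {M : OracleTM} {L : Language M.Γ} {B : ℕ} {c c' : M.Cfg}
    (h : M.next L c = c') (h' : c.l = some M.ask → (c.stk M.qry).length ≤ B) :
    Reach M L B c c' 1 := by
  refine ⟨h, fun i hi => ?_⟩
  obtain rfl : i = 0 := by omega
  exact h'

/-! ### The machine simulates the big-step semantics. -/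

section Simulation

variable [DecidableEq K] [Fintype K] [Fintype σ] (A : Iface K σ) (p₀ : Prog K σ) (inp : K) (start : σ)
  (accept : σ → Bool) (L : Language Bool)

/-- The configuration of the machine at a label. -/
def cfgAt (x : MLab p₀) (s : St K σ) (r : MLab p₀) : (machine A p₀ inp start accept).Cfg :=
  ⟨some x, (s.1, r), s.2⟩

/-- Labels of the program proper lie in the left summand and so differ from `ask`; hence no oracle
call intervenes. -/
theorem next_cfgAt (x : Lab p₀) (s : St K σ) (r : MLab p₀) :
    (machine A p₀ inp start accept).next L (cfgAt A p₀ inp start accept (Sum.inl x) s r) =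
      TM2.stepAux (code (Sum.inr (Sum.inr none)) p₀ Sum.inl (Sum.inr (Sum.inl ())) x)
        (s.1, r) s.2 := by
  refine (next_of_ne_ask ?_).trans ?_
  rotate_left
  · rfl
  · intro h
    have h := Option.some.inj h
    cases h

theorem reach_of_stepAux {x : Lab p₀} {s : St K σ} {r : MLab p₀} {B : ℕ}
    {c' : (machine A p₀ inp start accept).Cfg}
    (h : TM2.stepAux (code (Sum.inr (Sum.inr none)) p₀ Sum.inl (Sum.inr (Sum.inl ())) x)
        (s.1, r) s.2 = c') :
    Reach (machine A p₀ inp start accept) L B (cfgAt A p₀ inp start accept (Sum.inl x) s r)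
      c' 1 := by
  refine Reach.one ((next_cfgAt ..).trans h) fun h => ?_
  have h := Option.some.inj h
  cases h

/-- Induction on the big-step derivation, generalized to subprograms: `e` embeds the labels of `p`
into those of the whole program, `x` is the label where `p` exits, and `he` says that the whole code
restricts to the code of `p`. The return label `r'` is existential because oracle calls change it.
-/
theorem reach_of_exec {B : ℕ} {p : Prog K σ} {s s' : St K σ} {t : ℕ}
    (h : Exec A L B p s s' t) (e : Lab p → Lab p₀) (x : MLab p₀)
    (he : ∀ y, code (Sum.inr (Sum.inr none)) p₀ Sum.inl (Sum.inr (Sum.inl ())) (e y) =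
      code (Sum.inr (Sum.inr none)) p (Sum.inl ∘ e) x y) (r : MLab p₀) :
    ∃ r', Reach (machine A p₀ inp start accept) L B
      (cfgAt A p₀ inp start accept (Sum.inl (e (entry p))) s r)
      (cfgAt A p₀ inp start accept x s' r') t := by
  induction h generalizing x r with
  | ops l s =>
    refine ⟨r, reach_of_stepAux _ _ _ _ _ _ ?_⟩
    rw [he]
    exact stepAux_opsStmt ..
  | @seq p q s s' s'' t t' _ _ h1 h2 =>
    obtain ⟨r1, h1⟩ := h1 (e ∘ Sum.inl) (Sum.inl (e (Sum.inr (entry q)))) (fun y => he _) r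
    obtain ⟨r2, h2⟩ := h2 (e ∘ Sum.inr) x (fun y => he _) r1
    exact ⟨r2, h1.trans h2⟩
  | @condT l b p q s s' t hb _ h =>
    obtain ⟨r1, h⟩ := h (e ∘ some ∘ Sum.inl) x (fun y => he _) r
    refine ⟨r1, Reach.trans (reach_of_stepAux _ _ _ _ _ _ ?_) h⟩
    rw [he]
    refine (stepAux_opsStmt ..).trans ?_
    simp only [TM2.stepAux, hb, cond_true]
    rfl
  | @condF l b p q s s' t hb _ h =>
    obtain ⟨r1, h⟩ := h (e ∘ some ∘ Sum.inr) x (fun y => he _) r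
    refine ⟨r1, Reach.trans (reach_of_stepAux _ _ _ _ _ _ ?_) h⟩
    rw [he]
    refine (stepAux_opsStmt ..).trans ?_
    simp only [TM2.stepAux, hb, cond_false]
    rfl
  | @loopT l b p s s' s'' t t' hb _ _ h1 h2 =>
    obtain ⟨r1, h1⟩ := h1 (e ∘ some) (Sum.inl (e none)) (fun y => he _) r
    -- The body exits to the head of the loop, so the remaining rounds are the same loop with the
    -- same embedding and exit.
    obtain ⟨r2, h2⟩ := h2 e x he r1
    refine ⟨r2, Reach.trans (Reach.trans (reach_of_stepAux _ _ _ _ _ _ ?_) h1) h2⟩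
    rw [he]
    refine (stepAux_opsStmt ..).trans ?_
    simp only [TM2.stepAux, hb, cond_true]
    rfl
  | @loopF l b p s hb =>
    refine ⟨r, reach_of_stepAux _ _ _ _ _ _ ?_⟩
    rw [he]
    refine (stepAux_opsStmt ..).trans ?_
    simp only [TM2.stepAux, hb, cond_false]
    rfl
  | ask s hs =>
    classical
    -- The three steps of a call: store the return label and go to `ask`; the oracle's answer;
    -- process the answer and jump back.
    refine ⟨x, Reach.trans (t := 2) (c' := cfgAt A p₀ inp start accept
        (Sum.inr (Sum.inr (some (decide (s.2 A.qry ∈ L)))))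
        (s.1, Function.update s.2 A.qry []) x)
      (Reach.trans (t := 1) (c' := cfgAt A p₀ inp start accept (Sum.inr (Sum.inr none)) s x)
        (reach_of_stepAux _ _ _ _ _ _ ?_) (Reach.one ?_ fun _ => hs)) (Reach.one ?_ fun h => ?_)⟩
    · rw [he]
      rfl
    · by_cases h : s.2 A.qry ∈ L
      · rw [decide_eq_true h]
        exact next_of_mem rfl h
      · rw [decide_eq_false h]
        exact next_of_notMem rfl h
    · refine (next_of_ne_ask ?_).trans ?_
      rotate_left
      · rfl
      · intro h
        have h := Option.some.inj h
        cases h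
    · have h := Option.some.inj h
      cases h

end Simulation

/-- A language that is decided by a stack program with small queries has a Turing compression. -/
theorem hasTuringCompression_of_exec [DecidableEq K] [Fintype K] [Fintype σ] {A : Iface K σ} {p : Prog K σ}
    {inp : K} {start : σ} {accept : σ → Bool} {L : Language Bool} {T : Polynomial ℕ}
    {f : ℕ → ℕ} {Q : ParamProblem}
    (h : ∀ x k, ∃ t ≤ T.eval (x.length + k), ∃ s',
      Exec A L (f k) p (start, Function.update (fun _ => []) inp (instanceWord x k)) s' t ∧
      (accept s'.1 = true ↔ (x, k) ∈ Q)) : HasTuringCompression Q f := by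
  -- The extra step leads from the exit label to the halted configuration.
  refine ⟨machine A p inp start accept, L, T + 1, fun x k => ?_⟩
  obtain ⟨t, ht, s', hs', hacc⟩ := h x k
  obtain ⟨r, hr⟩ := reach_of_exec A p inp start accept L hs' id (Sum.inr (Sum.inl ()))
    (fun y => rfl) (Sum.inr (Sum.inl ()))
  have hinit : (machine A p inp start accept).init (instanceWord x k) =
      cfgAt A p inp start accept (Sum.inl (entry p))
        (start, Function.update (fun _ => []) inp (instanceWord x k)) (Sum.inr (Sum.inl ())) := by
    have : (instanceWord x k).map (Function.Embedding.refl Bool) = instanceWord x k :=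
      List.map_id _
    exact congrArg (fun w => cfgAt A p inp start accept (Sum.inl (entry p))
        (start, Function.update (fun _ => []) inp w) (Sum.inr (Sum.inl ()))) this
  set M := machine A p inp start accept with hM
  set c' := cfgAt A p inp start accept (Sum.inr (Sum.inl ())) s' r with hc'
  have hnext : M.next L c' = ⟨none, c'.var, c'.stk⟩ := by
    refine (next_of_ne_ask ?_).trans ?_
    rotate_left
    · rfl
    · intro h
      have h := Option.some.inj h
      cases h
  have hhalt : ∀ j, (M.next L)^[j] ⟨none, c'.var, c'.stk⟩ = ⟨none, c'.var, c'.stk⟩ := by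
    refine fun j => Function.iterate_fixed ?_ j
    exact next_of_ne_ask (by simp)
  have hrun' : ∀ j, M.run L (instanceWord x k) j = (M.next L)^[j] (M.init (instanceWord x k)) :=
    fun j => rfl
  have hrun : ∀ j, M.run L (instanceWord x k) (j + 1 + t) = ⟨none, c'.var, c'.stk⟩ := by
    intro j
    rw [hrun', Function.iterate_add_apply, hinit]
    erw [hr.1]
    rw [Function.iterate_add_apply, Function.iterate_one, hnext, hhalt]
  refine ⟨⟨0 + 1 + t, by simp; omega, ?_⟩, fun j hj => ?_⟩
  · rw [hrun]
    exact ⟨rfl, hacc⟩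
  -- Queries before time `t` are bounded by the simulation; at time `t` the label is the exit label;
  -- afterwards the machine has halted.
  · rcases lt_trichotomy j t with hjt | rfl | hjt
    · rw [hrun', hinit] at hj ⊢
      exact hr.2 j hjt hj
    · rw [hrun', hinit] at hj
      erw [hr.1] at hj
      have h := Option.some.inj hj
      cases h
    · obtain ⟨i, rfl⟩ := Nat.exists_eq_add_of_lt hjt
      rw [show t + i + 1 = i + 1 + t by omega, hrun] at hj
      cases hj

end StackLang

/-! ### A language of bounded loops -/

namespace LoopLang

open StackLang

/-- Programs of a language with bounded loops over the index variables `I`, with counters `C`,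
Boolean arrays `A` and flags `F`. -/
inductive HProg (I C A F : Type) : Type
  | skip
  | seq (p q : HProg I C A F)
  | setF (f : F) (b : Bool)
  | ifF (f : F) (p q : HProg I C A F)
  | ifLt (a b : I ⊕ C) (p q : HProg I C A F)
  | ifRd (x : A) (j : I ⊕ C) (p q : HProg I C A F)
  | wr (x : A) (j : I ⊕ C) (b : Bool)
  | reset (c : C)
  | inc (c : C)
  | push (b : Bool)
  | ifAsk (p q : HProg I C A F)
  | popIn (p q r : HProg I C A F)
  | loop (i : I) (p : HProg I C A F)

/-- States of loop programs; `maxq` bounds the lengths of the queries so far. -/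
structure HS (C A F : Type) where
  inp : List Bool
  qry : List Bool
  arr : A → ℕ → Bool
  cnt : C → ℕ
  flag : F → Bool
  maxq : ℕ

/-- The `n`-fold iteration of a function that also depends on the number of the round. -/
def iter {X : Type} (f : ℕ → X → X) : ℕ → X → X
  | 0, s => s
  | n + 1, s => f n (iter f n s)

/-- The invariant rule for bounded loops, on which most statements about loops below rest. -/
theorem iter_induction {X : Type} {f : ℕ → X → X} (P : ℕ → X → Prop) {s : X} {N : ℕ} (h0 : P 0 s)
    (h : ∀ j < N, ∀ s, P j s → P (j + 1) (f j s)) : P N (iter f N s) := by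
  have : ∀ n ≤ N, P n (iter f n s) := by
    intro n
    induction n with
    | zero => exact fun _ => h0
    | succ n ih => exact fun hn => h n hn _ (ih (by omega))
  exact this N le_rfl

variable {I C A F : Type} [DecidableEq I] [DecidableEq C] [DecidableEq A] [DecidableEq F]

/-- The value of an index variable or counter. -/
def val (env : I → ℕ) (s : HS C A F) : I ⊕ C → ℕ := Sum.elim env s.cnt

open Classical in
/-- The effect of a program; loops run from `0` to `N - 1`, counters are capped at `N`. -/
noncomputable def eval (L : Language Bool) (N : ℕ) :
    HProg I C A F → (I → ℕ) → HS C A F → HS C A F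
  | .skip, _, s => s
  | .seq p q, env, s => eval L N q env (eval L N p env s)
  | .setF f b, _, s => { s with flag := Function.update s.flag f b }
  | .ifF f p q, env, s => if s.flag f = true then eval L N p env s else eval L N q env s
  | .ifLt a b p q, env, s =>
      if val env s a < val env s b then eval L N p env s else eval L N q env s
  | .ifRd x j p q, env, s =>
      if s.arr x (val env s j) = true then eval L N p env s else eval L N q env s
  | .wr x j b, env, s =>
      { s with arr := Function.update s.arr x (Function.update (s.arr x) (val env s j) b) }
  | .reset c, _, s => { s with cnt := Function.update s.cnt c 0 }
  | .inc c, _, s => { s with cnt := Function.update s.cnt c (min N (s.cnt c + 1)) }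
  | .push b, _, s => { s with qry := b :: s.qry }
  | .ifAsk p q, env, s =>
      if s.qry ∈ L then eval L N p env { s with qry := [], maxq := max s.maxq s.qry.length }
      else eval L N q env { s with qry := [], maxq := max s.maxq s.qry.length }
  | .popIn p q r, env, s =>
      match s.inp with
      | [] => eval L N p env s
      | false :: l => eval L N q env { s with inp := l }
      | true :: l => eval L N r env { s with inp := l }
  | .loop i p, env, s => iter (fun j s => eval L N p (Function.update env i j) s) N s

/-- Well-formed programs, where the index variables in `b` are already in use. -/
def wf : HProg I C A F → List I → Bool
  | .skip, _ => true
  | .seq p q, b => wf p b && wf q b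
  | .setF _ _, _ => true
  | .ifF _ p q, b => wf p b && wf q b
  -- The compiled comparison pops two stacks in parallel, which must be different.
  | .ifLt x y p q, b => decide (x ≠ y) && wf p b && wf q b
  | .ifRd _ _ p q, b => wf p b && wf q b
  | .wr _ _ _, _ => true
  | .reset _, _ => true
  | .inc _, _ => true
  | .push _, _ => true
  | .ifAsk p q, b => wf p b && wf q b
  | .popIn p q r, b => wf p b && wf q b && wf r b
  -- A loop starts with its index at zero and returns it to zero, so it cannot share the index with
  -- an enclosing loop.
  | .loop i p, b => decide (i ∉ b) && wf p (i :: b)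

/-- Values up to `N` are what the pair of stacks `lo`, `hi` of total height `N` can represent. -/
theorem eval_cnt_le (L : Language Bool) (N : ℕ) (p : HProg I C A F) (env : I → ℕ) (s : HS C A F)
    (h : ∀ c, s.cnt c ≤ N) : ∀ c, (eval L N p env s).cnt c ≤ N := by
  induction p generalizing env s with
  | skip => exact h
  | seq p q hp hq => exact hq _ _ (hp _ _ h)
  | setF f b => exact h
  | ifF f p q hp hq => rw [eval]; split_ifs; exacts [hp _ _ h, hq _ _ h]
  | ifLt a b p q hp hq => rw [eval]; split_ifs; exacts [hp _ _ h, hq _ _ h]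
  | ifRd x j p q hp hq => rw [eval]; split_ifs; exacts [hp _ _ h, hq _ _ h]
  | wr x j b => exact h
  | reset c =>
    intro c'
    by_cases hc : c' = c
    · subst hc; simp [eval]
    · simpa [eval, hc] using h c'
  | inc c =>
    intro c'
    by_cases hc : c' = c
    · subst hc; simp [eval]
    · simpa [eval, hc] using h c'
  | push b => exact h
  | ifAsk p q hp hq => rw [eval]; split_ifs; exacts [hp _ _ h, hq _ _ h]
  | popIn p q r hp hq hr => rw [eval]; split; exacts [hp _ _ h, hq _ _ h, hr _ _ h]
  | loop i p hp =>
    exact iter_induction (fun _ s => ∀ c, HS.cnt s c ≤ N) h fun j _ s hs => hp _ _ hs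

/-- Because of this, the final value of `maxq` bounds all queries of a run, and the executions of
its parts can be weakened to one common bound. -/
theorem maxq_le_eval (L : Language Bool) (N : ℕ) (p : HProg I C A F) (env : I → ℕ) (s : HS C A F) :
    s.maxq ≤ (eval L N p env s).maxq := by
  induction p generalizing env s with
  | skip => exact le_rfl
  | seq p q hp hq => exact (hp _ _).trans (hq _ _)
  | setF f b => exact le_rfl
  | ifF f p q hp hq => rw [eval]; split_ifs; exacts [hp _ _, hq _ _]
  | ifLt a b p q hp hq => rw [eval]; split_ifs; exacts [hp _ _, hq _ _]
  | ifRd x j p q hp hq => rw [eval]; split_ifs; exacts [hp _ _, hq _ _]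
  | wr x j b => exact le_rfl
  | reset c => exact le_rfl
  | inc c => exact le_rfl
  | push b => exact le_rfl
  | ifAsk p q hp hq =>
    rw [eval]
    split_ifs
    exacts [(le_max_left _ _).trans (hp env { s with qry := [], maxq := _ }),
      (le_max_left _ _).trans (hq env { s with qry := [], maxq := _ })]
  | popIn p q r hp hq hr =>
    rw [eval]
    split
    · exact hp _ _
    · rename_i l _
      exact hq env { s with inp := l }
    · rename_i l _
      exact hr env { s with inp := l }
  | loop i p hp =>
    exact iter_induction (fun _ s' => s.maxq ≤ HS.maxq s') le_rfl
      fun j _ s hs => hs.trans (hp _ _)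

/-! ### Compilation to stack programs -/

/-- The stacks of a compiled program: for an index variable or counter `j`, the length of `hi j` is
its value, and the length of `lo j` is `N` minus its value. -/
inductive Stk (I C A : Type) : Type
  | inp
  | qry
  | arr (x : A)
  | lo (j : I ⊕ C)
  | hi (j : I ⊕ C)
  | t1
  | t2
  deriving DecidableEq, Fintype

/-- The internal states of a compiled program: the flags and two registers. -/
abbrev Reg (F : Type) : Type := (F → Bool) × Option Bool × Bool

/-- The register for the result of a pop operation. -/
def setX (v : Reg F) (o : Option Bool) : Reg F := (v.1, o, v.2.2)

/-- The register for the result of a test. -/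
def setR (v : Reg F) (b : Bool) : Reg F := (v.1, v.2.1, b)

/-- Whether the last pop operation has found a symbol. -/
def isX (v : Reg F) : Bool := v.2.1.isSome

/-- The last symbol that was popped. -/
def getX (v : Reg F) : Bool := v.2.1.getD false

/-- The interface of compiled programs. -/
def iface (I C A F : Type) : Iface (Stk I C A) (Reg F) := ⟨.qry, fun b v => setR v b⟩

/-- Pour one stack onto another one. -/
def pour {K : Type} (a b : K) : Prog K (Reg F) :=
  .loop [.pop a setX] isX (.ops [.push b getX])

/-- Move as many symbols from `c` to `d` as there are on `a`, and empty `a` onto `b`. -/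
def walk {K : Type} (a b c d : K) : Prog K (Reg F) :=
  .loop [.pop a setX] isX
    (.cond [.push b fun _ => false, .pop c setX] isX (.ops [.push d getX]) (.ops []))

/-- Perform operations on the stack `c` at the position that is the length of the stack `a`. -/
def probe (a c : Stk I C A) (o : List (Op (Stk I C A) (Reg F))) : Prog (Stk I C A) (Reg F) :=
  .seq (walk a .t1 c .t2) (.seq (.ops o) (.seq (pour .t1 a) (pour .t2 c)))

/-- Compilation of loop programs to stack programs. -/
def comp : HProg I C A F → Prog (Stk I C A) (Reg F)
  | .skip => .ops []
  | .seq p q => .seq (comp p) (comp q)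
  | .setF f b => .ops [.load fun v => (Function.update v.1 f b, v.2)]
  | .ifF f p q => .cond [] (fun v => v.1 f) (comp p) (comp q)
  | .ifLt a b p q => .seq (probe (.hi a) (.hi b) [.peek (.hi b) fun v o => setR v o.isSome])
      (.cond [] (fun v => v.2.2) (comp p) (comp q))
  | .ifRd x j p q =>
      .seq (probe (.hi j) (.arr x) [.peek (.arr x) fun v o => setR v (o.getD false)])
        (.cond [] (fun v => v.2.2) (comp p) (comp q))
  | .wr x j b => probe (.hi j) (.arr x) [.pop (.arr x) fun v _ => v, .push (.arr x) fun _ => b]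
  | .reset c => pour (.hi (.inr c)) (.lo (.inr c))
  | .inc c => .cond [.pop (.lo (.inr c)) setX] isX (.ops [.push (.hi (.inr c)) fun _ => false])
      (.ops [])
  | .push b => .ops [.push .qry fun _ => b]
  | .ifAsk p q => .seq .ask (.cond [] (fun v => v.2.2) (comp p) (comp q))
  | .popIn p q r => .cond [.pop .inp setX] isX (.cond [] getX (comp r) (comp q)) (comp p)
  | .loop i p =>
      .seq (.loop [.peek (.lo (.inl i)) setX] isX
          (.seq (comp p) (.ops [.pop (.lo (.inl i)) setX, .push (.hi (.inl i)) fun _ => false])))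
        (pour (.hi (.inl i)) (.lo (.inl i)))

/-- The stacks that represent a state. -/
def repStk (N : ℕ) (env : I → ℕ) (s : HS C A F) : Stk I C A → List Bool
  | .inp => s.inp
  | .qry => s.qry
  | .arr x => (List.range (N + 1)).map (s.arr x)
  | .lo j => List.replicate (N - val env s j) false
  | .hi j => List.replicate (val env s j) false
  | .t1 => []
  | .t2 => []

/-! ### Running time and effect of the basic stack manipulations. -/

section Exec

variable {K : Type} [DecidableEq K] {J : Iface K (Reg F)} {L : Language Bool} {B : ℕ}

theorem exec_pour {a b : K} (hab : a ≠ b) (v : Reg F) (g : K → List Bool) :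
    ∃ t ≤ 2 * (g a).length + 1, Exec J L B (pour a b) (v, g)
      (setX v none, Function.update (Function.update g a []) b ((g a).reverse ++ g b)) t := by
  induction h : g a generalizing v g with
  | nil =>
    refine ⟨1, by simp, ?_⟩
    refine (Exec.loopF (by simp [runOps, Op.run, h, isX, setX])).of_eq ?_
    simp [runOps, Op.run, h, setX, Function.update_of_ne hab.symm]
  | cons y l ih =>
    obtain ⟨t, ht, ht'⟩ := ih (setX v (some y))
      (Function.update (Function.update g a l) b (y :: g b)) (by simp [hab])
    refine ⟨1 + 1 + t, by simp; omega, ?_⟩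
    refine (Exec.loopT (s' := (setX v (some y),
      Function.update (Function.update g a l) b (y :: g b))) ?_ ?_ ?_)
    · simp [runOps, Op.run, h, isX, setX]
    · refine (Exec.ops _ _).of_eq ?_
      simp [runOps, Op.run, h, setX, getX, hab.symm]
    · refine ht'.of_eq ?_
      simp only [Prod.mk.injEq]
      refine ⟨rfl, ?_⟩
      funext k
      by_cases hb : k = b
      · subst hb; simp
      · by_cases ha : k = a
        · subst ha; simp [hb]
        · simp [ha, hb]

/-- The stack `a` serves as a unary number. If `c` is shorter than `a`, the walk continues without
moving symbols, which agrees with the truncating behaviour of `take` and `drop`. -/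
theorem exec_walk {a b c d : K} (hab : a ≠ b) (hac : a ≠ c) (had : a ≠ d) (hbc : b ≠ c)
    (hbd : b ≠ d) (hcd : c ≠ d) (m : ℕ) (v : Reg F) (g : K → List Bool)
    (hm : g a = List.replicate m false) :
    ∃ t ≤ 3 * m + 1, Exec J L B (walk a b c d) (v, g)
      (setX v none, Function.update (Function.update (Function.update (Function.update g a [])
        b (List.replicate m false ++ g b)) c ((g c).drop m)) d (((g c).take m).reverse ++ g d))
        t := by
  induction m generalizing v g with
  | zero =>
    refine ⟨1, by simp, ?_⟩
    refine (Exec.loopF (by simp [runOps, Op.run, hm, isX, setX])).of_eq ?_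
    simp [runOps, Op.run, hm, setX]
    funext k
    by_cases ha : k = a
    · subst ha; simp [hab, hac, had]
    · simp only [Function.update_apply, ha, if_false]
      split_ifs <;> simp_all
  | succ m ih =>
    -- The state after one round is kept opaque, with its description in `hg'`, so that both cases
    -- for `c` share it.
    obtain ⟨x, g', hg', hx⟩ : ∃ x, ∃ g', g' = Function.update (Function.update (Function.update
      (Function.update g a (List.replicate m false)) b (false :: g b)) c ((g c).drop 1))
      d (((g c).take 1).reverse ++ g d) ∧ x = (g c).head? := ⟨_, _, rfl, rfl⟩
    obtain ⟨t, ht, ht'⟩ := ih (setX v x) g' (by rw [hg']; simp [hab, hac, had])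
    refine ⟨1 + (1 + 1) + t, by omega, ?_⟩
    refine (Exec.loopT (s' := (setX v x, g')) ?_ ?_ ?_)
    · simp [runOps, Op.run, hm, isX, setX, List.replicate_succ]
    · cases hc : g c with
      | nil =>
        refine Exec.condF ?_ ?_
        · simp [runOps, Op.run, isX, setX, hac.symm, hbc.symm, hc]
        · refine (Exec.ops _ _).of_eq ?_
          simp only [runOps, Op.run, hm, Prod.mk.injEq]
          refine ⟨by simp [hx, hc, setX, hac.symm, hbc.symm], ?_⟩
          rw [hg']
          funext k
          simp only [Function.update_apply, hc]
          split_ifs <;> simp_all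
      | cons y l =>
        refine Exec.condT ?_ ?_
        · simp [runOps, Op.run, isX, setX, hac.symm, hbc.symm, hc]
        · refine (Exec.ops _ _).of_eq ?_
          simp only [runOps, Op.run, hm, Prod.mk.injEq]
          refine ⟨by simp [hx, hc, setX, hac.symm, hbc.symm], ?_⟩
          rw [hg']
          funext k
          simp only [Function.update_apply, hc]
          split_ifs <;> simp_all [getX, setX]
    · refine ht'.of_eq ?_
      simp only [Prod.mk.injEq]
      refine ⟨rfl, ?_⟩
      rw [hg']
      funext k
      simp only [Function.update_apply]
      cases hc : g c with
      | nil => split_ifs <;> simp_all [List.replicate_succ']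
      | cons y l => split_ifs <;> simp_all [List.replicate_succ']

end Exec


/-- The representation of a state by a state of the stack program. -/
def rep (N : ℕ) (env : I → ℕ) (s : HS C A F) (x : Option Bool) (r : Bool) : St (Stk I C A) (Reg F) :=
  ((s.flag, x, r), repStk N env s)

/-- A bound for the running time of compiled programs. -/
noncomputable def cost : HProg I C A F → Polynomial ℕ
  | .skip => 1
  | .seq p q => cost p + cost q
  | .setF _ _ => 1
  | .ifF _ p q => 1 + cost p + cost q
  | .ifLt _ _ p q => 7 * Polynomial.X + 5 + cost p + cost q
  | .ifRd _ _ p q => 7 * Polynomial.X + 5 + cost p + cost q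
  | .wr _ _ _ => 7 * Polynomial.X + 4
  | .reset _ => 2 * Polynomial.X + 1
  | .inc _ => 2
  | .push _ => 1
  | .ifAsk p q => 4 + cost p + cost q
  | .popIn p q r => 2 + cost p + cost q + cost r
  | .loop _ p => Polynomial.X * (cost p + 2) + 1 + (2 * Polynomial.X + 1)

/-! ### Correctness and cost of the compilation. -/

section Correct

variable {L : Language Bool} {N B : ℕ} {env : I → ℕ} {s : HS C A F}

theorem take_append_cons_drop_map_range (f : ℕ → Bool) (m n : ℕ) (h : m < n) (b : Bool) :
    ((List.range n).map f).take m ++ b :: ((List.range n).map f).drop (m + 1) =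
      (List.range n).map (Function.update f m b) := by
  rw [← List.set_eq_take_cons_drop b (by simpa using h)]
  apply List.ext_getElem
  · simp
  · intro i h1 h2
    simp [List.getElem_set, Function.update_apply, eq_comm]

/-- Walking exposes the part of `c` from position `m` on, the operations `o` turn this part into
`l`, and pouring back undoes the reversal of the first `m` symbols. The time is `3m + 1` for the
walk, `1` for `o`, and at most `2m + 1` for each pouring. -/
theorem exec_probe {a c : Stk I C A} (hac : a ≠ c) (ha1 : a ≠ .t1) (ha2 : a ≠ .t2) (hc1 : c ≠ .t1)
    (hc2 : c ≠ .t2) {m : ℕ} (hm : m ≤ N) {v v' : Reg F} {g : Stk I C A → List Bool}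
    (ha : g a = List.replicate m false) (h1 : g .t1 = []) (h2 : g .t2 = [])
    {o : List (Op (Stk I C A) (Reg F))} {l : List Bool}
    (ho : ∀ g', g' c = (g c).drop m → runOps o (setX v none, g') = (v', Function.update g' c l)) :
    ∃ t ≤ 7 * N + 4, Exec (iface I C A F) L B (probe a c o) (v, g)
      (setX v' none, Function.update g c ((g c).take m ++ l)) t := by
  obtain ⟨t1, ht1, e1⟩ := exec_walk (J := iface I C A F) (L := L) (B := B) (b := .t1) (d := .t2)
    ha1 hac ha2 hc1.symm (by simp) hc2 m v g ha
  set g1 := Function.update (Function.update (Function.update (Function.update g a [])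
    .t1 (List.replicate m false ++ g .t1)) c ((g c).drop m)) .t2 (((g c).take m).reverse ++ g .t2)
    with hg1
  have e2 := (Exec.ops (A := iface I C A F) (L := L) (B := B) o (setX v none, g1)).of_eq
    (ho g1 (by simp [hg1, hc2]))
  obtain ⟨t3, ht3, e3⟩ := exec_pour (J := iface I C A F) (L := L) (B := B) (a := .t1) (b := a)
    ha1.symm v' (Function.update g1 c l)
  set g3 := Function.update (Function.update (Function.update g1 c l) .t1 []) a
    ((Function.update g1 c l .t1).reverse ++ Function.update g1 c l a) with hg3
  obtain ⟨t4, ht4, e4⟩ := exec_pour (J := iface I C A F) (L := L) (B := B) (a := .t2) (b := c)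
    hc2.symm (setX v' none) g3
  have l1 : Function.update g1 c l .t1 = List.replicate m false := by
    simp [hg1, hc1.symm, h1]
  have l2 : g3 .t2 = ((g c).take m).reverse := by
    simp [hg3, hg1, hc2.symm, ha2.symm, h2]
  rw [l1] at ht3
  rw [l2] at ht4
  simp only [List.length_replicate, List.length_reverse, List.length_take] at ht3 ht4
  refine ⟨t1 + (1 + (t3 + t4)), by omega, ?_⟩
  refine (e1.seq (e2.seq (e3.seq e4))).of_eq ?_
  simp only [Prod.mk.injEq]
  refine ⟨rfl, ?_⟩
  rw [l2, hg3, l1, hg1]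
  funext k
  simp only [Function.update_apply]
  split_ifs <;> simp_all

/-- Induction on the program. The list `b` holds the indices of the enclosing loops; all other
indices are zero, which is the state in which a loop expects its own index. -/
theorem exec_comp (p : HProg I C A F) : ∀ (b : List I) (_ : wf p b = true) (env : I → ℕ)
    (_ : ∀ i, env i ≤ N) (_ : ∀ i, i ∉ b → env i = 0) (s : HS C A F) (_ : ∀ c, s.cnt c ≤ N)
    (x : Option Bool) (r : Bool), ∃ t ≤ (cost p).eval N, ∃ x' r',
      Exec (iface I C A F) L (eval L N p env s).maxq (comp p) (rep N env s x r)
        (rep N env (eval L N p env s) x' r') t := by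
  induction p with
  | skip => exact fun b _ env _ _ s _ x r => ⟨1, by simp [cost], x, r, .ops _ _⟩
  | seq p q hp hq =>
    intro b hb env henv hnot s hs x r
    simp only [wf, Bool.and_eq_true] at hb
    obtain ⟨t1, ht1, x1, r1, e1⟩ := hp b hb.1 env henv hnot s hs x r
    obtain ⟨t2, ht2, x2, r2, e2⟩ := hq b hb.2 env henv hnot _ (eval_cnt_le L N p env s hs) x1 r1
    exact ⟨t1 + t2, by simp [cost]; omega, x2, r2, (e1.mono (maxq_le_eval ..)).seq e2⟩
  | setF f v => exact fun b _ env _ _ s _ x r => ⟨1, by simp [cost], x, r, .ops _ _⟩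
  | ifF f p q hp hq =>
    intro b hb env henv hnot s hs x r
    simp only [wf, Bool.and_eq_true] at hb
    by_cases h : s.flag f = true
    · obtain ⟨t, ht, x', r', e⟩ := hp b hb.1 env henv hnot s hs x r
      rw [eval, if_pos h]
      exact ⟨1 + t, by simp [cost]; omega, x', r', .condT h e⟩
    · obtain ⟨t, ht, x', r', e⟩ := hq b hb.2 env henv hnot s hs x r
      rw [eval, if_neg h]
      exact ⟨1 + t, by simp [cost]; omega, x', r', .condF (Bool.eq_false_iff.2 h) e⟩
  | ifLt y z p q hp hq =>
    intro b hb env henv hnot s hs x r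
    simp only [wf, Bool.and_eq_true, decide_eq_true_eq] at hb
    have hval : val env s y ≤ N := by cases y; exacts [henv _, hs _]
    have pr : ∀ B, ∃ t ≤ 7 * N + 4, Exec (iface I C A F) L B
        (probe (.hi y) (.hi z) [.peek (.hi z) fun v o => setR v o.isSome]) (rep N env s x r)
        (rep N env s none (decide (val env s y < val env s z))) t := by
      intro B
      obtain ⟨t, ht, e⟩ := exec_probe (L := L) (B := B) (N := N) (a := (.hi y : Stk I C A))
        (c := .hi z) (m := val env s y) (v := (s.flag, x, r)) (g := repStk N env s)
        (v' := (s.flag, none, decide (val env s y < val env s z)))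
        (o := [.peek (.hi z) fun v o => setR v o.isSome])
        (l := List.replicate (val env s z - val env s y) false) (by simpa using hb.1.1)
        (by simp) (by simp) (by simp) (by simp) hval rfl rfl rfl (fun g' hg' => by
          have hg' : g' (.hi z) = List.replicate (val env s z - val env s y) false := by
            simpa [repStk] using hg'
          simp only [runOps, Op.run, hg', setR, setX, Prod.mk.injEq, true_and]
          refine ⟨?_, by rw [← hg', Function.update_eq_self]⟩
          -- After `val env s y` symbols are removed from the stack of `z`, a symbol is left exactly
          -- if the strict inequality holds.
          by_cases h : val env s y < val env s z
          · obtain ⟨d, hd⟩ := Nat.exists_eq_add_of_lt h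
            simp [show val env s z - val env s y = d + 1 by omega, List.replicate_succ, h]
          · simp [show val env s z - val env s y = 0 by omega, h])
      refine ⟨t, ht, e.of_eq ?_⟩
      simp only [rep, setX, Prod.mk.injEq, true_and]
      have : (repStk N env s (.hi z)).take (val env s y) ++
          List.replicate (val env s z - val env s y) false = repStk N env s (.hi z) := by
        simp only [repStk, List.take_replicate, ← List.replicate_add]
        congr 1
        omega
      rw [this, Function.update_eq_self]
    by_cases h : val env s y < val env s z
    · obtain ⟨t, ht, x', r', e⟩ := hp b hb.1.2 env henv hnot s hs none true
      rw [eval, if_pos h]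
      obtain ⟨t1, ht1, e1⟩ := pr (eval L N p env s).maxq
      rw [decide_eq_true h] at e1
      exact ⟨t1 + (1 + t), by simp [cost]; omega, x', r', e1.seq (.condT rfl e)⟩
    · obtain ⟨t, ht, x', r', e⟩ := hq b hb.2 env henv hnot s hs none false
      rw [eval, if_neg h]
      obtain ⟨t1, ht1, e1⟩ := pr (eval L N q env s).maxq
      rw [decide_eq_false h] at e1
      exact ⟨t1 + (1 + t), by simp [cost]; omega, x', r', e1.seq (.condF rfl e)⟩
  | ifRd y j p q hp hq =>
    intro b hb env henv hnot s hs x r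
    simp only [wf, Bool.and_eq_true] at hb
    have hval : val env s j ≤ N := by cases j; exacts [henv _, hs _]
    have pr : ∀ B, ∃ t ≤ 7 * N + 4, Exec (iface I C A F) L B
        (probe (.hi j) (.arr y) [.peek (.arr y) fun v o => setR v (o.getD false)]) (rep N env s x r)
        (rep N env s none (s.arr y (val env s j))) t := by
      intro B
      obtain ⟨t, ht, e⟩ := exec_probe (L := L) (B := B) (N := N) (a := (.hi j : Stk I C A))
        (c := .arr y) (m := val env s j) (v := (s.flag, x, r)) (g := repStk N env s)
        (v' := (s.flag, none, s.arr y (val env s j)))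
        (o := [.peek (.arr y) fun v o => setR v (o.getD false)])
        (l := (repStk N env s (.arr y)).drop (val env s j)) (by simp)
        (by simp) (by simp) (by simp) (by simp) hval rfl rfl rfl (fun g' hg' => by
          simp only [runOps, Op.run, hg', setR, setX, Prod.mk.injEq, true_and]
          refine ⟨?_, by rw [← hg', Function.update_eq_self]⟩
          simp [repStk, List.head?_drop, show val env s j < N + 1 by omega])
      refine ⟨t, ht, e.of_eq ?_⟩
      simp only [rep, setX, Prod.mk.injEq, true_and]
      rw [List.take_append_drop, Function.update_eq_self]
    by_cases h : s.arr y (val env s j) = true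
    · obtain ⟨t, ht, x', r', e⟩ := hp b hb.1 env henv hnot s hs none true
      rw [eval, if_pos h]
      obtain ⟨t1, ht1, e1⟩ := pr (eval L N p env s).maxq
      rw [h] at e1
      exact ⟨t1 + (1 + t), by simp [cost]; omega, x', r', e1.seq (.condT rfl e)⟩
    · obtain ⟨t, ht, x', r', e⟩ := hq b hb.2 env henv hnot s hs none false
      rw [eval, if_neg h]
      obtain ⟨t1, ht1, e1⟩ := pr (eval L N q env s).maxq
      rw [Bool.eq_false_iff.2 h] at e1
      exact ⟨t1 + (1 + t), by simp [cost]; omega, x', r', e1.seq (.condF rfl e)⟩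
  | wr y j v =>
    intro b hb env henv hnot s hs x r
    have hval : val env s j ≤ N := by cases j; exacts [henv _, hs _]
    obtain ⟨t, ht, e⟩ := exec_probe (L := L) (B := s.maxq) (N := N) (a := (.hi j : Stk I C A))
        (c := .arr y) (m := val env s j) (v := (s.flag, x, r)) (g := repStk N env s)
        (v' := (s.flag, none, r))
        (o := [.pop (.arr y) fun v _ => v, .push (.arr y) fun _ => v])
        (l := v :: (repStk N env s (.arr y)).drop (val env s j + 1)) (by simp)
        (by simp) (by simp) (by simp) (by simp) hval rfl rfl rfl (fun g' hg' => by
          simp [runOps, Op.run, hg', setX])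
    refine ⟨t, by simpa [cost] using ht, none, r, e.of_eq ?_⟩
    simp only [rep, setX, eval, Prod.mk.injEq, true_and]
    simp only [repStk]
    rw [take_append_cons_drop_map_range _ _ _ (by omega)]
    funext k
    cases k <;> simp [Function.update_apply, repStk]
    · split_ifs with h
      · subst h; rfl
      · rfl
    · rfl
    · rfl
  | reset c =>
    intro b hb env henv hnot s hs x r
    obtain ⟨t, ht, e⟩ := exec_pour (J := iface I C A F) (L := L) (B := s.maxq)
      (a := (.hi (.inr c) : Stk I C A)) (b := .lo (.inr c)) (by simp) (s.flag, x, r) (repStk N env s)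
    refine ⟨t, ?_, none, r, e.of_eq ?_⟩
    · have := hs c
      simp [cost, repStk, val] at ht ⊢
      omega
    · simp only [rep, setX, eval, Prod.mk.injEq, true_and]
      have := hs c
      funext k
      cases k with
      | lo j =>
        rcases j with j | j
        · simp [repStk, val]
        · by_cases hj : j = c
          · subst hj
            simp [repStk, val, show s.cnt j + (N - s.cnt j) = N by omega]
          · simp [repStk, val, hj]
      | hi j =>
        rcases j with j | j
        · simp [repStk, val]
        · by_cases hj : j = c
          · subst hj
            simp [repStk, val]
          · simp [repStk, val, hj]
      | _ => simp [repStk]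
  | inc c =>
    intro b hb env henv hnot s hs x r
    rcases (hs c).lt_or_eq with hc | hc
    · obtain ⟨d, hd⟩ := Nat.exists_eq_add_of_lt hc
      refine ⟨2, by simp [cost], some false, r, .condT (t := 1) ?_ ((Exec.ops _ _).of_eq ?_)⟩
      · simp [runOps, Op.run, rep, repStk, val, setX, isX, show N - s.cnt c = d + 1 by omega,
          List.replicate_succ]
      · simp only [runOps, Op.run, rep, setX, eval, Prod.mk.injEq, true_and]
        refine ⟨by simp [repStk, val, show N - s.cnt c = d + 1 by omega, List.replicate_succ], ?_⟩
        funext k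
        cases k with
        | lo j =>
          rcases j with j | j
          · simp [repStk, val]
          · by_cases hj : j = c
            · subst hj
              simp [repStk, val, show N - s.cnt j - 1 = N - min N (s.cnt j + 1) by omega]
            · simp [repStk, val, hj]
        | hi j =>
          rcases j with j | j
          · simp [repStk, val]
          · by_cases hj : j = c
            · subst hj
              simp [repStk, val, show min N (s.cnt j + 1) = s.cnt j + 1 by omega,
                List.replicate_succ]
            · simp [repStk, val, hj]
        | _ => simp [repStk]
    · refine ⟨2, by simp [cost], none, r, .condF (t := 1) ?_ ((Exec.ops _ _).of_eq ?_)⟩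
      · simp [runOps, Op.run, rep, repStk, val, setX, isX, hc]
      · have : eval L N (.inc c) env s = s := by
          -- At the cap the stack `lo` is empty, so the pop fails and the counter stays.
          have h : min N (s.cnt c + 1) = s.cnt c := by omega
          rw [eval, h, Function.update_eq_self]
        rw [this]
        simp only [runOps, Op.run, rep, setX, Prod.mk.injEq, true_and]
        refine ⟨by simp [repStk, val, hc], ?_⟩
        rw [Function.update_eq_self_iff]
        simp [repStk, val, hc]
  | push v =>
    refine fun b _ env _ _ s _ x r => ⟨1, by simp [cost], x, r, (Exec.ops _ _).of_eq ?_⟩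
    simp only [rep, eval, runOps, Op.run, Prod.mk.injEq, true_and]
    funext k
    cases k <;> simp [repStk] <;> rfl
  | ifAsk p q hp hq =>
    intro b hb env henv hnot s hs x r
    simp only [wf, Bool.and_eq_true] at hb
    classical
    set s0 : HS C A F := { s with qry := [], maxq := max s.maxq s.qry.length } with hs0
    have e1 : ∀ B, s.qry.length ≤ B → Exec (iface I C A F) L B .ask (rep N env s x r)
        (rep N env s0 x (decide (s.qry ∈ L))) 3 := by
      intro B hB
      refine (Exec.ask (A := iface I C A F) (rep N env s x r) hB).of_eq ?_
      simp only [rep, iface, setR, Prod.mk.injEq, true_and]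
      refine ⟨⟨rfl, rfl⟩, ?_⟩
      funext k
      cases k <;> simp [repStk, hs0] <;> rfl
    by_cases h : s.qry ∈ L
    · obtain ⟨t, ht, x', r', e⟩ := hp b hb.1 env henv hnot s0 hs x true
      rw [eval, if_pos h]
      have e1 := e1 (eval L N p env s0).maxq ((le_max_right _ _).trans (maxq_le_eval L N p env s0))
      rw [decide_eq_true h] at e1
      exact ⟨3 + (1 + t), by simp [cost]; omega, x', r', e1.seq (.condT rfl e)⟩
    · obtain ⟨t, ht, x', r', e⟩ := hq b hb.2 env henv hnot s0 hs x false
      rw [eval, if_neg h]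
      have e1 := e1 (eval L N q env s0).maxq ((le_max_right _ _).trans (maxq_le_eval L N q env s0))
      rw [decide_eq_false h] at e1
      exact ⟨3 + (1 + t), by simp [cost]; omega, x', r', e1.seq (.condF rfl e)⟩
  | popIn p q r' hp hq hr =>
    intro b hb env henv hnot s hs x r
    simp only [wf, Bool.and_eq_true] at hb
    have e1 : runOps [.pop .inp setX] (rep N env s x r) =
        rep N env { s with inp := s.inp.tail } s.inp.head? r := by
      simp only [runOps, Op.run, rep, setX, repStk, Prod.mk.injEq, true_and]
      funext k
      cases k <;> simp [repStk] <;> rfl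
    cases h : s.inp with
    | nil =>
      obtain ⟨t, ht, x', r', e⟩ := hp b hb.1.1 env henv hnot s hs none r
      have hs' : ({ s with inp := [] } : HS C A F) = s := by rw [← h]
      rw [h, List.tail_nil, List.head?_nil, hs'] at e1
      refine ⟨1 + t, by simp [cost]; omega, x', r', ?_⟩
      simp only [eval, h]
      refine .condF ?_ ?_
      · rw [e1]; rfl
      · rw [e1]; exact e
    | cons y l =>
      rw [h, List.tail_cons, List.head?_cons] at e1
      cases y with
      | false =>
        obtain ⟨t, ht, x', r', e⟩ := hq b hb.1.2 env henv hnot { s with inp := l } hs (some false) r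
        refine ⟨1 + (1 + t), by simp [cost]; omega, x', r', ?_⟩
        simp only [eval, h]
        refine .condT ?_ (.condF ?_ ?_)
        · rw [e1]; rfl
        · rw [e1]; rfl
        · rw [e1]; exact e
      | true =>
        obtain ⟨t, ht, x', r', e⟩ := hr b hb.2 env henv hnot { s with inp := l } hs (some true) r
        refine ⟨1 + (1 + t), by simp [cost]; omega, x', r', ?_⟩
        simp only [eval, h]
        refine .condT ?_ (.condT ?_ ?_)
        · rw [e1]; rfl
        · rw [e1]; rfl
        · rw [e1]; exact e
  | loop i p hp =>
    intro b hb env henv hnot s hs x r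
    simp only [wf, Bool.and_eq_true, decide_eq_true_eq] at hb
    set f : ℕ → HS C A F → HS C A F := fun j s => eval L N p (Function.update env i j) s with hf
    have hcnt : ∀ n c, (iter f n s).cnt c ≤ N := by
      intro n
      induction n with
      | zero => exact hs
      | succ n ih => exact eval_cnt_le L N p _ _ ih
    -- Here `n` rounds are done and `d` are still to come; the induction is on `d`.
    have main : ∀ d n, n + d = N → ∀ x r, ∃ t ≤ d * ((cost p).eval N + 2) + 1, ∃ r',
        Exec (iface I C A F) L (iter f N s).maxq (.loop [.peek (.lo (.inl i)) setX] isX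
          (.seq (comp p) (.ops [.pop (.lo (.inl i)) setX, .push (.hi (.inl i)) fun _ => false])))
          (rep N (Function.update env i n) (iter f n s) x r)
          (rep N (Function.update env i N) (iter f N s) none r') t := by
      intro d
      induction d with
      | zero =>
        rintro n rfl x r
        refine ⟨1, by simp, r, (Exec.loopF ?_).of_eq ?_⟩
        · simp [runOps, Op.run, rep, repStk, val, isX, setX]
        · simp [runOps, Op.run, rep, repStk, val, setX]
      | succ d ih =>
        intro n hn x r
        obtain ⟨t1, ht1, x1, r1, e1⟩ := hp (i :: b) hb.2 (Function.update env i n)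
          (fun j => by
            by_cases hj : j = i
            · subst hj; simp; omega
            · simpa [hj] using henv j)
          (fun j hj => by
            simp only [List.mem_cons, not_or] at hj
            simpa [hj.1] using hnot j hj.2) (iter f n s) (hcnt n) (some false) r
        obtain ⟨t2, ht2, r2, e2⟩ := ih (n + 1) (by omega) (some false) r1
        refine ⟨1 + (t1 + 1) + t2, by ring_nf at ht2 ⊢; omega, r2, .loopT ?_ ?_ e2⟩
        · simp [runOps, Op.run, rep, repStk, val, isX, setX, show N - n = d + 1 by omega,
            List.replicate_succ]
        · have e0 : runOps [.peek (.lo (.inl i)) setX]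
              (rep N (Function.update env i n) (iter f n s) x r) =
              rep N (Function.update env i n) (iter f n s) (some false) r := by
            simp [runOps, Op.run, rep, repStk, val, setX, show N - n = d + 1 by omega,
              List.replicate_succ]
          rw [e0]
          have hmax : (iter f (n + 1) s).maxq ≤ (iter f N s).maxq := by
            have : ∀ m, (iter f (n + 1) s).maxq ≤ (iter f (n + 1 + m) s).maxq := by
              intro m
              induction m with
              | zero => exact le_rfl
              | succ m ih => exact ih.trans (maxq_le_eval L N p _ _)
            have h := this d
            rwa [show n + 1 + d = N by omega] at h
          refine (e1.mono hmax).seq ((Exec.ops _ _).of_eq ?_)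
          simp only [runOps, Op.run, rep, setX, Prod.mk.injEq]
          refine ⟨⟨rfl, by simp [repStk, val, show N - n = d + 1 by omega, List.replicate_succ],
            trivial⟩, ?_⟩
          funext k
          cases k with
          | lo j =>
            rcases j with j | j
            · by_cases hj : j = i
              · subst hj
                simp [repStk, val, show N - n - 1 = N - (n + 1) by omega]
              · simp [repStk, val, hj]
            · simp [repStk, val, iter, hf]
          | hi j =>
            rcases j with j | j
            · by_cases hj : j = i
              · subst hj
                simp [repStk, val, List.replicate_succ]
              · simp [repStk, val, hj]
            · simp [repStk, val, iter, hf]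
          | _ => simp [repStk, iter, hf]
    obtain ⟨t1, ht1, r1, e1⟩ := main N 0 (by simp) x r
    -- The index `i` is not in use, so it is zero before the loop.
    have henv0 : Function.update env i 0 = env := by
      rw [← hnot i hb.1, Function.update_eq_self]
    rw [henv0] at e1
    obtain ⟨t2, ht2, e2⟩ := exec_pour (J := iface I C A F) (L := L) (B := (iter f N s).maxq)
      (a := (.hi (.inl i) : Stk I C A)) (b := .lo (.inl i)) (by simp)
      ((iter f N s).flag, none, r1) (repStk N (Function.update env i N) (iter f N s))
    refine ⟨t1 + t2, ?_, none, r1, e1.seq (e2.of_eq ?_)⟩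
    · simp [cost, repStk, val] at ht1 ht2 ⊢
      omega
    · simp only [rep, setX, eval, Prod.mk.injEq]
      have h0 := hnot i hb.1
      refine ⟨⟨rfl, trivial⟩, ?_⟩
      funext k
      cases k with
      | lo j =>
        rcases j with j | j
        · by_cases hj : j = i
          · subst hj
            simp [repStk, val, h0, hf]
          · simp [repStk, val, hj]
        · simp [repStk, val, hf]
      | hi j =>
        rcases j with j | j
        · by_cases hj : j = i
          · subst hj
            simp [repStk, val, h0]
          · simp [repStk, val, hj]
        · simp [repStk, val, hf]
      | _ => simp [repStk, hf]

end Correct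

end LoopLang

namespace LoopLang

open StackLang

variable {I C A F : Type} [DecidableEq I] [DecidableEq C] [DecidableEq A] [DecidableEq F]

/-! ### Initialization -/

/-- Push a blank symbol onto each of the given stacks. -/
def fill {K : Type} (l : List K) : List (Op K (Reg F)) := l.map fun k => .push k fun _ => false

theorem runOps_fill {K : Type} [DecidableEq K] (l : List K) (v : Reg F) (g : K → List Bool) :
    runOps (fill l) (v, g) = (v, fun k => List.replicate (l.count k) false ++ g k) := by
  induction l generalizing g with
  | nil => simp [fill, runOps]
  | cons a l ih =>
    have h := ih (Function.update g a (false :: g a))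
    rw [fill] at h
    simp only [fill, List.map_cons, runOps, Op.run, h, Prod.mk.injEq, true_and]
    funext k
    by_cases hk : k = a
    · subst hk
      simp [List.replicate_succ']
    · simp [Function.update_of_ne hk, List.count_cons_of_ne (Ne.symm hk)]

theorem runOps_append {K σ : Type} [DecidableEq K] (l l' : List (Op K σ)) (s : St K σ) :
    runOps (l ++ l') s = runOps l' (runOps l s) := by
  induction l generalizing s with
  | nil => rfl
  | cons o l ih => exact ih _

/-- Pour the stack `a` onto `b`, and push a blank symbol onto each of the given stacks for each
symbol. -/
def measure {K : Type} (a b : K) (l : List K) : Prog K (Reg F) :=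
  .loop [.pop a setX] isX (.ops (.push b getX :: fill l))

/-- This measures the input in unary on several stacks at once; the input is reversed on `b` and can
be poured back. -/
theorem exec_measure {K : Type} [DecidableEq K] {J : Iface K (Reg F)} {L : Language Bool} {B : ℕ}
    {a b : K} {l : List K} (hab : a ≠ b) (ha : a ∉ l) (hb : b ∉ l) (v : Reg F)
    (g : K → List Bool) :
    ∃ t ≤ 2 * (g a).length + 1, Exec J L B (measure a b l) (v, g) (setX v none,
      Function.update (Function.update
        (fun k => List.replicate ((g a).length * l.count k) false ++ g k) a [])
        b ((g a).reverse ++ g b)) t := by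
  induction h : g a generalizing v g with
  | nil =>
    refine ⟨1, by simp, ?_⟩
    refine (Exec.loopF (by simp [runOps, Op.run, h, isX, setX])).of_eq ?_
    simp [runOps, Op.run, h, setX, Function.update_of_ne hab.symm]
  | cons y w ih =>
    obtain ⟨g', hg'⟩ : ∃ g', g' = fun k => List.replicate (l.count k) false ++
      Function.update (Function.update g a w) b (y :: g b) k := ⟨_, rfl⟩
    have hga : g' a = w := by
      simp [hg', List.count_eq_zero_of_not_mem ha, hab]
    obtain ⟨t, ht, ht'⟩ := ih (setX v (some y)) g' hga
    refine ⟨1 + 1 + t, by simp; omega, ?_⟩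
    refine (Exec.loopT (s' := (setX v (some y), g')) ?_ ?_ ?_)
    · simp [runOps, Op.run, h, isX, setX]
    · refine (Exec.ops _ _).of_eq ?_
      simp only [runOps, Op.run, runOps_fill, Prod.mk.injEq, hg']
      simp [h, setX, getX, hab.symm]
    · refine ht'.of_eq ?_
      simp only [Prod.mk.injEq]
      refine ⟨rfl, ?_⟩
      rw [hg']
      funext k
      by_cases hkb : k = b
      · subst hkb; simp [List.count_eq_zero_of_not_mem hb]
      · by_cases hka : k = a
        · subst hka; simp [hkb]
        · simp only [Function.update_of_ne hkb, Function.update_of_ne hka, ← List.append_assoc,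
            List.replicate_append_replicate, List.length_cons]
          congr 2
          ring

variable [Fintype I] [Fintype C] [Fintype A] [Fintype F]

/-- Whether a stack has to be filled up to the length of the input. -/
def isBlank : Stk I C A → Bool
  | .arr _ => true
  | .lo _ => true
  | _ => false

/-- Whether a stack holds an array. -/
def isArr : Stk I C A → Bool
  | .arr _ => true
  | _ => false

/-- The stacks with a given property. -/
noncomputable def stksOf (I C A : Type) [Fintype I] [Fintype C] [Fintype A]
    (b : Stk I C A → Bool) : List (Stk I C A) :=
  ((Finset.univ : Finset (Stk I C A)).toList).filter b

theorem count_stksOf (b : Stk I C A → Bool) (k : Stk I C A) :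
    (stksOf I C A b).count k = if b k = true then 1 else 0 := by
  split_ifs with h
  · exact List.count_eq_one_of_mem ((Finset.nodup_toList _).filter _) (by simp [stksOf, h])
  · exact List.count_eq_zero_of_not_mem (by simp [stksOf, h])

/-- The program that sets up the representation of the initial state. -/
noncomputable def initProg (I C A F : Type) [Fintype I] [Fintype C] [Fintype A] :
    Prog (Stk I C A) (Reg F) :=
  .seq (measure .inp .t1 (stksOf I C A isBlank))
    -- Two more blanks make the stacks `lo` as high as `N = |w| + 2`. The arrays get a third one,
    -- since their cells are numbered from `0` to `N` inclusively.
    (.seq (.ops (fill (stksOf I C A isBlank) ++ (fill (stksOf I C A isBlank) ++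
      fill (stksOf I C A isArr)))) (pour .t1 .inp))

/-- The initial state of a loop program. -/
def initHS (C A F : Type) (w : List Bool) : HS C A F :=
  ⟨w, [], fun _ _ => false, fun _ => 0, fun _ => false, 0⟩

theorem exec_initProg (L : Language Bool) (B : ℕ) (w : List Bool) :
    ∃ t ≤ 4 * w.length + 3, Exec (iface I C A F) L B (initProg I C A F)
      ((fun _ => false, none, false), Function.update (fun _ => []) .inp w)
      (rep (w.length + 2) (fun _ => 0) (initHS C A F w) none false) t := by
  obtain ⟨t1, ht1, e1⟩ := exec_measure (J := iface I C A F) (L := L) (B := B)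
    (a := (.inp : Stk I C A)) (b := .t1) (l := stksOf I C A isBlank) (by simp)
    (by simp [stksOf, isBlank]) (by simp [stksOf, isBlank]) (fun _ => false, none, false)
    (Function.update (fun _ => []) .inp w)
  set g1 := Function.update (Function.update (fun k => List.replicate
    ((Function.update (fun _ => []) (.inp : Stk I C A) w .inp).length *
      (stksOf I C A isBlank).count k) false ++
    Function.update (fun _ => []) (.inp : Stk I C A) w k) .inp []) .t1
    ((Function.update (fun _ => []) (.inp : Stk I C A) w .inp).reverse ++
    Function.update (fun _ => []) (.inp : Stk I C A) w .t1) with hg1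
  obtain ⟨g2, hg2⟩ : ∃ g2 : Stk I C A → List Bool, g2 = fun k =>
    List.replicate ((if isArr k = true then 1 else 0) + (if isBlank k = true then 2 else 0)) false ++
      g1 k := ⟨_, rfl⟩
  have e2 : Exec (iface I C A F) L B (.ops (fill (stksOf I C A isBlank) ++
      (fill (stksOf I C A isBlank) ++ fill (stksOf I C A isArr))))
      (setX (fun _ => false, none, false) none, g1) (setX (fun _ => false, none, false) none, g2)
      1 := by
    refine (Exec.ops _ _).of_eq ?_
    simp only [runOps_append, runOps_fill, Prod.mk.injEq, true_and, count_stksOf, hg2]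
    funext k
    rw [← List.append_assoc, ← List.append_assoc, List.replicate_append_replicate,
      List.replicate_append_replicate]
    congr 2
    split_ifs <;> rfl
  obtain ⟨t3, ht3, e3⟩ := exec_pour (J := iface I C A F) (L := L) (B := B)
    (a := (.t1 : Stk I C A)) (b := .inp) (by simp) (setX (fun _ => false, none, false) none) g2
  have h1 : g2 .t1 = w.reverse := by simp [hg2, hg1, isArr, isBlank]
  have h2 : g2 .inp = [] := by simp [hg2, hg1, isArr, isBlank]
  rw [h1] at ht3
  simp only [Function.update_self, List.length_reverse] at ht1 ht3
  refine ⟨t1 + (1 + t3), by omega, (e1.seq (e2.seq e3)).of_eq ?_⟩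
  simp only [rep, setX, initHS, Prod.mk.injEq, true_and]
  rw [h1, h2]
  funext k
  cases k with
  | arr x =>
    simp [repStk, hg2, hg1, isArr, isBlank, count_stksOf]
    rfl
  | lo j =>
    rcases j with j | j <;>
    · simp [repStk, hg2, hg1, isArr, isBlank, count_stksOf, val]
      rfl
  | hi j =>
    rcases j with j | j <;>
    · simp [repStk, hg2, hg1, isArr, isBlank, count_stksOf, val]
  | _ => simp [repStk, hg2, hg1, isArr, isBlank, count_stksOf]

/-- A parameterized problem that is decided by a loop program with small queries has a Turing
compression. -/
theorem hasTuringCompression_of_eval {p : HProg I C A F} (hp : wf p [] = true) {L : Language Bool}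
    {acc : (F → Bool) → Bool} {Q : ParamProblem} {f : ℕ → ℕ}
    (h : ∀ x k, ∀ s, eval L ((instanceWord x k).length + 2) p (fun _ => 0)
        (initHS C A F (instanceWord x k)) = s →
      s.maxq ≤ f k ∧ (acc s.flag = true ↔ (x, k) ∈ Q)) : HasTuringCompression Q f := by
  refine hasTuringCompression_of_exec (A := iface I C A F) (L := L) (inp := .inp)
    (p := .seq (initProg I C A F) (comp p)) (start := (fun _ => false, none, false))
    (accept := fun v => acc v.1)
    -- The input word has length `|x| + k + 1`, so `N = |x| + k + 3`.
    (T := 4 * (Polynomial.X + 1) + 3 + (cost p).comp (Polynomial.X + 3)) fun x k => ?_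
  have hlen : (instanceWord x k).length = x.length + k + 1 := by
    simp [instanceWord]; omega
  obtain ⟨hq, hacc⟩ := h x k _ rfl
  obtain ⟨t1, ht1, e1⟩ := exec_initProg (I := I) (C := C) (A := A) (F := F) L (f k)
    (instanceWord x k)
  obtain ⟨t2, ht2, x', r', e2⟩ := exec_comp (L := L) (N := (instanceWord x k).length + 2) p [] hp
    (fun _ => 0) (fun _ => Nat.zero_le _) (fun _ _ => rfl) (initHS C A F (instanceWord x k))
    (fun _ => Nat.zero_le _) none false
  refine ⟨t1 + t2, ?_, _, e1.seq (e2.mono hq), hacc⟩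
  rw [hlen] at ht1 ht2
  rw [show x.length + k + 1 + 2 = x.length + k + 3 by omega] at ht2
  simp only [Polynomial.eval_add, Polynomial.eval_mul, Polynomial.eval_comp, Polynomial.eval_X,
    Polynomial.eval_one, Polynomial.eval_ofNat]
  omega

end LoopLang

/-! ### Modules and prime induced subgraphs -/

namespace SimpleGraph

variable {V W : Type} {G : SimpleGraph V} {H : SimpleGraph W}

/-- A module of the subgraph of `G` that is induced by `S`. -/
def IsModuleIn (G : SimpleGraph V) (S M : Set V) : Prop :=
  M ⊆ S ∧ ∀ v ∈ S, v ∉ M → ∀ a ∈ M, ∀ b ∈ M, G.Adj v a → G.Adj v b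

/-- A set of vertices that induces a prime subgraph. -/
def IsPrimeSet (G : SimpleGraph V) (X : Set V) : Prop :=
  ∀ M, G.IsModuleIn X M → M = ∅ ∨ M = X ∨ ∃ v, M = {v}

/-- `H` is isomorphic to an induced subgraph of `G` with vertices in `X`. -/
def IndIn (H : SimpleGraph W) (G : SimpleGraph V) (X : Set V) : Prop :=
  ∃ f : W → V, Function.Injective f ∧ (∀ w, f w ∈ X) ∧ ∀ x y, H.Adj x y ↔ G.Adj (f x) (f y)

theorem IndIn.mono {X Y : Set V} (h : IndIn H G X) (hXY : X ⊆ Y) : IndIn H G Y := by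
  obtain ⟨f, h1, h2, h3⟩ := h
  exact ⟨f, h1, fun w => hXY (h2 w), h3⟩

theorem isModularSet_iff {M : Set W} : H.IsModularSet M ↔ H.IsModuleIn Set.univ M := by
  simp only [IsModularSet, IsModuleIn, Set.subset_univ, true_and, Set.mem_univ, true_imp_iff]
  refine forall₂_congr fun v hv => ⟨fun h a ha b hb hab => ?_, fun h => ?_⟩
  · rcases h with h | h
    · exact absurd (show a ∈ M ∩ H.neighborSet v from ⟨ha, hab⟩) (h ▸ Set.notMem_empty a)
    · exact h hb
  · by_cases h' : ∃ a ∈ M, H.Adj v a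
    · obtain ⟨a, ha, hab⟩ := h'
      exact Or.inr fun b hb => h a ha b hb hab
    · left
      ext a
      simp only [Set.mem_inter_iff, mem_neighborSet, Set.mem_empty_iff_false, iff_false]
      exact fun ha => h' ⟨a, ha⟩

/-- Modules are transported along an embedding by images and preimages. -/
theorem isPrimeGraph_iff_isPrimeSet_range {f : W → V} (hf : Function.Injective f)
    (hadj : ∀ x y, H.Adj x y ↔ G.Adj (f x) (f y)) :
    H.IsPrimeGraph ↔ G.IsPrimeSet (Set.range f) := by
  constructor
  · intro h M hM
    have hM' : f '' (f ⁻¹' M) = M := Set.image_preimage_eq_of_subset hM.1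
    have := h (f ⁻¹' M) (isModularSet_iff.2 ⟨Set.subset_univ _, fun v _ hv a ha b hb => by
      rw [hadj, hadj]
      exact hM.2 _ ⟨v, rfl⟩ hv _ ha _ hb⟩)
    rcases this with h | h | ⟨v, h⟩
    · left; rw [← hM', h, Set.image_empty]
    · right; left; rw [← hM', h, Set.image_univ]
    · right; right; exact ⟨f v, by rw [← hM', h, Set.image_singleton]⟩
  · intro h M hM
    rw [isModularSet_iff] at hM
    have := h (f '' M) ⟨Set.image_subset_range _ _, by
      rintro _ ⟨v, rfl⟩ hv _ ⟨a, ha, rfl⟩ _ ⟨b, hb, rfl⟩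
      rw [← hadj, ← hadj]
      exact hM.2 v (Set.mem_univ _) (fun h => hv ⟨v, h, rfl⟩) a ha b hb⟩
    rcases this with h | h | ⟨v, h⟩
    · left; exact Set.image_eq_empty.1 h
    · right; left
      rw [← Set.image_univ] at h
      exact hf.image_injective h
    · right; right
      obtain ⟨w, hw, rfl⟩ : v ∈ f '' M := by rw [h]; exact rfl
      exact ⟨w, hf.image_injective (by rw [h, Set.image_singleton])⟩

theorem isPrimeGraph_induce_iff {X : Set V} : (G.induce X).IsPrimeGraph ↔ G.IsPrimeSet X := by
  rw [isPrimeGraph_iff_isPrimeSet_range (f := Subtype.val) (G := G) Subtype.val_injective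
    (fun x y => Iff.rfl), Subtype.range_coe]

theorem isPrimeSet_image_iff {f : W → V} (hf : Function.Injective f)
    (hadj : ∀ x y, H.Adj x y ↔ G.Adj (f x) (f y)) (X : Set W) :
    G.IsPrimeSet (f '' X) ↔ H.IsPrimeSet X := by
  have h := isPrimeGraph_iff_isPrimeSet_range (H := H.induce X) (G := G) (f := fun x : X => f x)
    (fun x y h => Subtype.ext (hf h)) (fun x y => hadj _ _)
  rw [show (Set.range fun x : X => f x) = f '' X by ext; simp] at h
  rw [← h, isPrimeGraph_induce_iff]

/-- The preimage of `M` under the embedding is a module of `H`. The copy can only be an obstacle if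
it uses `v`, so the preimage is not empty. If it is everything, the copy lies in `M`; if it is one
vertex, that vertex is mapped to `v` and can be mapped to the twin `u` instead. -/
theorem IndIn.prime_split (hH : H.IsPrimeGraph) {S M : Set V} (hM : G.IsModuleIn S M) {u v : V}
    (hu : u ∈ M) (hv : v ∈ M) (huv : u ≠ v) (h : IndIn H G S) :
    IndIn H G M ∨ IndIn H G (S \ {v}) := by
  classical
  obtain ⟨f, hf, hfS, hadj⟩ := h
  by_cases hfv : ∀ w, f w ≠ v
  · exact Or.inr ⟨f, hf, fun w => ⟨hfS w, hfv w⟩, hadj⟩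
  push Not at hfv
  obtain ⟨z, hz⟩ := hfv
  rcases hH (f ⁻¹' M) (isModularSet_iff.2 ⟨Set.subset_univ _, fun w _ hw a ha b hb => by
      rw [hadj, hadj]
      exact hM.2 _ (hfS w) hw _ ha _ hb⟩) with h | h | ⟨z', h⟩
  · exact absurd (show z ∈ f ⁻¹' M by rw [Set.mem_preimage, hz]; exact hv) (h ▸ Set.notMem_empty z)
  · left
    refine ⟨f, hf, fun w => ?_, hadj⟩
    have : w ∈ f ⁻¹' M := h ▸ Set.mem_univ w
    exact this
  · right
    obtain rfl : z = z' := by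
      have : z ∈ f ⁻¹' M := by rw [Set.mem_preimage, hz]; exact hv
      rwa [h] at this
    have hout : ∀ w, w ≠ z → f w ∉ M := by
      intro w hw hwM
      have : w ∈ f ⁻¹' M := hwM
      rw [h] at this
      exact hw this
    have hadj' : ∀ w, w ≠ z → (G.Adj (f w) v ↔ G.Adj (f w) u) := fun w hw =>
      ⟨hM.2 _ (hfS w) (hout w hw) v hv u hu, hM.2 _ (hfS w) (hout w hw) u hu v hv⟩
    -- The new copy uses `u` in place of `v`; it is injective since the rest of the copy avoids `M`.
    refine ⟨Function.update f z u, ?_, fun w => ?_, fun x y => ?_⟩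
    · intro x y hxy
      by_cases hx : x = z <;> by_cases hy : y = z
      · rw [hx, hy]
      · rw [hx, Function.update_self, Function.update_of_ne hy] at hxy
        exact absurd (hxy ▸ hu) (hout y hy)
      · rw [hy, Function.update_self, Function.update_of_ne hx] at hxy
        exact absurd (hxy ▸ hu) (hout x hx)
      · rw [Function.update_of_ne hx, Function.update_of_ne hy] at hxy
        exact hf hxy
    · by_cases hw : w = z
      · rw [hw, Function.update_self]
        exact ⟨hM.1 hu, huv⟩
      · rw [Function.update_of_ne hw]
        exact ⟨hfS w, fun h => hout w hw (by rw [h]; exact hv)⟩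
    · by_cases hx : x = z <;> by_cases hy : y = z
      · subst hx; subst hy; simp
      · subst hx
        rw [Function.update_self, Function.update_of_ne hy, hadj, hz, G.adj_comm v, hadj' y hy,
          G.adj_comm u]
      · subst hy
        rw [Function.update_self, Function.update_of_ne hx, hadj, hz, hadj' x hx]
      · rw [Function.update_of_ne hx, Function.update_of_ne hy, hadj]

/-- A module of a module is a module. So if `S` is not prime, one can pass to a nontrivial proper
module and continue there. -/
theorem exists_isPrimeSet_module {S : Set V} (hS : S.Finite) (h2 : S.Nontrivial) :
    ∃ M, G.IsModuleIn S M ∧ M.Nontrivial ∧ G.IsPrimeSet M := by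
  induction hn : S.ncard using Nat.strong_induction_on generalizing S with
  | _ n ih =>
    by_cases hp : G.IsPrimeSet S
    · exact ⟨S, ⟨subset_rfl, fun v hv hv' => absurd hv hv'⟩, h2, hp⟩
    · simp only [IsPrimeSet, not_forall, not_or, not_exists] at hp
      obtain ⟨N, hN, h0, h1, hs⟩ := hp
      have hNt : N.Nontrivial := by
        by_contra h
        rcases (Set.not_nontrivial_iff.1 h).eq_empty_or_singleton with h | ⟨v, h⟩
        exacts [h0 h, hs v h]
      have hlt : N.ncard < n := hn ▸ Set.ncard_lt_ncard (lt_of_le_of_ne hN.1 h1) hS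
      obtain ⟨M, hM, hMt, hMp⟩ := ih _ hlt (hS.subset hN.1) hNt rfl
      refine ⟨M, ⟨hM.1.trans hN.1, fun v hv hvM a ha b hb hab => ?_⟩, hMt, hMp⟩
      by_cases hvN : v ∈ N
      · exact hM.2 v hvN hvM a ha b hb hab
      · exact hN.2 v hv hvN a (hM.1 ha) b (hM.1 hb) hab

/-- Let `M` be a module with at least two vertices that is not everything. By connectedness some `v`
outside `M` has a neighbour in `M`, so all of `M` is adjacent to `v`, and `M` consists of the two
neighbours of `v`. As there are at least four vertices, one of these neighbours has a further
neighbour on the path, which distinguishes the two. -/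
theorem isPrimeGraph_pathGraph {l : ℕ} (hl : 4 ≤ l) : (pathGraph l).IsPrimeGraph := by
  intro M hM
  rw [isModularSet_iff] at hM
  by_contra hcon
  simp only [not_or, not_exists] at hcon
  obtain ⟨h0, h1, hs⟩ := hcon
  have hNt : M.Nontrivial := by
    by_contra h
    rcases (Set.not_nontrivial_iff.1 h).eq_empty_or_singleton with h | ⟨v, h⟩
    exacts [h0 h, hs v h]
  have hadj : ∀ (i j : ℕ) (hi : i < l) (hj : j < l),
      (pathGraph l).Adj ⟨i, hi⟩ ⟨j, hj⟩ ↔ i + 1 = j ∨ j + 1 = i := by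
    intro i j hi hj
    rw [pathGraph_adj]
  have key : ∀ v (hv : v < l), (⟨v, hv⟩ : Fin l) ∉ M → ∀ a (ha : a < l), (⟨a, ha⟩ : Fin l) ∈ M →
      ∀ b (hb : b < l), (⟨b, hb⟩ : Fin l) ∈ M → v + 1 = a ∨ a + 1 = v → v + 1 = b ∨ b + 1 = v := by
    intro v hv hvM a ha haM b hb hbM h
    rw [← hadj v b hv hb]
    exact hM.2 _ (Set.mem_univ _) hvM _ haM _ hbM ((hadj v a hv ha).2 h)
  -- two neighbours on the path, one inside and one outside
  obtain ⟨i, hi, hne⟩ : ∃ i, ∃ hi : i + 1 < l,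
      ¬ ((⟨i, by omega⟩ : Fin l) ∈ M ↔ (⟨i + 1, hi⟩ : Fin l) ∈ M) := by
    by_contra hcon
    push Not at hcon
    have hall : ∀ j (hj : j < l), (⟨0, by omega⟩ : Fin l) ∈ M ↔ (⟨j, hj⟩ : Fin l) ∈ M := by
      intro j
      induction j with
      | zero => exact fun _ => Iff.rfl
      | succ j ih => exact fun hj => (ih (by omega)).trans (hcon j hj)
    obtain ⟨a, ha, -⟩ := hNt
    exact h1 (Set.eq_univ_of_forall fun b => (hall b b.2).1 ((hall a a.2).2 ha))
  obtain ⟨⟨a, ha⟩, haM, ⟨b, hb⟩, hbM, hab⟩ := hNt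
  have hab : a ≠ b := fun h => hab (Fin.ext h)
  have main : ∀ v (hv : v < l), (⟨v, hv⟩ : Fin l) ∉ M → ∀ c (hc : c < l), (⟨c, hc⟩ : Fin l) ∈ M →
      v + 1 = c ∨ c + 1 = v → False := by
    intro v hv hvM c hc hcM hvc
    have h1 := key v hv hvM c hc hcM a ha haM hvc
    have h2 := key v hv hvM c hc hcM b hb hbM hvc
    have hout : ∀ w (hw : w < l), (w + 1 = a ∨ a + 1 = w) → (w + 1 = b ∨ b + 1 = w) ∨
        (⟨w, hw⟩ : Fin l) ∈ M := fun w hw h => by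
      by_cases hwM : (⟨w, hw⟩ : Fin l) ∈ M
      · exact Or.inr hwM
      · exact Or.inl (key w hw hwM a ha haM b hb hbM h)
    have hmem : ∀ w (hw : w < l), (⟨w, hw⟩ : Fin l) ∈ M → v + 1 = w ∨ w + 1 = v := fun w hw hwM =>
      key v hv hvM c hc hcM w hw hwM hvc
    have houtb : ∀ w (hw : w < l), (w + 1 = b ∨ b + 1 = w) → (w + 1 = a ∨ a + 1 = w) ∨
        (⟨w, hw⟩ : Fin l) ∈ M := fun w hw h => by
      by_cases hwM : (⟨w, hw⟩ : Fin l) ∈ M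
      · exact Or.inr hwM
      · exact Or.inl (key w hw hwM b hb hbM a ha haM h)
    -- The distinguishing vertex is `v + 2` if it exists, and `v - 2` otherwise.
    by_cases hv2 : v + 2 < l
    · rcases h1 with h1 | h1
      · rcases hout (v + 2) hv2 (by omega) with h | h
        · omega
        · have := hmem _ _ h; omega
      · rcases houtb (v + 2) hv2 (by omega) with h | h
        · omega
        · have := hmem _ _ h; omega
    · rcases h1 with h1 | h1
      · rcases houtb (v - 2) (by omega) (by omega) with h | h
        · omega
        · have := hmem _ _ h; omega
      · rcases hout (v - 2) (by omega) (by omega) with h | h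
        · omega
        · have := hmem _ _ h; omega
  by_cases hiM : (⟨i, by omega⟩ : Fin l) ∈ M
  · exact main (i + 1) hi (fun h => hne (by simp [hiM, h])) i (by omega) hiM (by omega)
  · refine main i (by omega) hiM (i + 1) hi ?_ (by omega)
    by_contra h
    exact hne (by simp [hiM, h])

/-- The supremum is a maximum: the set of sizes contains `0`, from the empty set, and is bounded by
the number of vertices. -/
theorem modularWidth_eq_iff [Finite V] (k : ℕ) : G.modularWidth = k ↔
    (∃ X, G.IsPrimeSet X ∧ X.ncard = k) ∧ ∀ X, G.IsPrimeSet X → X.ncard ≤ k := by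
  have hgr : IsGreatest {m | ∃ S : Set V, (G.induce S).IsPrimeGraph ∧ S.ncard = m}
      G.modularWidth := by
    refine ⟨Nat.sSup_mem ⟨0, ∅, ?_, Set.ncard_empty _⟩ ⟨Nat.card V, ?_⟩, fun m hm => le_csSup
      ⟨Nat.card V, ?_⟩ hm⟩
    · exact fun M _ => Or.inl (Set.eq_empty_of_isEmpty M)
    all_goals
      rintro _ ⟨S, -, rfl⟩
      exact (Set.ncard_le_ncard (Set.subset_univ S)).trans_eq (Set.ncard_univ V)
  simp only [isPrimeGraph_induce_iff] at hgr
  constructor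
  · rintro rfl
    exact ⟨hgr.1, fun X hX => hgr.2 ⟨X, hX, rfl⟩⟩
  · rintro ⟨h1, h2⟩
    exact hgr.unique ⟨h1, by rintro _ ⟨X, hX, rfl⟩; exact h2 X hX⟩

end SimpleGraph

/-! ### Words for graphs -/

namespace SimpleGraph

theorem replicate_append_false_inj {a b : ℕ} {x y : List Bool}
    (h : List.replicate a true ++ false :: x = List.replicate b true ++ false :: y) :
    a = b ∧ x = y := by
  induction a generalizing b with
  | zero =>
    cases b with
    | zero => simpa using h
    | succ b => simp [List.replicate_succ] at h
  | succ a ih =>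
    cases b with
    | zero => simp [List.replicate_succ] at h
    | succ b =>
      simp only [List.replicate_succ, List.cons_append, List.cons.injEq, true_and] at h
      simpa using ih h

/-- The word of an `m × n` matrix, row by row. -/
def matWord (f : ℕ → ℕ → Bool) (m n : ℕ) : List Bool :=
  (List.range m).flatMap fun i => (List.range n).map (f i)

theorem length_matWord (f : ℕ → ℕ → Bool) (m n : ℕ) : (matWord f m n).length = m * n := by
  simp [matWord, List.length_flatMap]

theorem matWord_getD (f : ℕ → ℕ → Bool) {m n i j : ℕ} (hi : i < m) (hj : j < n) :
    (matWord f m n).getD (i * n + j) false = f i j := by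
  induction m with
  | zero => omega
  | succ m ih =>
    have h : matWord f (m + 1) n = matWord f m n ++ (List.range n).map (f m) := by
      simp [matWord, List.range_succ]
    rw [h]
    rcases Nat.lt_succ_iff_lt_or_eq.1 hi with hi | rfl
    · rw [List.getD_append _ _ _ _ (by rw [length_matWord]; nlinarith), ih hi]
    · rw [List.getD_append_right _ _ _ _ (by rw [length_matWord]; omega), length_matWord]
      simp [hj]

theorem eq_matWord {f : ℕ → ℕ → Bool} {m n : ℕ} {l : List Bool} (hl : l.length = m * n)
    (h : ∀ i < m, ∀ j < n, l.getD (i * n + j) false = f i j) : l = matWord f m n := by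
  apply List.ext_getElem
  · rw [hl, length_matWord]
  · intro p h1 h2
    have hn : 0 < n := by
      rcases Nat.eq_zero_or_pos n with rfl | h
      · simp [hl] at h1
      · exact h
    have hm : p / n < m := by rw [Nat.div_lt_iff_lt_mul hn, ← hl]; exact h1
    have := h (p / n) hm (p % n) (Nat.mod_lt _ hn)
    rw [← matWord_getD f hm (Nat.mod_lt _ hn), Nat.div_add_mod', List.getD_eq_getElem _ _ h1,
      List.getD_eq_getElem _ _ h2] at this
    exact this

/-- The adjacency relation of a graph on `Fin n`, as a relation on the natural numbers. -/
def natGraph {n : ℕ} (G : SimpleGraph (Fin n)) : SimpleGraph ℕ := G.map Fin.valEmbedding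

theorem natGraph_adj {n : ℕ} (G : SimpleGraph (Fin n)) (x y : Fin n) :
    G.Adj x y ↔ G.natGraph.Adj x y :=
  (map_adj_apply (G := G) (f := Fin.valEmbedding)).symm

open Classical in
theorem encodeGraphNat_eq {n : ℕ} (G : SimpleGraph (Fin n)) (l : ℕ) : encodeGraphNat G l =
    List.replicate n true ++ false ::
      (matWord (fun i j => decide (G.natGraph.Adj i j)) n n ++ l.bits) := by
  have h : ∀ (f : ℕ → List Bool), (List.finRange n).flatMap (fun i : Fin n => f i) =
      (List.range n).flatMap f := by
    intro f
    rw [← List.map_coe_finRange_eq_range, List.flatMap_map]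
  have h' : ∀ (f : ℕ → Bool), (List.finRange n).map (fun i : Fin n => f i) = (List.range n).map f := by
    intro f
    rw [← List.map_coe_finRange_eq_range, List.map_map]
    rfl
  rw [encodeGraphNat, matWord, ← h]
  simp only [← h', natGraph_adj]

theorem natGraph_injective {n : ℕ} :
    Function.Injective (natGraph : SimpleGraph (Fin n) → SimpleGraph ℕ) := by
  intro G G' h
  ext x y
  rw [natGraph_adj, natGraph_adj, h]

theorem bits_injective : Function.Injective Nat.bits := by
  intro a b h
  rw [← Nat.ofDigits_digits 2 a, ← Nat.ofDigits_digits 2 b, Nat.digits_two_eq_bits,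
    Nat.digits_two_eq_bits, h]

/-- The unary prefix is self-delimiting, it determines the length of the matrix, and the rest is the
binary expansion. -/
theorem encodeGraphNat_inj {n n' : ℕ} {G : SimpleGraph (Fin n)} {G' : SimpleGraph (Fin n')}
    {l l' : ℕ} (h : encodeGraphNat G l = encodeGraphNat G' l') : n = n' ∧ HEq G G' ∧ l = l' := by
  rw [encodeGraphNat_eq, encodeGraphNat_eq] at h
  obtain ⟨rfl, h⟩ := replicate_append_false_inj h
  obtain ⟨h1, h2⟩ := List.append_inj h (by rw [length_matWord, length_matWord])
  refine ⟨rfl, heq_of_eq (natGraph_injective ?_), bits_injective h2⟩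
  ext i j
  have hlt : ∀ {G : SimpleGraph (Fin n)}, G.natGraph.Adj i j → i < n ∧ j < n := by
    intro G hG
    obtain ⟨x, y, -, rfl, rfl⟩ := (map_adj ..).1 hG
    exact ⟨x.2, y.2⟩
  by_cases hij : i < n ∧ j < n
  · have := congrArg (fun l => l.getD (i * n + j) false) h1
    simpa only [matWord_getD _ hij.1 hij.2, decide_eq_decide] using this
  · exact iff_of_false (fun h => hij (hlt h)) fun h => hij (hlt h)

/-- Binary expansions, least significant digit first, are the words that do not end in `0`. The
default `true` admits the empty word, which is the expansion of zero. -/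
theorem exists_bits_eq {l : List Bool} (h : l.getLastD true = true) : ∃ m : ℕ, m.bits = l := by
  induction l with
  | nil => exact ⟨0, Nat.zero_bits⟩
  | cons b l ih =>
    have hl : l.getLastD true = true := by
      cases l with
      | nil => rfl
      | cons c l => simpa [List.getLastD] using h
    obtain ⟨m, rfl⟩ := ih hl
    refine ⟨Nat.bit b m, Nat.bits_append_bit m b fun hm => ?_⟩
    subst hm
    simpa using h

theorem getLastD_bits (m : ℕ) : m.bits.getLastD true = true := by
  induction m using Nat.binaryRec' with
  | zero => simp
  | bit b m h ih =>
    rw [Nat.bits_append_bit _ _ h]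
    cases hm : m.bits with
    | nil =>
      have : m = 0 := bits_injective (by rw [hm, Nat.zero_bits])
      simp [h this]
    | cons c l =>
      rw [hm] at ih
      simpa [List.getLastD] using ih

/-- The oracle: it answers for a graph `H` on `m` vertices and numbers `l` and `k` whether `H`
contains the path on `l` vertices, and whether `H` is prime with `m = k`. -/
def queryLang : Language Bool :=
  {w | ∃ (m : ℕ) (H : SimpleGraph (Fin m)) (l k : ℕ) (b : Bool),
    -- The symbol that is pushed first lies at the bottom of the query stack, so the reversed word
    -- is the one in order of writing. The bit `b`, written last, selects the question.
    w.reverse = instanceWord (encodeGraphNat H l) k ++ [b] ∧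
      if b = true then (pathGraph l).IsIndContained H else H.IsPrimeGraph ∧ m = k}

/-- Unique decoding: the word determines the graph, both numbers and the question, so the
existential quantifiers in `queryLang` cause no ambiguity. -/
theorem mem_queryLang_iff {m : ℕ} {H : SimpleGraph (Fin m)} {l k : ℕ} {b : Bool} {w : List Bool}
    (h : w.reverse = instanceWord (encodeGraphNat H l) k ++ [b]) : w ∈ queryLang ↔
      if b = true then (pathGraph l).IsIndContained H else H.IsPrimeGraph ∧ m = k := by
  refine ⟨?_, fun h' => ⟨m, H, l, k, b, h, h'⟩⟩
  rintro ⟨m', H', l', k', b', h1, h2⟩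
  rw [h] at h1
  obtain ⟨h1, hb⟩ := List.append_inj' h1 rfl
  obtain ⟨hk, hx⟩ := replicate_append_false_inj h1
  subst hk
  obtain ⟨rfl, h3, rfl⟩ := encodeGraphNat_inj hx
  obtain rfl := eq_of_heq h3
  obtain rfl : b = b' := by simpa using hb
  exact h2

/-- The graph on `Fin m` that a graph induces on a list of `m` vertices. -/
def listGraph (G : SimpleGraph ℕ) (l : List ℕ) : SimpleGraph (Fin l.length) := G.comap l.get

open Classical in
/-- The word of a query about the graph that is induced on a list of vertices. -/
noncomputable def queryWord (G : SimpleGraph ℕ) (l : List ℕ) (k : ℕ) (bits : List Bool) :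
    List Bool :=
  List.replicate k true ++ false :: (List.replicate l.length true ++ false ::
    (l.flatMap (fun i => l.map fun j => decide (G.Adj i j)) ++ bits))

theorem queryWord_eq (G : SimpleGraph ℕ) (l : List ℕ) (k m : ℕ) :
    queryWord G l k m.bits = instanceWord (encodeGraphNat (listGraph G l) m) k := by
  have h : ∀ {X : Type} (f : ℕ → X), (List.finRange l.length).map (fun i => f (l.get i)) =
      l.map f := by
    intro X f
    conv_rhs => rw [← List.map_get_finRange l]
    rw [List.map_map]
    rfl
  have h' : ∀ (f : ℕ → List Bool), (List.finRange l.length).flatMap (fun i => f (l.get i)) =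
      l.flatMap f := by
    intro f
    rw [List.flatMap_def, h, List.flatMap_def]
  rw [queryWord, instanceWord, encodeGraphNat, ← h']
  simp only [← h]
  rfl

theorem length_queryWord (G : SimpleGraph ℕ) (l : List ℕ) (k : ℕ) (bits : List Bool) :
    (queryWord G l k bits).length =
      k + 1 + l.length + 1 + l.length * l.length + bits.length := by
  simp [queryWord, List.length_flatMap]
  ring

theorem isPrimeGraph_listGraph_iff {G : SimpleGraph ℕ} {l : List ℕ} (hl : l.Nodup) :
    (listGraph G l).IsPrimeGraph ↔ G.IsPrimeSet {x | x ∈ l} := by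
  rw [isPrimeGraph_iff_isPrimeSet_range (f := l.get) (G := G) (List.nodup_iff_injective_get.1 hl)
    (fun x y => Iff.rfl), Set.range_list_get]

theorem isIndContained_listGraph_iff {G : SimpleGraph ℕ} {l : List ℕ} (hl : l.Nodup) {W : Type}
    {H : SimpleGraph W} : H.IsIndContained (listGraph G l) ↔ IndIn H G {x | x ∈ l} := by
  constructor
  · rintro ⟨f⟩
    exact ⟨fun w => l.get (f w), fun x y h => f.injective (List.nodup_iff_injective_get.1 hl h),
      fun w => l.get_mem (f w), fun x y => f.map_adj_iff.symm⟩
  · rintro ⟨f, h1, h2, h3⟩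
    choose g hg using fun w => List.mem_iff_get.1 (h2 w)
    refine ⟨⟨⟨g, fun x y h => h1 (by rw [← hg x, ← hg y, h])⟩, ?_⟩⟩
    intro x y
    rw [h3, ← hg x, ← hg y]
    rfl

end SimpleGraph

/-! ### The algorithm -/

namespace LoopLang

section Loops

variable {I C A F : Type} [DecidableEq I] [DecidableEq C] [DecidableEq A] [DecidableEq F]
  {L : Language Bool} {N : ℕ} {env : I → ℕ} {s : HS C A F} {p : HProg I C A F} {i : I}

theorem eval_loop (st : ℕ → HS C A F) (h0 : st 0 = s)
    (h : ∀ j < N, eval L N p (Function.update env i j) (st j) = st (j + 1)) :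
    eval L N (.loop i p) env s = st N :=
  iter_induction (fun j s => s = st j) h0.symm fun j hj s hs => by rw [hs, h j hj]

/-- A loop up to `N` with a guard acts as a loop up to `m ≤ N`: once the guard fails, the state is
frozen at `st m`. By `hb` the body does not change the bound. -/
theorem eval_loop_lt {b : I ⊕ C} {m : ℕ} (hm : m ≤ N) (st : ℕ → HS C A F) (h0 : st 0 = s)
    (hb : ∀ j k, j ≤ m → val (Function.update env i k) (st j) b = m)
    (h : ∀ j < m, eval L N p (Function.update env i j) (st j) = st (j + 1)) :
    eval L N (.loop i (.ifLt (.inl i) b p .skip)) env s = st m := by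
  have := iter_induction (f := fun j s => eval L N (.ifLt (.inl i) b p .skip)
    (Function.update env i j) s) (N := N) (fun j s => s = st (min j m)) (s := s) (by simp [h0])
    fun j hj s hs => by
      rw [hs]
      rcases lt_or_ge j m with hjm | hjm
      · rw [min_eq_left hjm.le, min_eq_left (by omega), ← h j hjm, eval, if_pos]
        rw [hb j j hjm.le]
        simpa [val] using hjm
      · rw [min_eq_right hjm, min_eq_right (by omega), eval, if_neg, eval]
        rw [hb m j le_rfl]
        simpa [val] using hjm
  rw [min_eq_right hm] at this
  exact this

end Loops

end LoopLang

/-! ### Variables and code of the algorithm, and its evaluation. -/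

namespace InducedPath

open LoopLang SimpleGraph

/-- The index variables. -/
inductive Ix | r | s | a | b | c | d | u | v | w
  deriving DecidableEq

instance : Fintype Ix := ⟨{.r, .s, .a, .b, .c, .d, .u, .v, .w}, fun x => by cases x <;> decide⟩

/-- The counters. -/
inductive Ctr | k | n | q | e | t
  deriving DecidableEq

instance : Fintype Ctr := ⟨{.k, .n, .q, .e, .t}, fun x => by cases x <;> decide⟩

/-- The arrays. -/
inductive Arr | adj | ell | S | M
  deriving DecidableEq

instance : Fintype Arr := ⟨{.adj, .ell, .S, .M}, fun x => by cases x <;> decide⟩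

/-- The flags. -/
inductive Fl | rej | fin | path | mw
  deriving DecidableEq

instance : Fintype Fl := ⟨{.rej, .fin, .path, .mw}, fun x => by cases x <;> decide⟩

/-- Programs of the algorithm. -/
abbrev P : Type := HProg Ix Ctr Arr Fl

/-- Sequences of programs. -/
def block : List P → P
  | [] => .skip
  | p :: l => .seq p (block l)

/-- Read `1ᵏ0`, and set the counters `k` and `t` to `k` and `k + 2`. -/
def readParam : P :=
  block [.inc .t, .inc .t, .loop .r (.ifF .fin .skip (.popIn (.setF .fin true) (.setF .fin true)
    (block [.inc .k, .inc .t]))), .setF .fin false]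

/-- Read `1ⁿ0`, and set the counter `n` to `n`. -/
def readSize : P :=
  block [.loop .r (.ifF .fin .skip (.popIn (block [.setF .rej true, .setF .fin true])
    (.setF .fin true) (.inc .n))), .setF .fin false]

/-- Read a matrix with `n` rows and columns. -/
def readMat : P :=
  block [.loop .a (.ifLt (.inl .a) (.inr .n) (.loop .b (.ifLt (.inl .b) (.inr .n)
    (.popIn (.setF .rej true) (block [.wr .adj (.inr .q) false, .inc .q])
      (block [.wr .adj (.inr .q) true, .inc .q])) .skip)) .skip), .reset .q]

/-- Read the binary digits of a number. -/
def readBits : P :=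
  -- The flag `fin` records whether the last digit so far is `0`, in which case the word is not a
  -- binary expansion.
  block [.loop .r (.popIn .skip (block [.wr .ell (.inr .e) false, .inc .e, .setF .fin true])
    (block [.wr .ell (.inr .e) true, .inc .e, .setF .fin false])),
    .ifF .fin (block [.setF .rej true, .setF .fin false]) .skip,
    -- More than `k + 2` digits: the path is too long for a graph of modular-width `k`.
    .ifLt (.inr .t) (.inr .e) (.setF .rej true) .skip]

/-- Add `i * n + j` to the counter `q`. -/
def addr (i j : Ix) : P :=
  block [.loop .r (.ifLt (.inl .r) (.inl i)
    (.loop .s (.ifLt (.inl .s) (.inr .n) (.inc .q) .skip)) .skip),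
    .loop .r (.ifLt (.inl .r) (.inl j) (.inc .q) .skip)]

/-- Test the adjacency of two vertices. -/
def ifAdj (i j : Ix) (p q : P) : P :=
  block [addr i j, .ifRd .adj (.inr .q) (block [.reset .q, p]) (block [.reset .q, q])]

/-- Reject if the matrix is not the adjacency matrix of a graph. -/
def validate : P :=
  .loop .a (.ifLt (.inl .a) (.inr .n) (block [
    .loop .b (.ifLt (.inl .b) (.inr .n) (ifAdj .a .b (ifAdj .b .a .skip (.setF .rej true)) .skip)
      .skip),
    ifAdj .a .a (.setF .rej true) .skip]) .skip)

/-- Write the query word for the graph that is induced on `M`. -/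
def emit : P :=
  block [.loop .r (.ifLt (.inl .r) (.inr .k) (.push true) .skip), .push false,
    .loop .a (.ifRd .M (.inl .a) (.push true) .skip), .push false,
    .loop .a (.ifRd .M (.inl .a) (.loop .b (.ifRd .M (.inl .b)
      (ifAdj .a .b (.push true) (.push false)) .skip)) .skip),
    .loop .r (.ifLt (.inl .r) (.inr .e) (.ifRd .ell (.inl .r) (.push true) (.push false)) .skip)]

/-- Ask the two questions about the graph that is induced on `M`. -/
def query : P :=
  block [emit, .push false, .ifAsk (.setF .mw true) .skip,
    emit, .push true, .ifAsk (.setF .path true) .skip]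

/-- Empty the set `M`. -/
def clear : P := .loop .a (.wr .M (.inl .a) false)

/-- Enlarge `M` to a module. -/
def close : P :=
  -- The index `c` only counts rounds. All members of `M` are compared with the fixed member `u`.
  .loop .c (.loop .w (.ifRd .S (.inl .w) (.loop .a (.ifRd .M (.inl .a)
    (ifAdj .w .a (ifAdj .w .u .skip (.wr .M (.inl .w) true))
      (ifAdj .w .u (.wr .M (.inl .w) true) .skip)) .skip)) .skip))

/-- Treat the smallest module that contains `u` and `v`. -/
def reduce : P :=
  block [clear, .wr .M (.inl .u) true, .wr .M (.inl .v) true, close,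
    .loop .a (.ifRd .M (.inl .a) (.inc .q) .skip),
    .ifLt (.inr .k) (.inr .q) (.reset .q) (block [.reset .q, query, .wr .S (.inl .v) false])]

/-- All reductions. -/
def reduceAll : P :=
  -- Here too `d` only counts rounds: a pair that allows no deletion at first may allow one after
  -- `S` has shrunk.
  .loop .d (.loop .u (.loop .v (.ifLt (.inl .v) (.inl .u)
    (.ifRd .S (.inl .u) (.ifRd .S (.inl .v) reduce .skip) .skip) .skip)))

/-- Ask about all sets with at most three vertices. -/
def triples : P :=
  .loop .u (.ifLt (.inl .u) (.inr .n) (.loop .v (.ifLt (.inl .v) (.inr .n)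
    (.loop .w (.ifLt (.inl .w) (.inr .n)
      (block [clear, .wr .M (.inl .u) true, .wr .M (.inl .v) true, .wr .M (.inl .w) true, query])
      .skip)) .skip)) .skip)

/-- Let `S` be the set of all vertices. -/
def initAll : P := .loop .u (.ifLt (.inl .u) (.inr .n) (.wr .S (.inl .u) true) .skip)

/-- Reject if two vertices are left, or if there are vertices although `k` is zero. -/
def final : P :=
  block [.loop .u (.loop .v (.ifLt (.inl .v) (.inl .u)
    (.ifRd .S (.inl .u) (.ifRd .S (.inl .v) (.setF .rej true) .skip) .skip) .skip)),
    -- The counter `q` is zero at this point, so the comparison tests `0 < k`.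
    .loop .u (.ifLt (.inl .u) (.inr .n) (.ifLt (.inr .q) (.inr .k) .skip (.setF .rej true)) .skip)]

/-- The part of the algorithm after reading the input. -/
def work : P := block [query, triples, initAll, reduceAll, final]

/-- The whole algorithm. -/
def algorithm : P :=
  block [readParam, readSize, .ifF .rej .skip (block [readMat, .ifF .rej .skip (block [readBits,
    .ifF .rej .skip (block [validate, .ifF .rej .skip work])])])]

/-- The acceptance condition. -/
def accepts (f : Fl → Bool) : Bool := !f .rej && f .mw && f .path

theorem wf_algorithm : wf algorithm [] = true := by decide

/-- A readable form of the states of the algorithm. -/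
structure Conf where
  inp : List Bool
  qry : List Bool
  adj : ℕ → Bool
  ell : ℕ → Bool
  S : Finset ℕ
  M : Finset ℕ
  k : ℕ
  n : ℕ
  q : ℕ
  e : ℕ
  t : ℕ
  rej : Bool
  fin : Bool
  path : Bool
  mw : Bool
  mq : ℕ

/-- The state of the loop program. -/
def Conf.toHS (c : Conf) : HS Ctr Arr Fl where
  inp := c.inp
  qry := c.qry
  arr := fun
    | .adj => c.adj
    | .ell => c.ell
    | .S => fun i => decide (i ∈ c.S)
    | .M => fun i => decide (i ∈ c.M)
  cnt := fun
    | .k => c.k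
    | .n => c.n
    | .q => c.q
    | .e => c.e
    | .t => c.t
  flag := fun
    | .rej => c.rej
    | .fin => c.fin
    | .path => c.path
    | .mw => c.mw
  maxq := c.mq

/-! ### Effect of single commands on the readable states. -/

section Eval

variable {L : Language Bool} {N : ℕ} {env : Ix → ℕ} {c : Conf} {p q r : P}

@[simp] theorem eval_block_nil (s : HS Ctr Arr Fl) : eval L N (block []) env s = s := rfl

@[simp] theorem eval_block_cons (l : List P) (s : HS Ctr Arr Fl) :
    eval L N (block (p :: l)) env s = eval L N (block l) env (eval L N p env s) := rfl

@[simp] theorem eval_skip (s : HS Ctr Arr Fl) : eval L N (.skip : P) env s = s := rfl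

@[simp] theorem eval_ifLt (x y : Ix ⊕ Ctr) (s : HS Ctr Arr Fl) : eval L N (.ifLt x y p q) env s =
    if val env s x < val env s y then eval L N p env s else eval L N q env s := by rw [eval]

@[simp] theorem val_inl (i : Ix) (s : HS Ctr Arr Fl) : val env s (.inl i) = env i := rfl
@[simp] theorem val_k : val env c.toHS (.inr .k) = c.k := rfl
@[simp] theorem val_n : val env c.toHS (.inr .n) = c.n := rfl
@[simp] theorem val_q : val env c.toHS (.inr .q) = c.q := rfl
@[simp] theorem val_e : val env c.toHS (.inr .e) = c.e := rfl
@[simp] theorem val_t : val env c.toHS (.inr .t) = c.t := rfl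

@[simp] theorem eval_ifRej : eval L N (.ifF .rej p q) env c.toHS =
    if c.rej = true then eval L N p env c.toHS else eval L N q env c.toHS := by rw [eval]; rfl

@[simp] theorem eval_ifFin : eval L N (.ifF .fin p q) env c.toHS =
    if c.fin = true then eval L N p env c.toHS else eval L N q env c.toHS := by rw [eval]; rfl

@[simp] theorem eval_rdS (j : Ix ⊕ Ctr) : eval L N (.ifRd .S j p q) env c.toHS =
    if val env c.toHS j ∈ c.S then eval L N p env c.toHS else eval L N q env c.toHS := by
  rw [eval]; exact if_congr (by exact decide_eq_true_iff) rfl rfl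

@[simp] theorem eval_rdM (j : Ix ⊕ Ctr) : eval L N (.ifRd .M j p q) env c.toHS =
    if val env c.toHS j ∈ c.M then eval L N p env c.toHS else eval L N q env c.toHS := by
  rw [eval]; exact if_congr (by exact decide_eq_true_iff) rfl rfl

@[simp] theorem eval_rdAdj (j : Ix ⊕ Ctr) : eval L N (.ifRd .adj j p q) env c.toHS =
    if c.adj (val env c.toHS j) = true then eval L N p env c.toHS else eval L N q env c.toHS := by
  rw [eval]; rfl

@[simp] theorem eval_rdEll (j : Ix ⊕ Ctr) : eval L N (.ifRd .ell j p q) env c.toHS =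
    if c.ell (val env c.toHS j) = true then eval L N p env c.toHS else eval L N q env c.toHS := by
  rw [eval]; rfl

theorem eval_pop_nil (h : c.inp = []) :
    eval L N (.popIn p q r) env c.toHS = eval L N p env c.toHS := by
  rw [eval]; simp [Conf.toHS, h]

theorem eval_pop_cons {b : Bool} {l : List Bool} (h : c.inp = b :: l) :
    eval L N (.popIn p q r) env c.toHS =
      eval L N (if b = true then r else q) env { c with inp := l }.toHS := by
  rw [eval]; cases b <;> simp [Conf.toHS, h]

@[simp] theorem eval_setRej (b : Bool) :
    eval L N (.setF .rej b) env c.toHS = { c with rej := b }.toHS := by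
  simp only [eval, Conf.toHS, HS.mk.injEq, true_and, and_true]; funext x; cases x <;> simp

@[simp] theorem eval_setFin (b : Bool) :
    eval L N (.setF .fin b) env c.toHS = { c with fin := b }.toHS := by
  simp only [eval, Conf.toHS, HS.mk.injEq, true_and, and_true]; funext x; cases x <;> simp

@[simp] theorem eval_setPath (b : Bool) :
    eval L N (.setF .path b) env c.toHS = { c with path := b }.toHS := by
  simp only [eval, Conf.toHS, HS.mk.injEq, true_and, and_true]; funext x; cases x <;> simp

@[simp] theorem eval_setMw (b : Bool) :
    eval L N (.setF .mw b) env c.toHS = { c with mw := b }.toHS := by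
  simp only [eval, Conf.toHS, HS.mk.injEq, true_and, and_true]; funext x; cases x <;> simp

@[simp] theorem eval_push (b : Bool) :
    eval L N (.push b) env c.toHS = { c with qry := b :: c.qry }.toHS := by
  simp only [eval, Conf.toHS]

@[simp] theorem eval_resetQ : eval L N (.reset .q) env c.toHS = { c with q := 0 }.toHS := by
  simp only [eval, Conf.toHS, HS.mk.injEq, true_and, and_true]; funext x; cases x <;> simp

@[simp] theorem eval_incQ :
    eval L N (.inc .q) env c.toHS = { c with q := min N (c.q + 1) }.toHS := by
  simp only [eval, Conf.toHS, HS.mk.injEq, true_and, and_true]; funext x; cases x <;> simp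

@[simp] theorem eval_incK :
    eval L N (.inc .k) env c.toHS = { c with k := min N (c.k + 1) }.toHS := by
  simp only [eval, Conf.toHS, HS.mk.injEq, true_and, and_true]; funext x; cases x <;> simp

@[simp] theorem eval_incN :
    eval L N (.inc .n) env c.toHS = { c with n := min N (c.n + 1) }.toHS := by
  simp only [eval, Conf.toHS, HS.mk.injEq, true_and, and_true]; funext x; cases x <;> simp

@[simp] theorem eval_incE :
    eval L N (.inc .e) env c.toHS = { c with e := min N (c.e + 1) }.toHS := by
  simp only [eval, Conf.toHS, HS.mk.injEq, true_and, and_true]; funext x; cases x <;> simp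

@[simp] theorem eval_incT :
    eval L N (.inc .t) env c.toHS = { c with t := min N (c.t + 1) }.toHS := by
  simp only [eval, Conf.toHS, HS.mk.injEq, true_and, and_true]; funext x; cases x <;> simp

@[simp] theorem eval_wrAdj (j : Ix ⊕ Ctr) (b : Bool) : eval L N (.wr .adj j b) env c.toHS =
    { c with adj := Function.update c.adj (val env c.toHS j) b }.toHS := by
  simp only [eval, Conf.toHS, HS.mk.injEq, true_and, and_true]; funext x; cases x <;> simp

@[simp] theorem eval_wrEll (j : Ix ⊕ Ctr) (b : Bool) : eval L N (.wr .ell j b) env c.toHS =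
    { c with ell := Function.update c.ell (val env c.toHS j) b }.toHS := by
  simp only [eval, Conf.toHS, HS.mk.injEq, true_and, and_true]; funext x; cases x <;> simp

theorem update_decide_mem_true (X : Finset ℕ) (i : ℕ) :
    Function.update (fun j => decide (j ∈ X)) i true = fun j => decide (j ∈ insert i X) := by
  funext j
  by_cases h : j = i <;> simp [h]

theorem update_decide_mem_false (X : Finset ℕ) (i : ℕ) :
    Function.update (fun j => decide (j ∈ X)) i false = fun j => decide (j ∈ X.erase i) := by
  funext j
  by_cases h : j = i <;> simp [h]

@[simp] theorem eval_wrS_true (j : Ix ⊕ Ctr) : eval L N (.wr .S j true) env c.toHS =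
    { c with S := insert (val env c.toHS j) c.S }.toHS := by
  simp only [eval]
  generalize val env c.toHS j = m
  simp only [Conf.toHS, HS.mk.injEq, true_and, and_true]
  funext x; cases x <;> first | exact update_decide_mem_true _ _ | rfl

@[simp] theorem eval_wrS_false (j : Ix ⊕ Ctr) : eval L N (.wr .S j false) env c.toHS =
    { c with S := c.S.erase (val env c.toHS j) }.toHS := by
  simp only [eval]
  generalize val env c.toHS j = m
  simp only [Conf.toHS, HS.mk.injEq, true_and, and_true]
  funext x; cases x <;> first | exact update_decide_mem_false _ _ | rfl

@[simp] theorem eval_wrM_true (j : Ix ⊕ Ctr) : eval L N (.wr .M j true) env c.toHS =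
    { c with M := insert (val env c.toHS j) c.M }.toHS := by
  simp only [eval]
  generalize val env c.toHS j = m
  simp only [Conf.toHS, HS.mk.injEq, true_and, and_true]
  funext x; cases x <;> first | exact update_decide_mem_true _ _ | rfl

@[simp] theorem eval_wrM_false (j : Ix ⊕ Ctr) : eval L N (.wr .M j false) env c.toHS =
    { c with M := c.M.erase (val env c.toHS j) }.toHS := by
  simp only [eval]
  generalize val env c.toHS j = m
  simp only [Conf.toHS, HS.mk.injEq, true_and, and_true]
  funext x; cases x <;> first | exact update_decide_mem_false _ _ | rfl

open Classical in
theorem eval_ifAsk : eval L N (.ifAsk p q) env c.toHS =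
    if c.qry ∈ L then eval L N p env { c with qry := [], mq := max c.mq c.qry.length }.toHS
    else eval L N q env { c with qry := [], mq := max c.mq c.qry.length }.toHS := by
  rw [eval]; rfl

theorem eval_loop_conf {i : Ix} (cf : ℕ → Conf) {c' : Conf} (h0 : cf 0 = c) (h1 : cf N = c')
    (h : ∀ j < N, eval L N p (Function.update env i j) (cf j).toHS = (cf (j + 1)).toHS) :
    eval L N (.loop i p) env c.toHS = c'.toHS := by
  rw [← h1]
  exact eval_loop (fun j => (cf j).toHS) (by rw [h0]) h

theorem eval_loop_lt_conf {i : Ix} {b : Ix ⊕ Ctr} {m : ℕ} (hm : m ≤ N) (cf : ℕ → Conf) {c' : Conf}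
    (h0 : cf 0 = c) (h1 : cf m = c')
    (hb : ∀ j k, j ≤ m → val (Function.update env i k) (cf j).toHS b = m)
    (h : ∀ j < m, eval L N p (Function.update env i j) (cf j).toHS = (cf (j + 1)).toHS) :
    eval L N (.loop i (.ifLt (.inl i) b p .skip)) env c.toHS = c'.toHS := by
  rw [← h1]
  exact eval_loop_lt hm (fun j => (cf j).toHS) (by rw [h0]) hb h

/-- The address is accumulated in `q` by single increments, which `hN` keeps below the cap. The
indices `r` and `s` are reserved for this purpose, and `q` is zero again before a branch is entered.
-/
theorem eval_ifAdj {i j : Ix} (hi : i ≠ .r ∧ i ≠ .s) (hj : j ≠ .r ∧ j ≠ .s) (hq : c.q = 0)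
    (hN : c.n * c.n ≤ N) (hin : env i < c.n) (hjn : env j < c.n) :
    eval L N (ifAdj i j p q) env c.toHS =
      if c.adj (env i * c.n + env j) = true then eval L N p env c.toHS
      else eval L N q env c.toHS := by
  have hnN : c.n ≤ N := (Nat.le_mul_self _).trans hN
  have hmul : env i * c.n + env j < c.n * c.n := by nlinarith
  have h1 : eval L N (.loop .r (.ifLt (.inl .r) (.inl i)
      (.loop .s (.ifLt (.inl .s) (.inr .n) (.inc .q) .skip)) .skip)) env c.toHS =
      { c with q := env i * c.n }.toHS := by
    refine eval_loop_lt_conf (hin.le.trans hnN) (fun m => { c with q := m * c.n })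
      (by rw [zero_mul, ← hq]) rfl (fun m k _ => by simp [hi.1]) fun m hm => ?_
    refine eval_loop_lt_conf hnN (fun m' => { c with q := m * c.n + m' }) rfl
      (by rw [Nat.succ_mul]) (fun _ _ _ => rfl) fun m' hm' => ?_
    rw [eval_incQ]
    have : m * c.n + m' + 1 ≤ N := by nlinarith
    simp only [min_eq_right this]
    rfl
  have h2 : eval L N (.loop .r (.ifLt (.inl .r) (.inl j) (.inc .q) .skip)) env
      { c with q := env i * c.n }.toHS = { c with q := env i * c.n + env j }.toHS := by
    refine eval_loop_lt_conf (hjn.le.trans hnN) (fun m => { c with q := env i * c.n + m }) rfl rfl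
      (fun m k _ => by simp [hj.1]) fun m hm => ?_
    rw [eval_incQ]
    have : env i * c.n + m + 1 ≤ N := by omega
    simp only [min_eq_right this]
    rfl
  rw [ifAdj, eval_block_cons, addr, eval_block_cons (p := .loop .r _), h1, eval_block_cons (p := .loop .r _), h2]
  simp only [eval_block_nil, eval_block_cons, eval_rdAdj, val_q, eval_resetQ, ← hq]

end Eval

end InducedPath

namespace InducedPath

open LoopLang SimpleGraph

variable {L : Language Bool} {N : ℕ} {env : Ix → ℕ} {c : Conf} {p : P}

/-! ### Queries -/

theorem flatMap_ite {X Y : Type} (l : List X) (b : X → Prop) [DecidablePred b] (f : X → List Y) :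
    (l.flatMap fun a => if b a then f a else []) = (l.filter fun a => decide (b a)).flatMap f := by
  induction l with
  | nil => rfl
  | cons a l ih =>
    by_cases h : b a <;> simp [h, ih]

theorem flatMap_const_true {X : Type} (l : List X) :
    (l.flatMap fun _ => [true]) = List.replicate l.length true := by
  induction l with
  | nil => rfl
  | cons a l ih => simp [ih, List.replicate_succ]

/-- If each round pushes a word, the loop pushes the concatenation; on the stack it appears
reversed. -/
theorem eval_loop_emit {i : Ix} {m : ℕ} (g : ℕ → List Bool)
    (hp : ∀ j y, eval L N p (Function.update env i j) { c with qry := y }.toHS =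
      if j < m then { c with qry := (g j).reverse ++ y }.toHS else { c with qry := y }.toHS)
    (hm : m ≤ N) (y : List Bool) : eval L N (.loop i p) env { c with qry := y }.toHS =
      { c with qry := ((List.range m).flatMap g).reverse ++ y }.toHS := by
  refine eval_loop_conf
    (fun j => { c with qry := ((List.range (min j m)).flatMap g).reverse ++ y }) (by simp)
    (by rw [min_eq_right hm]) fun j hj => ?_
  rw [hp]
  split_ifs with h
  · simp [min_eq_left h.le, min_eq_left (show j + 1 ≤ m by omega), List.range_succ]
  · simp [min_eq_right (not_lt.1 h), min_eq_right (show m ≤ j + 1 by omega)]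

/-- The list of the elements of a set of numbers below `N`. -/
def verts (N : ℕ) (X : Finset ℕ) : List ℕ := (List.range N).filter fun i => decide (i ∈ X)

theorem nodup_verts (N : ℕ) (X : Finset ℕ) : (verts N X).Nodup := List.nodup_range.filter _

theorem mem_verts {N : ℕ} {X : Finset ℕ} (h : X ⊆ Finset.range N) (i : ℕ) :
    i ∈ verts N X ↔ i ∈ X := by
  simp only [verts, List.mem_filter, List.mem_range, decide_eq_true_eq, and_iff_right_iff_imp]
  exact fun hi => Finset.mem_range.1 (h hi)

theorem length_verts {N : ℕ} {X : Finset ℕ} (h : X ⊆ Finset.range N) :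
    (verts N X).length = X.card := by
  rw [← List.toFinset_card_of_nodup (nodup_verts N X)]
  congr 1
  ext i
  rw [List.mem_toFinset, mem_verts h]

/-- The states after reading a graph `G` and a number `l`. -/
structure Good (N : ℕ) (G : SimpleGraph ℕ) (l : ℕ) (c : Conf) : Prop where
  q : c.q = 0
  qry : c.qry = []
  sq : c.n * c.n ≤ N
  k : c.k ≤ N
  e : c.e ≤ N
  adj : ∀ i < c.n, ∀ j < c.n, c.adj (i * c.n + j) = true ↔ G.Adj i j
  ell : (List.range c.e).map c.ell = l.bits
  S : c.S ⊆ Finset.range c.n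
  M : c.M ⊆ Finset.range c.n

variable {G : SimpleGraph ℕ} {l : ℕ}

theorem Good.n_le (hc : Good N G l c) : c.n ≤ N := (Nat.le_mul_self _).trans hc.sq

theorem Good.M_subset (hc : Good N G l c) : c.M ⊆ Finset.range N :=
  hc.M.trans (Finset.range_subset_range.2 hc.n_le)

theorem Good.S_subset (hc : Good N G l c) : c.S ⊆ Finset.range N :=
  hc.S.trans (Finset.range_subset_range.2 hc.n_le)

open Classical in
theorem Good.eval_ifAdj {q : P} (hc : Good N G l c) {i j : Ix} (hi : i ≠ .r ∧ i ≠ .s)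
    (hj : j ≠ .r ∧ j ≠ .s) (hin : env i < c.n) (hjn : env j < c.n) (y : List Bool) :
    eval L N (ifAdj i j p q) env { c with qry := y }.toHS =
      if G.Adj (env i) (env j) then eval L N p env { c with qry := y }.toHS
      else eval L N q env { c with qry := y }.toHS := by
  rw [InducedPath.eval_ifAdj (c := { c with qry := y }) hi hj hc.q hc.sq hin hjn]
  exact if_congr (hc.adj _ hin _ hjn) rfl rfl

theorem Good.eval_emit (hc : Good N G l c) (y : List Bool) :
    eval L N emit env { c with qry := y }.toHS =
      { c with qry := (queryWord G (verts N c.M) c.k l.bits).reverse ++ y }.toHS := by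
  classical
  have h1 : ∀ y, eval L N (.loop .r (.ifLt (.inl .r) (.inr .k) (.push true) .skip)) env
      { c with qry := y }.toHS = { c with qry := (List.replicate c.k true).reverse ++ y }.toHS := by
    intro y
    rw [eval_loop_emit (m := c.k) (fun _ => [true]) (fun j y => ?_) hc.k]
    · rw [flatMap_const_true, List.length_range]
    · simp
  have h2 : ∀ y, eval L N (.loop .a (.ifRd .M (.inl .a) (.push true) .skip)) env
      { c with qry := y }.toHS =
      { c with qry := (List.replicate (verts N c.M).length true).reverse ++ y }.toHS := by
    intro y
    rw [eval_loop_emit (m := N) (fun a => if a ∈ c.M then [true] else []) (fun j y => ?_) le_rfl]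
    · rw [flatMap_ite, flatMap_const_true, verts]
    · by_cases hj : j ∈ c.M
      · have := Finset.mem_range.1 (hc.M_subset hj)
        simp [hj, this]
      · simp [hj]
  have h3 : ∀ y, eval L N (.loop .a (.ifRd .M (.inl .a) (.loop .b (.ifRd .M (.inl .b)
      (ifAdj .a .b (.push true) (.push false)) .skip)) .skip)) env { c with qry := y }.toHS =
      { c with qry := ((verts N c.M).flatMap fun i =>
        (verts N c.M).map fun j => decide (G.Adj i j)).reverse ++ y }.toHS := by
    intro y
    have hin : ∀ a, a ∈ c.M → ∀ y, eval L N (.loop .b (.ifRd .M (.inl .b)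
        (ifAdj .a .b (.push true) (.push false)) .skip)) (Function.update env .a a)
        { c with qry := y }.toHS =
        { c with qry := ((verts N c.M).map fun j => decide (G.Adj a j)).reverse ++ y }.toHS := by
      intro a ha y
      rw [eval_loop_emit (m := N) (fun b => if b ∈ c.M then [decide (G.Adj a b)] else [])
        (fun j y => ?_) le_rfl]
      · congr 3
        rw [flatMap_ite, verts, List.map_eq_flatMap]
      · by_cases hj : j ∈ c.M
        · have hjn := Finset.mem_range.1 (hc.M hj)
          have han := Finset.mem_range.1 (hc.M ha)
          have := Finset.mem_range.1 (hc.M_subset hj)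
          simp only [eval_rdM, val_inl, Function.update_self, hj, if_true, this]
          rw [hc.eval_ifAdj (by decide) (by decide) (by simpa using han) (by simpa using hjn)]
          by_cases hadj : G.Adj a j <;> simp [hadj]
        · simp [hj]
    rw [eval_loop_emit (m := N) (fun a => if a ∈ c.M then
      (verts N c.M).map fun j => decide (G.Adj a j) else []) (fun j y => ?_) le_rfl]
    · congr 3
      rw [flatMap_ite, verts]
    · by_cases hj : j ∈ c.M
      · have := Finset.mem_range.1 (hc.M_subset hj)
        simp only [eval_rdM, val_inl, Function.update_self, hj, if_true, this, hin j hj]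
      · simp [hj]
  have h4 : ∀ y, eval L N (.loop .r (.ifLt (.inl .r) (.inr .e)
      (.ifRd .ell (.inl .r) (.push true) (.push false)) .skip)) env { c with qry := y }.toHS =
      { c with qry := l.bits.reverse ++ y }.toHS := by
    intro y
    rw [eval_loop_emit (m := c.e) (fun j => [c.ell j]) (fun j y => ?_) hc.e]
    · rw [← List.map_eq_flatMap, hc.ell]
    · by_cases hj : c.ell j = true <;> simp [hj]
  simp only [emit, eval_block_cons, eval_block_nil, h1, eval_push, h2, h3, h4]
  simp [queryWord]

-- The word is written twice, since the first call empties the query stack. Both queries have the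
-- same length, so `mq` is updated by a single maximum.
open Classical in
theorem Good.eval_query (hc : Good N G l c) :
    eval queryLang N query env c.toHS =
      { c with
        mw := c.mw || decide (G.IsPrimeSet (c.M : Set ℕ) ∧ c.M.card = c.k)
        path := c.path || decide (IndIn (pathGraph l) G (c.M : Set ℕ))
        mq := max c.mq (c.k + 1 + c.M.card + 1 + c.M.card * c.M.card + l.bits.length + 1) }.toHS := by
  -- For arbitrary values of these two fields, because the first call changes them before the second
  -- word is written.
  have he : ∀ (mw : Bool) (mq : ℕ),
      eval queryLang N emit env { c with qry := [], mw := mw, mq := mq }.toHS =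
      { c with qry := (queryWord G (verts N c.M) c.k l.bits).reverse
               mw := mw
               mq := mq }.toHS := by
    intro mw mq
    have hc' : Good N G l { c with mw := mw, mq := mq } :=
      ⟨hc.q, hc.qry, hc.sq, hc.k, hc.e, hc.adj, hc.ell, hc.S, hc.M⟩
    have := hc'.eval_emit (L := queryLang) (env := env) []
    rw [List.append_nil] at this
    exact this
  have hset : {x | x ∈ verts N c.M} = (c.M : Set ℕ) := by
    ext i
    exact mem_verts hc.M_subset i
  have hlen := length_queryWord G (verts N c.M) c.k l.bits
  rw [length_verts hc.M_subset] at hlen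
  have hmem : ∀ b : Bool, b :: (queryWord G (verts N c.M) c.k l.bits).reverse ∈ queryLang ↔
      if b = true then IndIn (pathGraph l) G (c.M : Set ℕ)
      else G.IsPrimeSet (c.M : Set ℕ) ∧ c.M.card = c.k := by
    intro b
    rw [mem_queryLang_iff (H := listGraph G (verts N c.M)) (l := l) (k := c.k) (b := b)
      (by simp [queryWord_eq]), isIndContained_listGraph_iff (nodup_verts _ _),
      isPrimeGraph_listGraph_iff (nodup_verts _ _), hset, length_verts hc.M_subset]
  have h1 := he c.mw c.mq
  rw [show ({ c with qry := [], mw := c.mw, mq := c.mq } : Conf) = c by rw [← hc.qry]] at h1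
  simp only [query, eval_block_cons, eval_block_nil, h1, eval_push, eval_ifAsk, hmem,
    List.length_cons, List.length_reverse, hlen, eval_setMw, eval_skip, Bool.false_eq_true,
    if_false]
  by_cases hA : G.IsPrimeSet (c.M : Set ℕ) ∧ c.M.card = c.k <;>
    by_cases hB : IndIn (pathGraph l) G (c.M : Set ℕ) <;>
    (first | rw [if_pos hA, decide_eq_true hA] | rw [if_neg hA, decide_eq_false hA]) <;>
    simp only [hB, if_true, if_false, he, eval_push, eval_ifAsk, hmem, eval_setPath,
      List.length_cons, List.length_reverse, hlen, eval_skip, max_assoc, max_self] <;>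
    simp [hc.qry]

end InducedPath

namespace InducedPath

open LoopLang SimpleGraph

variable {L : Language Bool} {N : ℕ} {env : Ix → ℕ} {c : Conf} {p : P} {G : SimpleGraph ℕ} {l : ℕ}

/-! ### The smallest module that contains a set -/

section Closure

open Classical in
/-- Add the vertex `w` if it distinguishes `a` and `u`. -/
noncomputable def addSplitter (G : SimpleGraph ℕ) (u w a : ℕ) (X : Finset ℕ) : Finset ℕ :=
  if a ∈ X ∧ ¬(G.Adj w a ↔ G.Adj w u) then insert w X else X

/-- Add the vertex `w` if it distinguishes vertices. -/
noncomputable def addSplitters (G : SimpleGraph ℕ) (N u : ℕ) (S : Finset ℕ) (w : ℕ)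
    (X : Finset ℕ) : Finset ℕ :=
  if w ∈ S then iter (addSplitter G u w) N X else X

/-- Add all vertices that distinguish vertices. -/
noncomputable def closeStep (G : SimpleGraph ℕ) (N u : ℕ) (S X : Finset ℕ) : Finset ℕ :=
  iter (addSplitters G N u S) N X

/-- The smallest module of the subgraph induced on `S` that contains `X`. -/
noncomputable def closure (G : SimpleGraph ℕ) (N u : ℕ) (S X : Finset ℕ) : Finset ℕ :=
  iter (fun _ => closeStep G N u S) N X

/-- No vertex of `S` outside of `X` distinguishes the vertices of `X`. -/
def IsClosed (G : SimpleGraph ℕ) (u : ℕ) (S X : Finset ℕ) : Prop :=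
  ∀ w ∈ S, w ∉ X → ∀ a ∈ X, (G.Adj w a ↔ G.Adj w u)

variable {u : ℕ} {S X : Finset ℕ}

/-- The set grows by at most `w`, and only if `w` distinguishes two of its members, in which case
every module that contains the set contains `w`. The last two clauses link "nothing was added" to
"`w` is no splitter", for the detection of a fixed point. -/
theorem iter_addSplitter {w : ℕ} (hw : w ∈ S) (hu : u ∈ X) (hX : X ⊆ Finset.range N) :
    X ⊆ iter (addSplitter G u w) N X ∧
    (∀ Y : Set ℕ, G.IsModuleIn S Y → (X : Set ℕ) ⊆ Y →
      ((iter (addSplitter G u w) N X : Finset ℕ) : Set ℕ) ⊆ Y) ∧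
    (iter (addSplitter G u w) N X ⊆ insert w X) ∧
    (iter (addSplitter G u w) N X = X → w ∉ X → ∀ a ∈ X, (G.Adj w a ↔ G.Adj w u)) ∧
    ((∀ a ∈ X, (G.Adj w a ↔ G.Adj w u)) → iter (addSplitter G u w) N X = X) := by
  have h := iter_induction (f := addSplitter G u w) (s := X) (N := N) (fun j X' => X ⊆ X' ∧
    (∀ Y : Set ℕ, G.IsModuleIn S Y → (X : Set ℕ) ⊆ Y → (X' : Set ℕ) ⊆ Y) ∧ (X' ⊆ insert w X) ∧
    (X' = X → w ∉ X → ∀ a ∈ X, a < j → (G.Adj w a ↔ G.Adj w u)) ∧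
    ((∀ a ∈ X, (G.Adj w a ↔ G.Adj w u)) → X' = X))
    ⟨subset_rfl, fun Y _ h => h, Finset.subset_insert _ _, fun _ _ a _ h => absurd h (by omega),
      fun _ => rfl⟩ ?_
  · exact ⟨h.1, h.2.1, h.2.2.1, fun h1 h2 a ha =>
      h.2.2.2.1 h1 h2 a ha (Finset.mem_range.1 (hX ha)), h.2.2.2.2⟩
  · intro j hj X' h
    obtain ⟨h1, h2, h3, h4, h5⟩ := h
    unfold addSplitter
    split_ifs with hs
    · refine ⟨h1.trans (Finset.subset_insert _ _), fun Y hY hXY => ?_,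
        Finset.insert_subset (Finset.mem_insert_self _ _) h3, fun h hw => ?_, fun h => ?_⟩
      · rw [Finset.coe_insert, Set.insert_subset_iff]
        refine ⟨?_, h2 Y hY hXY⟩
        by_contra hwY
        have hu' : u ∈ Y := hXY hu
        have ha' : j ∈ Y := h2 Y hY hXY hs.1
        -- Outside the module `Y`, the vertex `w` could not distinguish the members `j` and `u` of
        -- `Y`.
        exact hs.2 ⟨hY.2 w hw hwY j ha' u hu', hY.2 w hw hwY u hu' j ha'⟩
      · exact absurd (h ▸ Finset.mem_insert_self w X') hw
      · rw [h5 h] at hs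
        exact absurd (h j hs.1) hs.2
    · refine ⟨h1, h2, h3, fun h hw a ha haj => ?_, h5⟩
      rcases Nat.lt_succ_iff_lt_or_eq.1 haj with haj | rfl
      · exact h4 h hw a ha haj
      · by_contra hcon
        exact hs ⟨h1 ha, hcon⟩

theorem closeStep_spec (hu : u ∈ X) (hXS : X ⊆ S) (hS : S ⊆ Finset.range N) :
    X ⊆ closeStep G N u S X ∧
    (∀ Y : Set ℕ, G.IsModuleIn S Y → (X : Set ℕ) ⊆ Y → ((closeStep G N u S X : Finset ℕ) : Set ℕ) ⊆ Y) ∧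
    (closeStep G N u S X ⊆ S) ∧
    (closeStep G N u S X = X → IsClosed G u S X) ∧
    (IsClosed G u S X → closeStep G N u S X = X) := by
  have h := iter_induction (f := addSplitters G N u S) (s := X) (N := N) (fun j X' => X ⊆ X' ∧
    (∀ Y : Set ℕ, G.IsModuleIn S Y → (X : Set ℕ) ⊆ Y → (X' : Set ℕ) ⊆ Y) ∧ (X' ⊆ S) ∧
    (X' = X → ∀ w ∈ S, w < j → w ∉ X → ∀ a ∈ X, (G.Adj w a ↔ G.Adj w u)) ∧
    (IsClosed G u S X → X' = X))
    ⟨subset_rfl, fun Y _ h => h, hXS, fun _ w _ h => absurd h (by omega),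
      fun _ => rfl⟩ ?_
  · exact ⟨h.1, h.2.1, h.2.2.1, fun h1 w hw =>
      h.2.2.2.1 h1 w hw (Finset.mem_range.1 (hS hw)), h.2.2.2.2⟩
  · intro j hj X' h
    obtain ⟨h1, h2, h3, h4, h5⟩ := h
    unfold addSplitters
    split_ifs with hs
    · obtain ⟨g1, g2, g3, g4, g5⟩ := iter_addSplitter (G := G) hs (h1 hu) (h3.trans hS)
      refine ⟨h1.trans g1, fun Y hY hXY => g2 Y hY (h2 Y hY hXY),
        g3.trans (Finset.insert_subset hs h3), fun h w hw hwj => ?_, fun h => ?_⟩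
      · have hX' : X' = X := (g1.trans_eq h).antisymm h1
        rcases Nat.lt_succ_iff_lt_or_eq.1 hwj with hwj | rfl
        · exact h4 hX' w hw hwj
        · rw [hX'] at g4 h
          exact g4 h
      · have hX' := h5 h
        rw [hX'] at g1 g3 g5 ⊢
        by_cases hjX : j ∈ X
        · rw [Finset.insert_eq_of_mem hjX] at g3
          exact g3.antisymm g1
        · exact g5 (h j hs hjX)
    · refine ⟨h1, h2, h3, fun h w hw hwj => ?_, h5⟩
      rcases Nat.lt_succ_iff_lt_or_eq.1 hwj with hwj | rfl
      · exact h4 h w hw hwj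
      · exact absurd hw hs

/-- A round that starts from a set that is not closed adds a vertex, so `N` rounds reach a closed
set. Comparison with the single vertex `u` suffices: if nobody outside distinguishes any member from
`u`, nobody distinguishes two members. -/
theorem closure_spec (hu : u ∈ X) (hXS : X ⊆ S) (hS : S ⊆ Finset.range N) :
    X ⊆ closure G N u S X ∧ closure G N u S X ⊆ S ∧ G.IsModuleIn S (closure G N u S X) ∧
    ∀ Y : Set ℕ, G.IsModuleIn S Y → (X : Set ℕ) ⊆ Y → ((closure G N u S X : Finset ℕ) : Set ℕ) ⊆ Y := by
  have h := iter_induction (f := fun _ => closeStep G N u S) (s := X) (N := N)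
    (fun j X' => X ⊆ X' ∧
    (∀ Y : Set ℕ, G.IsModuleIn S Y → (X : Set ℕ) ⊆ Y → (X' : Set ℕ) ⊆ Y) ∧ (X' ⊆ S) ∧
    -- At `j = N` the second alternative contradicts `X' ⊆ Finset.range N`; at `j = 0` it holds
    -- because of `u`.
    (IsClosed G u S X' ∨ j < X'.card))
    ⟨subset_rfl, fun Y _ h => h, hXS, Or.inr (Finset.card_pos.2 ⟨u, hu⟩)⟩ ?_
  · obtain ⟨h1, h2, h3, h4⟩ := h
    have hcl : IsClosed G u S (closure G N u S X) := by
      rcases h4 with h4 | h4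
      · exact h4
      · have := Finset.card_le_card (h3.trans hS)
        rw [Finset.card_range] at this
        omega
    refine ⟨h1, h3, ⟨h3, fun v hv hvX a ha b hb hab => ?_⟩, h2⟩
    rw [hcl v hv hvX b hb, ← hcl v hv hvX a ha]
    exact hab
  · intro j hj X' h
    obtain ⟨h1, h2, h3, h4⟩ := h
    obtain ⟨g1, g2, g3, g4, g5⟩ := closeStep_spec (G := G) (h1 hu) h3 hS
    refine ⟨h1.trans g1, fun Y hY hXY => g2 Y hY (h2 Y hY hXY), g3, ?_⟩
    by_cases heq : closeStep G N u S X' = X'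
    · rw [heq]
      exact Or.inl (g4 heq)
    · rcases h4 with h4 | h4
      · exact absurd (g5 h4) heq
      · exact Or.inr (by
          have := Finset.card_lt_card (g1.ssubset_of_ne (Ne.symm heq))
          omega)

end Closure

theorem Good.withM (hc : Good N G l c) {X : Finset ℕ} (hX : X ⊆ Finset.range c.n) :
    Good N G l { c with M := X } :=
  ⟨hc.q, hc.qry, hc.sq, hc.k, hc.e, hc.adj, hc.ell, hc.S, hX⟩

theorem Good.eval_clear (hc : Good N G l c) :
    eval L N clear env c.toHS = { c with M := ∅ }.toHS := by
  refine eval_loop_conf (fun j => { c with M := c.M.filter fun i => j ≤ i }) (by simp) ?_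
    fun j hj => ?_
  · rw [Finset.filter_eq_empty_iff.2]
    intro i hi
    have := Finset.mem_range.1 (hc.M_subset hi)
    omega
  · simp only [eval_wrM_false, val_inl, Function.update_self]
    congr 2
    ext i
    simp only [Finset.mem_erase, Finset.mem_filter]
    constructor
    · rintro ⟨h1, h2, h3⟩
      exact ⟨h2, by omega⟩
    · rintro ⟨h1, h2⟩
      exact ⟨by omega, h1, by omega⟩

/-- The loops read and change `M` at the same time, and the nested `iter` in `closure` mirrors
exactly this order of updates. The inclusion keeps the addresses of all adjacency tests valid. -/
theorem Good.eval_close (hc : Good N G l c) (hu : env .u < c.n) :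
    eval L N close env c.toHS =
      { c with M := closure G N (env .u) c.S c.M }.toHS ∧
        closure G N (env .u) c.S c.M ⊆ Finset.range c.n := by
  classical
  have inner : ∀ X ⊆ Finset.range c.n, ∀ w ∈ c.S, ∀ env' : Ix → ℕ, env' .u = env .u →
      env' .w = w →
      eval L N (.loop .a (.ifRd .M (.inl .a)
        (ifAdj .w .a (ifAdj .w .u .skip (.wr .M (.inl .w) true))
          (ifAdj .w .u (.wr .M (.inl .w) true) .skip)) .skip)) env' { c with M := X }.toHS =
      { c with M := iter (addSplitter G (env .u) w) N X }.toHS := by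
    intro X hX w hw env' hu' hw'
    have hwn := Finset.mem_range.1 (hc.S hw)
    have hsub : ∀ j, iter (addSplitter G (env .u) w) j X ⊆ Finset.range c.n := by
      intro j
      induction j with
      | zero => exact hX
      | succ j ih =>
        rw [iter]
        unfold addSplitter
        split_ifs
        · exact Finset.insert_subset (hc.S hw) ih
        · exact ih
    refine eval_loop_conf (fun j => { c with M := iter (addSplitter G (env .u) w) j X }) rfl rfl
      fun j hj => ?_
    have hc' := hc.withM (hsub j)
    simp only [eval_rdM, val_inl, Function.update_self]
    by_cases hjX : j ∈ iter (addSplitter G (env .u) w) j X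
    · have hjn := Finset.mem_range.1 (hsub j hjX)
      have e1 := fun q : P => fun r : P => hc'.eval_ifAdj (L := L) (env := Function.update env' .a j)
        (i := .w) (j := .a) (p := q) (q := r) (by decide) (by decide) (by simpa [hw'] using hwn)
        (by simpa using hjn) []
      have e2 := fun q : P => fun r : P => hc'.eval_ifAdj (L := L) (env := Function.update env' .a j)
        (i := .w) (j := .u) (p := q) (q := r) (by decide) (by decide) (by simpa [hw'] using hwn)
        (by simpa [hu'] using hu) []
      rw [show ({ c with M := iter (addSplitter G (env .u) w) j X, qry := [] } : Conf) =
        { c with M := iter (addSplitter G (env .u) w) j X } by rw [← hc.qry]] at e1 e2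
      rw [if_pos hjX, e1, e2, e2]
      simp only [iter]
      rw [addSplitter]
      simp only [Function.update_self, ne_eq, reduceCtorEq, not_false_eq_true,
        Function.update_of_ne, hu', hw', hjX, true_and, eval_skip, eval_wrM_true, val_inl]
      by_cases h1 : G.Adj w j <;> by_cases h2 : G.Adj w (env .u) <;> simp [h1, h2]
    · rw [if_neg hjX]
      simp only [iter]
      rw [addSplitter, if_neg (fun h => hjX h.1), eval_skip]
  have hsub1 : ∀ X ⊆ Finset.range c.n, ∀ w, addSplitters G N (env .u) c.S w X ⊆
      Finset.range c.n := by
    intro X hX w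
    unfold addSplitters
    split_ifs with hw
    · refine iter_induction (fun _ Y => Y ⊆ Finset.range c.n) hX fun j _ Y hY => ?_
      unfold addSplitter
      split_ifs
      · exact Finset.insert_subset (hc.S hw) hY
      · exact hY
    · exact hX
  have hsub2 : ∀ X ⊆ Finset.range c.n, ∀ j, iter (addSplitters G N (env .u) c.S) j X ⊆
      Finset.range c.n := by
    intro X hX j
    induction j with
    | zero => exact hX
    | succ j ih => exact hsub1 _ ih j
  have hsub3 : ∀ j, iter (fun _ => closeStep G N (env .u) c.S) j c.M ⊆ Finset.range c.n := by
    intro j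
    induction j with
    | zero => exact hc.M
    | succ j ih => exact hsub2 _ ih N
  refine ⟨?_, hsub3 N⟩
  refine eval_loop_conf (fun j => { c with M := iter (fun _ => closeStep G N (env .u) c.S) j c.M })
    rfl rfl fun i _ => ?_
  refine eval_loop_conf (fun j => { c with
    M := (iter (addSplitters G N (env .u) c.S) j
      (iter (fun _ => closeStep G N (env .u) c.S) i c.M)) }) rfl rfl fun j hj => ?_
  simp only [eval_rdS, val_inl, Function.update_self]
  by_cases hjS : j ∈ c.S
  · rw [if_pos hjS, inner _ (hsub2 _ (hsub3 i) j) j hjS _ (by simp) (by simp)]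
    simp only [iter, addSplitters, if_pos hjS]
  · rw [if_neg hjS]
    simp only [iter, addSplitters, if_neg hjS, eval_skip]

theorem Good.eval_count (hc : Good N G l c) :
    eval L N (.loop .a (.ifRd .M (.inl .a) (.inc .q) .skip)) env c.toHS =
      { c with q := c.M.card }.toHS := by
  refine eval_loop_conf (fun j => { c with q := ((Finset.range j).filter (· ∈ c.M)).card })
    (by rw [Finset.range_zero, Finset.filter_empty, Finset.card_empty, ← hc.q]) ?_ fun j hj => ?_
  · congr 2
    ext i
    simp only [Finset.mem_filter, and_iff_right_iff_imp]
    exact fun h => hc.M_subset h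
  · have hle : ((Finset.range j).filter (· ∈ c.M)).card ≤ j :=
      (Finset.card_filter_le _ _).trans_eq (Finset.card_range j)
    simp only [eval_rdM, val_inl, Function.update_self]
    rw [Finset.range_add_one, Finset.filter_insert]
    by_cases h : j ∈ c.M
    · rw [if_pos h, if_pos h, eval_incQ, Finset.card_insert_of_notMem (by simp)]
      simp only [min_eq_right (show ((Finset.range j).filter (· ∈ c.M)).card + 1 ≤ N by omega)]
    · rw [if_neg h, if_neg h, eval_skip]

/-- The length of a query about a graph with `m` vertices. -/
def queryLen (k m e : ℕ) : ℕ := k + 1 + m + 1 + m * m + e + 1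

open Classical in
theorem Good.eval_reduce (hc : Good N G l c) (hu : env .u ∈ c.S) (hv : env .v ∈ c.S) :
    ∃ X : Finset ℕ, X ⊆ c.S ∧ env .u ∈ X ∧ env .v ∈ X ∧ G.IsModuleIn c.S X ∧
      (∀ Y : Set ℕ, G.IsModuleIn c.S Y → env .u ∈ Y → env .v ∈ Y → (X : Set ℕ) ⊆ Y) ∧
      eval queryLang N reduce env c.toHS =
        if c.k < X.card then { c with M := X }.toHS else
        { c with
          M := X
          S := c.S.erase (env .v)
          mw := c.mw || decide (G.IsPrimeSet (X : Set ℕ) ∧ X.card = c.k)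
          path := c.path || decide (IndIn (pathGraph l) G (X : Set ℕ))
          mq := max c.mq (queryLen c.k X.card l.bits.length) }.toHS := by
  have h0 : insert (env .v) (insert (env .u) ∅) ⊆ c.S := by
    rw [Finset.insert_subset_iff, Finset.insert_subset_iff]
    exact ⟨hv, hu, Finset.empty_subset _⟩
  have hc0 := hc.withM (h0.trans hc.S)
  obtain ⟨he, hsub⟩ := hc0.eval_close (L := queryLang) (env := env) (Finset.mem_range.1 (hc.S hu))
  obtain ⟨h1, h2, h3, h4⟩ := closure_spec (G := G) (u := env .u) (N := N)
    (X := insert (env .v) (insert (env .u) ∅)) (by simp) h0 hc.S_subset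
  set X := closure G N (env .u) c.S (insert (env .v) (insert (env .u) ∅)) with hX
  have hc1 := hc.withM hsub
  refine ⟨X, h2, h1 (by simp), h1 (by simp), h3, fun Y hY huY hvY => h4 Y hY ?_, ?_⟩
  · simp [Set.insert_subset_iff, huY, hvY]
  · have e1 : eval queryLang N reduce env c.toHS = eval queryLang N
        (.ifLt (.inr .k) (.inr .q) (.reset .q) (block [.reset .q, query, .wr .S (.inl .v) false])) env
        { c with M := X, q := X.card }.toHS := by
      simp only [reduce, eval_block_cons, eval_block_nil]
      rw [hc.eval_clear, eval_wrM_true, eval_wrM_true]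
      simp only [val_inl]
      rw [he, hc1.eval_count]
    have hq : ({ c with M := X, q := 0 } : Conf) = { c with M := X } := by rw [← hc.q]
    rw [e1]
    simp only [eval_ifLt, val_k, val_q, eval_block_cons, eval_block_nil, eval_resetQ, hq]
    split_ifs
    · rfl
    · rw [hc1.eval_query, eval_wrS_false]
      rfl

end InducedPath

namespace SimpleGraph

/-! ### Small sets of vertices -/

variable {V W : Type} {G : SimpleGraph V} {H : SimpleGraph W}

theorem IndIn.card_le {X : Finset V} (h : IndIn H G (X : Set V)) : Nat.card W ≤ X.card := by
  obtain ⟨f, hf, hX, -⟩ := h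
  have := Nat.card_le_card_of_injective (fun w => (⟨f w, hX w⟩ : X))
    fun a b hab => hf (congrArg Subtype.val hab)
  simpa using this

/-- An embedding into a set of the same size is onto, so this set induces a copy of `H`. -/
theorem IndIn.isPrimeSet {X : Finset V} (h : IndIn H G (X : Set V)) (hH : H.IsPrimeGraph)
    (hc : Nat.card W = X.card) : G.IsPrimeSet (X : Set V) := by
  obtain ⟨f, hf, hX, hadj⟩ := h
  have hsub : Set.range f ⊆ (X : Set V) := by
    rintro _ ⟨w, rfl⟩
    exact hX w
  rw [isPrimeGraph_iff_isPrimeSet_range hf hadj] at hH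
  rwa [Set.eq_of_subset_of_ncard_le hsub] at hH
  rw [Set.ncard_coe_finset, ← hc, ← Nat.card_coe_set_eq, Nat.card_range_of_injective hf]

theorem indIn_induce_self (X : Set V) : IndIn (G.induce X) G X :=
  ⟨Subtype.val, Subtype.val_injective, fun w => w.2, fun _ _ => Iff.rfl⟩

theorem isPrimeSet_singleton (v : V) : G.IsPrimeSet {v} := fun M hM => by
  rcases Set.subset_singleton_iff_eq.1 hM.1 with h | h
  · exact Or.inl h
  · exact Or.inr (Or.inl h)

end SimpleGraph

namespace InducedPath

open LoopLang SimpleGraph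

variable {L : Language Bool} {N : ℕ} {env : Ix → ℕ} {c : Conf} {p : P} {G : SimpleGraph ℕ}
  {l k n : ℕ}

/-! ### The main part of the algorithm -/

theorem queryLen_le {k m e : ℕ} (hm : m ≤ k + 3) (he : e ≤ k + 2) :
    queryLen k m e ≤ queryLen k (k + 3) (k + 2) := by
  have := Nat.mul_le_mul hm hm
  unfold queryLen
  omega

/-- The flags of the state record the answers about `X`. -/
def Asked (G : SimpleGraph ℕ) (l k : ℕ) (X : Finset ℕ) (c : Conf) : Prop :=
  (G.IsPrimeSet (X : Set ℕ) → X.card = k → c.mw = true) ∧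
    (IndIn (pathGraph l) G (X : Set ℕ) → c.path = true)

/-- The invariant of the main part of the algorithm. -/
structure Sound (N : ℕ) (G : SimpleGraph ℕ) (l k n : ℕ) (c : Conf) : Prop where
  good : Good N G l c
  k_eq : c.k = k
  n_eq : c.n = n
  rej : c.rej = false
  bits : l.bits.length ≤ k + 2
  mq : c.mq ≤ queryLen k (k + 3) (k + 2)
  mw : c.mw = true → ∃ X ⊆ Finset.range n, G.IsPrimeSet (X : Set ℕ) ∧ X.card = k
  path : c.path = true → IndIn (pathGraph l) G (Finset.range n : Set ℕ)

theorem Sound.withM (hc : Sound N G l k n c) {X : Finset ℕ} (hX : X ⊆ Finset.range n) :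
    Sound N G l k n { c with M := X } :=
  ⟨hc.good.withM (hc.n_eq ▸ hX), hc.k_eq, hc.n_eq, hc.rej, hc.bits, hc.mq, hc.mw, hc.path⟩

theorem Sound.withS (hc : Sound N G l k n c) {X : Finset ℕ} (hX : X ⊆ Finset.range n) :
    Sound N G l k n { c with S := X } :=
  ⟨⟨hc.good.q, hc.good.qry, hc.good.sq, hc.good.k, hc.good.e, hc.good.adj, hc.good.ell,
    hc.n_eq ▸ hX, hc.good.M⟩, hc.k_eq, hc.n_eq, hc.rej, hc.bits, hc.mq, hc.mw, hc.path⟩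

theorem Sound.S (hc : Sound N G l k n c) : c.S ⊆ Finset.range n := hc.n_eq ▸ hc.good.S

open Classical in
/-- The state after asking about the set `M`. -/
noncomputable def ask (G : SimpleGraph ℕ) (l : ℕ) (c : Conf) : Conf :=
  { c with
    mw := c.mw || decide (G.IsPrimeSet (c.M : Set ℕ) ∧ c.M.card = c.k)
    path := c.path || decide (IndIn (pathGraph l) G (c.M : Set ℕ))
    mq := max c.mq (queryLen c.k c.M.card l.bits.length) }

theorem asked_ask (hk : c.k = k) : Asked G l k c.M (ask G l c) := by
  refine ⟨fun h1 h2 => ?_, fun h => ?_⟩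
  · simp [ask, h1, h2, hk]
  · simp [ask, h]

theorem Asked.ask {X : Finset ℕ} (h : Asked G l k X c) : Asked G l k X (ask G l c) := by
  refine ⟨fun h1 h2 => ?_, fun h1 => ?_⟩
  · simp [InducedPath.ask, h.1 h1 h2]
  · simp [InducedPath.ask, h.2 h1]

theorem Sound.ask (hc : Sound N G l k n c) (hM : c.M.card ≤ k + 3) :
    Sound N G l k n (ask G l c) := by
  have hMn : c.M ⊆ Finset.range n := hc.n_eq ▸ hc.good.M
  refine ⟨⟨hc.good.q, hc.good.qry, hc.good.sq, hc.good.k, hc.good.e, hc.good.adj, hc.good.ell,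
    hc.good.S, hc.good.M⟩, hc.k_eq, hc.n_eq, hc.rej, hc.bits, max_le hc.mq ?_, fun h => ?_,
    fun h => ?_⟩
  · rw [hc.k_eq]
    exact queryLen_le hM hc.bits
  · simp only [InducedPath.ask, Bool.or_eq_true, decide_eq_true_eq] at h
    rcases h with h | h
    · exact hc.mw h
    · exact ⟨c.M, hMn, h.1, h.2.trans hc.k_eq⟩
  · simp only [InducedPath.ask, Bool.or_eq_true, decide_eq_true_eq] at h
    rcases h with h | h
    · exact hc.path h
    · exact h.mono (by exact_mod_cast hMn)

theorem exists_eval_loop {i : Ix} (Φ : ℕ → Conf → Prop) (h0 : Φ 0 c)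
    (h : ∀ j < N, ∀ c, Φ j c →
      ∃ c', eval L N p (Function.update env i j) c.toHS = c'.toHS ∧ Φ (j + 1) c') :
    ∃ c', eval L N (.loop i p) env c.toHS = c'.toHS ∧ Φ N c' := by
  have := iter_induction (f := fun j s => eval L N p (Function.update env i j) s) (N := N)
    (s := c.toHS) (fun j s => ∃ c', s = c'.toHS ∧ Φ j c') ⟨c, rfl, h0⟩ ?_
  · exact this
  · rintro j hj _ ⟨c, rfl, hc⟩
    exact h j hj c hc

/-- The invariant of the first queries. -/
def Early (N : ℕ) (G : SimpleGraph ℕ) (l k n : ℕ) (T : Finset ℕ → Prop) (c : Conf) : Prop :=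
  Sound N G l k n c ∧ ∀ X, T X → Asked G l k X c

/-- The predicate `T` describes the sets asked about so far; round `j` adds the family `A j`. -/
theorem Early.loop {i : Ix} {A : ℕ → Finset ℕ → Prop} {T : Finset ℕ → Prop}
    (h : ∀ j < n, ∀ T c, Early N G l k n T c →
      ∃ c', eval L N p (Function.update env i j) c.toHS = c'.toHS ∧
        Early N G l k n (fun X => T X ∨ A j X) c') (hc : Early N G l k n T c) :
    ∃ c', eval L N (.loop i (.ifLt (.inl i) (.inr .n) p .skip)) env c.toHS = c'.toHS ∧
      Early N G l k n (fun X => T X ∨ ∃ j < n, A j X) c' := by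
  have hn : n ≤ N := hc.1.n_eq ▸ hc.1.good.n_le
  have := exists_eval_loop (L := L) (N := N) (env := env) (c := c) (i := i)
    (p := .ifLt (.inl i) (.inr .n) p .skip)
    (fun m => Early N G l k n fun X => T X ∨ ∃ j < n, j < m ∧ A j X)
    ⟨hc.1, fun X hX => hc.2 X (by simpa using hX)⟩ ?_
  · obtain ⟨c', h1, h2⟩ := this
    refine ⟨c', h1, h2.1, fun X hX => h2.2 X ?_⟩
    rcases hX with hX | ⟨j, hj, hX⟩
    · exact Or.inl hX
    · exact Or.inr ⟨j, hj, by omega, hX⟩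
  · intro j hj c hc
    simp only [eval_ifLt, val_inl, val_n, Function.update_self, hc.1.n_eq]
    split_ifs with hjn
    · obtain ⟨c', h1, h2⟩ := h j hjn _ c hc
      refine ⟨c', h1, h2.1, fun X hX => h2.2 X ?_⟩
      rcases hX with hX | ⟨i, hi, hij, hX⟩
      · exact Or.inl (Or.inl hX)
      · rcases Nat.lt_succ_iff_lt_or_eq.1 hij with hij | rfl
        · exact Or.inl (Or.inr ⟨i, hi, hij, hX⟩)
        · exact Or.inr hX
    · refine ⟨c, rfl, hc.1, fun X hX => hc.2 X ?_⟩
      rcases hX with hX | ⟨i, hi, hij, hX⟩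
      · exact Or.inl hX
      · exact Or.inr ⟨i, hi, by omega, hX⟩

theorem Early.triples {T : Finset ℕ → Prop} (hc : Early N G l k n T c) :
    ∃ c', eval queryLang N triples env c.toHS = c'.toHS ∧
      Early N G l k n (fun X => T X ∨ ∃ u < n, ∃ v < n, ∃ w < n, X = {w, v, u}) c' := by
  refine Early.loop (fun u hu T c hc => ?_) hc
  refine Early.loop (fun v hv T c hc => ?_) hc
  refine Early.loop (A := fun w X => X = {w, v, u}) (fun w hw T c hc => ?_) hc
  have hX : ({w, v, u} : Finset ℕ) ⊆ Finset.range n := by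
    intro x hx
    simp only [Finset.mem_insert, Finset.mem_singleton] at hx
    rcases hx with rfl | rfl | rfl <;> simpa
  have hs := hc.1.withM hX
  have hq := hs.good.eval_query (env := Function.update (Function.update
    (Function.update env .u u) .v v) .w w)
  refine ⟨InducedPath.ask G l { c with M := {w, v, u} }, ?_, hs.ask ?_, ?_⟩
  · simp only [eval_block_cons, eval_block_nil]
    rw [hc.1.good.eval_clear, eval_wrM_true, eval_wrM_true, eval_wrM_true]
    simp only [val_inl, Function.update_self, ne_eq, reduceCtorEq, not_false_eq_true,
      Function.update_of_ne]
    exact hq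
  · exact Finset.card_le_three.trans (by omega)
  · rintro X (hX | rfl)
    · exact Asked.ask (c := { c with M := {w, v, u} }) (hc.2 X hX)
    · exact asked_ask (c := { c with M := {w, v, u} }) hc.1.k_eq

/-- All sets with at most three vertices have been treated. -/
def Small (G : SimpleGraph ℕ) (l k n : ℕ) (c : Conf) : Prop :=
  ∀ X ⊆ Finset.range n, X.card ≤ 3 → Asked G l k X c

/-- Repetitions among `u`, `v`, `w` yield the sets with one or two vertices; only the empty set
needs its own query. -/
theorem Small.of_asked (h0 : Asked G l k ∅ c)
    (h : ∀ u < n, ∀ v < n, ∀ w < n, Asked G l k {w, v, u} c) : Small G l k n c := by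
  intro X hX hc
  have hlt : ∀ x ∈ X, x < n := fun x hx => Finset.mem_range.1 (hX hx)
  have h4 : X.card = 0 ∨ X.card = 1 ∨ X.card = 2 ∨ X.card = 3 := by omega
  rcases h4 with h4 | h4 | h4 | h4
  · rwa [Finset.card_eq_zero.1 h4]
  · obtain ⟨u, rfl⟩ := Finset.card_eq_one.1 h4
    have hu := hlt u (by simp)
    simpa using h u hu u hu u hu
  · obtain ⟨u, v, -, rfl⟩ := Finset.card_eq_two.1 h4
    have hu := hlt u (by simp)
    have hv := hlt v (by simp)
    simpa using h v hv v hv u hu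
  · obtain ⟨u, v, w, -, -, -, rfl⟩ := Finset.card_eq_three.1 h4
    exact h w (hlt w (by simp)) v (hlt v (by simp)) u (hlt u (by simp))

theorem Sound.eval_initAll (hc : Sound N G l k n c) :
    eval L N initAll env c.toHS = { c with S := Finset.range n }.toHS := by
  refine eval_loop_lt_conf (m := n) (hc.n_eq ▸ hc.good.n_le)
    (fun j => { c with S := c.S ∪ Finset.range j }) (by simp) ?_ (fun _ _ _ => hc.n_eq)
    fun j hj => ?_
  · rw [Finset.union_eq_right.2 hc.S]
  · rw [eval_wrS_true, Finset.range_add_one, Finset.union_insert]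
    rfl

theorem Sound.eval_start (hc : Sound N G l k n c) (hM : c.M = ∅) :
    ∃ c', eval queryLang N (block [query, triples, initAll]) env c.toHS = c'.toHS ∧
      Sound N G l k n c' ∧ Small G l k n c' ∧ c'.S = Finset.range n := by
  have hq := hc.good.eval_query (env := env)
  have ha : Asked G l k ∅ (InducedPath.ask G l c) := by
    rw [← hM]
    exact asked_ask hc.k_eq
  obtain ⟨c', h1, h2, h3⟩ := Early.triples (env := env) (T := fun X => X = ∅)
    (c := InducedPath.ask G l c) ⟨hc.ask (by simp [hM]), fun X hX => hX ▸ ha⟩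
  refine ⟨_, ?_, h2.withS subset_rfl, ?_, rfl⟩
  · rw [← h2.eval_initAll (L := queryLang) (env := env), ← h1]
    simp only [eval_block_cons, eval_block_nil]
    rw [hq]
    rfl
  · exact Small.of_asked (h3 ∅ (Or.inl rfl)) fun u hu v hv w hw =>
      h3 _ (Or.inr ⟨u, hu, v, hv, w, hw, rfl⟩)

end InducedPath

namespace InducedPath

open LoopLang SimpleGraph

variable {L : Language Bool} {N : ℕ} {env : Ix → ℕ} {c : Conf} {p : P} {G : SimpleGraph ℕ}
  {l k n : ℕ}

/-! ### The reductions -/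

/-- The invariant of the reductions. -/
structure Inv (N : ℕ) (G : SimpleGraph ℕ) (l k n : ℕ) (c : Conf) : Prop where
  sound : Sound N G l k n c
  small : Small G l k n c
  mw : ∀ X ⊆ Finset.range n, G.IsPrimeSet (X : Set ℕ) → k ≤ X.card →
    IndIn (G.induce (X : Set ℕ)) G (c.S : Set ℕ) ∨ X.card = k ∧ c.mw = true
  path : 4 ≤ l → IndIn (pathGraph l) G (Finset.range n : Set ℕ) →
    IndIn (pathGraph l) G (c.S : Set ℕ) ∨ c.path = true

theorem Inv.withM (hc : Inv N G l k n c) {X : Finset ℕ} (hX : X ⊆ Finset.range n) :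
    Inv N G l k n { c with M := X } :=
  ⟨hc.sound.withM hX, hc.small, hc.mw, hc.path⟩

/-- This is where `IndIn.prime_split` is used, once for every prime induced subgraph with at least
`k` vertices and once for the path. -/
theorem Inv.ask_erase (hc : Inv N G l k n c) (hMk : c.M.card ≤ k) (hM : G.IsModuleIn c.S c.M)
    {u v : ℕ} (hu : u ∈ c.M) (hv : v ∈ c.M) (huv : u ≠ v) :
    Inv N G l k n { ask G l c with S := c.S.erase v } := by
  have hs := hc.sound.ask (hMk.trans (by omega))
  have ha := asked_ask (G := G) (l := l) hc.sound.k_eq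
  refine ⟨hs.withS ((Finset.erase_subset _ _).trans hc.sound.S),
    fun X hX h3 => (hc.small X hX h3).ask, fun X hX hp hk => ?_, fun hl h => ?_⟩
  · rw [Finset.coe_erase]
    rcases hc.mw X hX hp hk with h | ⟨h1, h2⟩
    · have hpg := isPrimeGraph_induce_iff.2 hp
      have hcard : Nat.card (X : Set ℕ) = X.card := by simp
      rcases h.prime_split hpg hM hu hv huv with h | h
      -- A copy inside `M` forces `k ≤ X.card ≤ M.card ≤ k`. Hence `M` itself is prime with `k`
      -- vertices, and the answer sets the flag.
      · have hle := h.card_le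
        rw [hcard] at hle
        exact Or.inr ⟨by omega, ha.1 (h.isPrimeSet hpg (by omega)) (by omega)⟩
      · exact Or.inl h
    · exact Or.inr ⟨h1, by simp [ask, h2]⟩
  · rw [Finset.coe_erase]
    rcases hc.path hl h with h | h
    · rcases h.prime_split (isPrimeGraph_pathGraph hl) hM hu hv huv with h | h
      · exact Or.inr (ha.2 h)
      · exact Or.inl h
    · exact Or.inr (by simp [ask, h])

/-- Some module with at most `k` vertices contains `u` and `v`. -/
def Close (G : SimpleGraph ℕ) (k : ℕ) (S : Finset ℕ) (u v : ℕ) : Prop :=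
  ∃ Y : Finset ℕ, G.IsModuleIn S Y ∧ u ∈ Y ∧ v ∈ Y ∧ Y.card ≤ k

/-- As the computed module is the smallest one containing both vertices, it is small as soon as any
module with them is small; then `v` is deleted. -/
theorem Inv.eval_reduce (hc : Inv N G l k n c) (hu : env .u ∈ c.S) (hv : env .v ∈ c.S)
    (huv : env .v < env .u) :
    ∃ c', eval queryLang N reduce env c.toHS = c'.toHS ∧ Inv N G l k n c' ∧ c'.S ⊆ c.S ∧
      (Close G k c.S (env .u) (env .v) → env .v ∉ c'.S) := by
  obtain ⟨X, hXS, huX, hvX, hX, hmin, he⟩ := hc.sound.good.eval_reduce hu hv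
  have hc' := hc.withM (hXS.trans hc.sound.S)
  rw [he]
  split_ifs with h
  · refine ⟨_, rfl, hc', subset_rfl, ?_⟩
    rintro ⟨Y, hY, h1, h2, h3⟩
    have := Finset.card_le_card (Finset.coe_subset.1 (hmin Y hY h1 h2))
    rw [hc.sound.k_eq] at h
    omega
  · rw [hc.sound.k_eq, not_lt] at h
    exact ⟨_, rfl, hc'.ask_erase h hX huX hvX huv.ne', Finset.erase_subset _ _,
      fun _ => Finset.notMem_erase _ _⟩

/-- The invariant of one round of reductions. -/
def Round (N : ℕ) (G : SimpleGraph ℕ) (l k n : ℕ) (S : Finset ℕ) (D : ℕ → ℕ → Prop) (c : Conf) :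
    Prop :=
  Inv N G l k n c ∧ c.S ⊆ S ∧ ∀ u v, v < u → D u v → Close G k S u v → c.S ≠ S

theorem Round.loop {i : Ix} {A : ℕ → ℕ → ℕ → Prop} {D : ℕ → ℕ → Prop} {S : Finset ℕ}
    (h : ∀ j < N, ∀ D c, Round N G l k n S D c →
      ∃ c', eval L N p (Function.update env i j) c.toHS = c'.toHS ∧
        Round N G l k n S (fun u v => D u v ∨ A j u v) c') (hc : Round N G l k n S D c) :
    ∃ c', eval L N (.loop i p) env c.toHS = c'.toHS ∧
      Round N G l k n S (fun u v => D u v ∨ ∃ j < N, A j u v) c' := by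
  refine exists_eval_loop (fun m => Round N G l k n S fun u v => D u v ∨ ∃ j < m, A j u v)
    ⟨hc.1, hc.2.1, fun u v hvu h => hc.2.2 u v hvu (by simpa using h)⟩ fun j hj c hc => ?_
  obtain ⟨c', h1, h2, h3, h4⟩ := h j hj _ c hc
  refine ⟨c', h1, h2, h3, fun u v hvu h => h4 u v hvu ?_⟩
  rcases h with h | ⟨i, hi, h⟩
  · exact Or.inl (Or.inl h)
  · rcases Nat.lt_succ_iff_lt_or_eq.1 hi with hi | rfl
    · exact Or.inl (Or.inr ⟨i, hi, h⟩)
    · exact Or.inr h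

/-- If `S` stays the same during the whole round, every pair has been tested against this very `S`,
so none of the pairs was close. -/
theorem Inv.eval_round (hc : Inv N G l k n c) :
    ∃ c', eval queryLang N (.loop .u (.loop .v (.ifLt (.inl .v) (.inl .u)
      (.ifRd .S (.inl .u) (.ifRd .S (.inl .v) reduce .skip) .skip) .skip))) env c.toHS = c'.toHS ∧
      Inv N G l k n c' ∧ c'.S ⊆ c.S ∧
      ∀ u ∈ c.S, ∀ v ∈ c.S, v < u → Close G k c.S u v → c'.S ≠ c.S := by
  have h0 : Round N G l k n c.S (fun _ _ => False) c :=
    ⟨hc, subset_rfl, fun _ _ _ h => h.elim⟩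
  have := Round.loop (L := queryLang) (env := env) (i := .u) (p := .loop .v (.ifLt (.inl .v)
    (.inl .u) (.ifRd .S (.inl .u) (.ifRd .S (.inl .v) reduce .skip) .skip) .skip))
    (A := fun u u' v' => ∃ v < N, u' = u ∧ v' = v) (fun u _ D c' hc' => ?_) h0
  · obtain ⟨c', h1, h2, h3, h4⟩ := this
    refine ⟨c', h1, h2, h3, fun u hu v hv hvu => h4 u v hvu (Or.inr ⟨u, ?_, v, ?_, rfl, rfl⟩)⟩
    · exact Finset.mem_range.1 (hc.sound.good.S_subset hu)
    · exact Finset.mem_range.1 (hc.sound.good.S_subset hv)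
  · refine Round.loop (A := fun v u' v' => u' = u ∧ v' = v) (fun v _ D c' hc' => ?_) hc'
    obtain ⟨g1, g2, g3⟩ := hc'
    have hskip : (v < u → Close G k c.S u v → c'.S ≠ c.S) →
        Round N G l k n c.S (fun u' v' => D u' v' ∨ u' = u ∧ v' = v) c' := by
      intro h
      refine ⟨g1, g2, fun u' v' hvu hD => ?_⟩
      rcases hD with hD | ⟨rfl, rfl⟩
      · exact g3 u' v' hvu hD
      · exact h hvu
    simp only [eval_ifLt, val_inl, Function.update_self, ne_eq, reduceCtorEq, not_false_eq_true,
      Function.update_of_ne, eval_rdS]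
    by_cases hvu : v < u
    · rw [if_pos hvu]
      by_cases hu : u ∈ c'.S
      · rw [if_pos hu]
        by_cases hv : v ∈ c'.S
        · rw [if_pos hv]
          obtain ⟨c'', e1, e2, e3, e4⟩ := g1.eval_reduce
            (env := Function.update (Function.update env .u u) .v v) (by simpa using hu)
            (by simpa using hv) (by simpa using hvu)
          refine ⟨c'', e1, e2, e3.trans g2, fun u' v' hvu' hD hcl heq => ?_⟩
          -- The set shrinks monotonically, so if it is the original one afterwards, it was so
          -- before this step.
          have hS : c'.S = c.S := g2.antisymm (heq ▸ e3)
          rcases hD with hD | ⟨rfl, rfl⟩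
          · exact g3 u' v' hvu' hD hcl hS
          · simp only [Function.update_self, ne_eq, reduceCtorEq, not_false_eq_true,
              Function.update_of_ne, hS] at e4
            exact e4 hcl (heq ▸ hS ▸ hv)
        · rw [if_neg hv]
          exact ⟨c', rfl, hskip fun _ ⟨Y, h1, h2, h3, _⟩ heq => hv (heq ▸ h1.1 h3)⟩
      · rw [if_neg hu]
        exact ⟨c', rfl, hskip fun _ ⟨Y, h1, h2, h3, _⟩ heq => hu (heq ▸ h1.1 h2)⟩
    · rw [if_neg hvu]
      exact ⟨c', rfl, hskip fun h => absurd h hvu⟩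

/-- A prime module with at least two vertices exists in `S`, it has at most `k` vertices by
assumption, and any two of its vertices form such a pair. -/
theorem exists_close {S : Finset ℕ} (hS : 1 < S.card)
    (hk : ∀ X ⊆ S, G.IsPrimeSet (X : Set ℕ) → X.card ≤ k) :
    ∃ u ∈ S, ∃ v ∈ S, v < u ∧ Close G k S u v := by
  obtain ⟨M, hM, ⟨a, ha, b, hb, hab⟩, hp⟩ := exists_isPrimeSet_module (G := G) S.finite_toSet
    (Finset.one_lt_card_iff_nontrivial.1 hS)
  lift M to Finset ℕ using S.finite_toSet.subset hM.1
  have hMS := Finset.coe_subset.1 hM.1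
  have hMk := hk M hMS hp
  rcases lt_or_gt_of_ne hab with h | h
  · exact ⟨b, hMS hb, a, hMS ha, h, M, hM, hb, ha, hMk⟩
  · exact ⟨a, hMS ha, b, hMS hb, h, M, hM, ha, hb, hMk⟩

theorem Inv.eval_reduceAll (hc : Inv N G l k n c) :
    ∃ c', eval queryLang N reduceAll env c.toHS = c'.toHS ∧ Inv N G l k n c' ∧
      ((∀ X ⊆ Finset.range n, G.IsPrimeSet (X : Set ℕ) → X.card ≤ k) → c'.S.card ≤ 1) := by
  have h := exists_eval_loop (L := queryLang) (N := N) (env := env) (c := c) (i := .d)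
    (p := .loop .u (.loop .v (.ifLt (.inl .v) (.inl .u)
      (.ifRd .S (.inl .u) (.ifRd .S (.inl .v) reduce .skip) .skip) .skip)))
    -- Each round deletes a vertex as long as two are left; since `n ≤ N`, the `N` rounds suffice.
    (fun j c' => Inv N G l k n c' ∧
      ((∀ X ⊆ Finset.range n, G.IsPrimeSet (X : Set ℕ) → X.card ≤ k) →
        c'.S.card ≤ 1 ∨ c'.S.card + j ≤ n)) ⟨hc, fun _ => Or.inr ?_⟩ ?_
  · obtain ⟨c', h1, h2, h3⟩ := h
    refine ⟨c', h1, h2, fun h => ?_⟩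
    have hn := h2.sound.good.n_le
    rw [h2.sound.n_eq] at hn
    have := h3 h
    omega
  · simpa using Finset.card_le_card hc.sound.S
  · rintro j _ c ⟨hc, hj⟩
    obtain ⟨c', h1, h2, h3, h4⟩ := hc.eval_round (env := Function.update env .d j)
    refine ⟨c', h1, h2, fun h => ?_⟩
    have hle := Finset.card_le_card h3
    rcases le_or_gt c.S.card 1 with h5 | h5
    · exact Or.inl (hle.trans h5)
    · obtain ⟨u, hu, v, hv, hvu, hcl⟩ := exists_close (G := G) (k := k) h5
        fun X hX => h X (hX.trans hc.sound.S)
      have := Finset.card_lt_card (h3.ssubset_of_ne (h4 u hu v hv hvu hcl))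
      have := hj h
      omega

/-! ### Rejection tests, and correctness of the main part. -/

/-- The program has no effect except that it rejects if `B` holds. -/
def RejectsIf (L : Language Bool) (N : ℕ) (p : P) (env : Ix → ℕ) (c : Conf) (B : Prop) : Prop :=
  ∀ r : Bool, ∃ r' : Bool, eval L N p env { c with rej := r }.toHS = { c with rej := r' }.toHS ∧
    (r' = true ↔ r = true ∨ B)

theorem RejectsIf.congr {A B : Prop} (h : RejectsIf L N p env c A) (hAB : A ↔ B) :
    RejectsIf L N p env c B := by
  rwa [← hAB]

theorem RejectsIf.loop {i : Ix} {B : ℕ → Prop}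
    (h : ∀ j < N, RejectsIf L N p (Function.update env i j) c (B j)) :
    RejectsIf L N (.loop i p) env c (∃ j < N, B j) := by
  intro r
  have := exists_eval_loop (L := L) (N := N) (env := env) (c := { c with rej := r }) (i := i)
    (p := p) (fun m c' => ∃ r' : Bool, c' = { c with rej := r' } ∧
      (r' = true ↔ r = true ∨ ∃ j < m, B j)) ⟨r, rfl, by simp⟩ ?_
  · obtain ⟨_, h1, r', rfl, h2⟩ := this
    exact ⟨r', h1, h2⟩
  · rintro j hj _ ⟨r1, rfl, h1⟩
    obtain ⟨r2, e, h2⟩ := h j hj r1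
    refine ⟨_, e, r2, rfl, ?_⟩
    rw [h2, h1, or_assoc]
    refine or_congr_right ⟨?_, ?_⟩
    · rintro (⟨i, hi, h⟩ | h)
      · exact ⟨i, by omega, h⟩
      · exact ⟨j, by omega, h⟩
    · rintro ⟨i, hi, h⟩
      rcases Nat.lt_succ_iff_lt_or_eq.1 hi with hi | rfl
      · exact Or.inl ⟨i, hi, h⟩
      · exact Or.inr h

theorem RejectsIf.loop_lt {i : Ix} {B : ℕ → Prop} (hn : c.n ≤ N)
    (h : ∀ j < c.n, RejectsIf L N p (Function.update env i j) c (B j)) :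
    RejectsIf L N (.loop i (.ifLt (.inl i) (.inr .n) p .skip)) env c (∃ j < c.n, B j) := by
  refine (RejectsIf.loop (B := fun j => j < c.n ∧ B j) fun j hj r => ?_).congr ?_
  · simp only [eval_ifLt, val_inl, val_n, Function.update_self]
    split_ifs with hjn
    · obtain ⟨r', h1, h2⟩ := h j hjn r
      exact ⟨r', h1, by simp [h2, hjn]⟩
    · exact ⟨r, rfl, by simp [hjn]⟩
  · exact ⟨fun ⟨j, _, h1, h2⟩ => ⟨j, h1, h2⟩, fun ⟨j, h1, h2⟩ => ⟨j, by omega, h1, h2⟩⟩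

theorem Sound.eval_final (hc : Sound N G l k n c) :
    ∃ r, eval L N final env c.toHS = { c with rej := r }.toHS ∧
      (r = true ↔ 1 < c.S.card ∨ k = 0 ∧ n ≠ 0) := by
  have e1 : RejectsIf L N (.loop .u (.loop .v (.ifLt (.inl .v) (.inl .u)
      (.ifRd .S (.inl .u) (.ifRd .S (.inl .v) (.setF .rej true) .skip) .skip) .skip))) env c
      (∃ u < N, ∃ v < N, v < u ∧ u ∈ c.S ∧ v ∈ c.S) := by
    refine RejectsIf.loop fun u _ => RejectsIf.loop fun v _ r => ?_
    simp only [eval_ifLt, val_inl, Function.update_self, ne_eq, reduceCtorEq, not_false_eq_true,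
      Function.update_of_ne, eval_rdS, eval_setRej, eval_skip]
    by_cases h : v < u ∧ u ∈ c.S ∧ v ∈ c.S
    · exact ⟨true, by simp [h], by simp [h]⟩
    · refine ⟨r, ?_, by simp [h]⟩
      split_ifs <;> first | rfl | exact absurd ⟨‹_›, ‹_›, ‹_›⟩ h
  have e2 : RejectsIf L N (.loop .u (.ifLt (.inl .u) (.inr .n)
      (.ifLt (.inr .q) (.inr .k) .skip (.setF .rej true)) .skip)) env c (∃ u < c.n, k = 0) := by
    refine RejectsIf.loop_lt hc.good.n_le fun u _ r => ?_
    simp only [eval_ifLt, val_q, val_k, hc.k_eq, hc.good.q, eval_setRej, eval_skip]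
    split_ifs with h
    · exact ⟨r, rfl, by simp [h.ne']⟩
    · exact ⟨true, rfl, by simpa using Or.inr (Nat.eq_zero_of_not_pos h)⟩
  obtain ⟨r1, h1, h1'⟩ := e1 c.rej
  obtain ⟨r2, h2, h2'⟩ := e2 r1
  refine ⟨r2, ?_, ?_⟩
  · simp only [final, eval_block_cons, eval_block_nil]
    rw [← h2, ← h1]
  · rw [h2', h1', hc.rej, hc.n_eq]
    simp only [Bool.false_eq_true, false_or]
    refine or_congr ⟨?_, fun h => ?_⟩ ⟨?_, fun h => ⟨0, by omega, h.1⟩⟩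
    · rintro ⟨u, -, v, -, hvu, hu, hv⟩
      exact Finset.one_lt_card.2 ⟨u, hu, v, hv, hvu.ne'⟩
    · obtain ⟨a, ha, b, hb, hab⟩ := Finset.one_lt_card.1 h
      have ha' := Finset.mem_range.1 (hc.good.S_subset ha)
      have hb' := Finset.mem_range.1 (hc.good.S_subset hb)
      rcases lt_or_gt_of_ne hab with h | h
      · exact ⟨b, hb', a, ha', h, hb, ha⟩
      · exact ⟨a, ha', b, hb', h, ha, hb⟩
    · rintro ⟨u, hu, hk⟩
      exact ⟨hk, by omega⟩

/-- Acceptance means that `S` has shrunk to at most one vertex, that the exceptional case `k = 0 <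
n` is excluded, and that both flags are set. Set flags always have witnesses by `Sound`; that they
are set when they should be follows from `Inv`, as nothing large can have a copy in the remaining
`S`. -/
theorem Sound.eval_work (hc : Sound N G l k n c) (hM : c.M = ∅) :
    ∃ c' : Conf, eval queryLang N work env c.toHS = c'.toHS ∧
      c'.mq ≤ queryLen k (k + 3) (k + 2) ∧
      (accepts c'.toHS.flag = true ↔
        ((∃ X ⊆ Finset.range n, G.IsPrimeSet (X : Set ℕ) ∧ X.card = k) ∧
          ∀ X ⊆ Finset.range n, G.IsPrimeSet (X : Set ℕ) → X.card ≤ k) ∧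
        IndIn (pathGraph l) G (Finset.range n : Set ℕ)) := by
  obtain ⟨c1, e1, h1, h2, h3⟩ := hc.eval_start (env := env) hM
  have hI : Inv N G l k n c1 := by
    refine ⟨h1, h2, fun X hX _ _ => Or.inl ?_, fun _ h => Or.inl ?_⟩
    · rw [h3]
      exact (indIn_induce_self _).mono (by exact_mod_cast hX)
    · rwa [h3]
  obtain ⟨c2, e2, h4, h5⟩ := hI.eval_reduceAll (env := env)
  obtain ⟨r, e3, h6⟩ := h4.sound.eval_final (L := queryLang) (env := env)
  have e : eval queryLang N work env c.toHS = { c2 with rej := r }.toHS := by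
    rw [← e3, ← e2, ← e1]
    rfl
  refine ⟨_, e, h4.sound.mq, ?_⟩
  have hacc : accepts (Conf.toHS { c2 with rej := r }).flag = true ↔
      (¬(1 < c2.S.card ∨ k = 0 ∧ n ≠ 0) ∧ c2.mw = true) ∧ c2.path = true := by
    rw [← h6]
    simp [accepts, Conf.toHS]
  rw [hacc]
  constructor
  · rintro ⟨⟨hr, hmw⟩, hpath⟩
    refine ⟨⟨h4.sound.mw hmw, fun X hX hp => ?_⟩, h4.sound.path hpath⟩
    by_contra hcon
    -- A prime set with more than `k` vertices would have a copy in the at most one remaining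
    -- vertex. This forces `k = 0` and `n ≠ 0`, which has been rejected.
    rcases h4.mw X hX hp (by omega) with h | h
    · have := h.card_le
      rw [show Nat.card (X : Set ℕ) = X.card by simp] at this
      have hn : n ≠ 0 := by
        rintro rfl
        have := Finset.card_le_card hX
        rw [Finset.card_range] at this
        omega
      omega
    · omega
  · rintro ⟨⟨⟨X, hX, hp, hXk⟩, hmax⟩, hpath⟩
    have hS := h5 hmax
    refine ⟨⟨?_, ?_⟩, ?_⟩
    · rintro (h | ⟨h, hn⟩)
      · omega
      -- A single vertex is a prime set, so `k ≥ 1` for nonempty graphs.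
      · have := hmax {0} (by simpa using Nat.pos_of_ne_zero hn)
          (by simpa using isPrimeSet_singleton 0)
        simp at this
        omega
    · rcases le_or_gt k 3 with hk | hk
      · exact (h4.small X hX (by omega)).1 hp hXk
      · rcases h4.mw X hX hp hXk.ge with h | h
        · have := h.card_le
          rw [show Nat.card (X : Set ℕ) = X.card by simp] at this
          omega
        · exact h.2
    -- The path on three vertices is not prime, so paths with up to three vertices are left to the
    -- queries about small sets.
    · rcases le_or_gt l 3 with hl | hl
      · obtain ⟨f, hf, hfn, hadj⟩ := hpath
        refine (h4.small (Finset.univ.image f) ?_ ?_).2 ⟨f, hf, by simp, hadj⟩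
        · intro x hx
          obtain ⟨i, -, rfl⟩ := Finset.mem_image.1 hx
          exact hfn i
        · exact Finset.card_image_le.trans (by simpa using hl)
      · rcases h4.path hl hpath with h | h
        · have := h.card_le
          simp at this
          omega
        · exact h

end InducedPath

namespace InducedPath

open LoopLang SimpleGraph

variable {L : Language Bool} {N : ℕ} {env : Ix → ℕ} {c : Conf} {p q : P} {k n : ℕ}

/-! ### Reading the input -/

theorem eval_readParam {x : List Bool} (hi : c.inp = List.replicate k true ++ false :: x)
    (hk : c.k = 0) (ht : c.t = 0) (hf : c.fin = false) (hN : k + 2 ≤ N) :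
    eval L N readParam env c.toHS = { c with inp := x, k := k, t := k + 2 }.toHS := by
  have h1 : eval L N (.loop .r (.ifF .fin .skip (.popIn (.setF .fin true) (.setF .fin true)
      (block [.inc .k, .inc .t])))) env { c with t := 2 }.toHS =
      { c with inp := x, k := k, t := k + 2, fin := true }.toHS := by
    -- Rounds before `k` consume a `1`, round `k` consumes the separator and sets `fin`, and the
    -- later rounds are idle.
    refine eval_loop_conf (fun j => { c with
      inp := if j ≤ k then List.replicate (k - j) true ++ false :: x else x
      k := min j k
      t := min j k + 2
      fin := decide (k < j) }) ?_ ?_ fun j hj => ?_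
    · cases c
      simp_all
    · simp [show ¬N ≤ k by omega, show k ≤ N by omega, show k < N by omega]
    · rw [eval_ifFin]
      rcases lt_trichotomy j k with h | rfl | h
      · have hl : k - j = k - (j + 1) + 1 := by omega
        rw [if_neg (by simp [h.le]), eval_pop_cons (b := true)
          (l := List.replicate (k - (j + 1)) true ++ false :: x)
          (by simp only [h.le, if_true]; rw [hl, List.replicate_succ, List.cons_append])]
        simp only [if_true, eval_block_cons, eval_block_nil, eval_incK, eval_incT]
        simp [h.le, show j + 1 ≤ k by omega, show j + 1 ≤ N by omega, show j + 3 ≤ N by omega,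
          show ¬k ≤ j by omega, show ¬k < j by omega,
          add_right_comm]
      · rw [if_neg (by simp), eval_pop_cons (b := false) (l := x) (by simp)]
        simp
      · rw [if_pos (by simp [h])]
        simp [show ¬j ≤ k by omega, show ¬j + 1 ≤ k by omega, h.le, h, show k < j + 1 by omega,
          show k ≤ j + 1 by omega]
  simp only [readParam, eval_block_cons, eval_block_nil, eval_incT, ht]
  rw [show ({ c with t := min N (min N (0 + 1) + 1) } : Conf) = { c with t := 2 } by
    congr 1; omega, h1]
  simp [hf]

theorem eval_readSize {y : List Bool} (hi : c.inp = List.replicate n true ++ false :: y)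
    (hn : c.n = 0) (hf : c.fin = false) (hN : n < N) :
    eval L N readSize env c.toHS = { c with inp := y, n := n }.toHS := by
  have h1 : eval L N (.loop .r (.ifF .fin .skip (.popIn (block [.setF .rej true, .setF .fin true])
      (.setF .fin true) (.inc .n)))) env c.toHS =
      { c with inp := y, n := n, fin := true }.toHS := by
    refine eval_loop_conf (fun j => { c with
      inp := if j ≤ n then List.replicate (n - j) true ++ false :: y else y
      n := min j n
      fin := decide (n < j) }) ?_ ?_ fun j hj => ?_
    · cases c
      simp_all
    · simp [show ¬N ≤ n by omega, hN.le, hN]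
    · rw [eval_ifFin]
      rcases lt_trichotomy j n with h | rfl | h
      · have hl : n - j = n - (j + 1) + 1 := by omega
        rw [if_neg (by simp [h.le]), eval_pop_cons (b := true)
          (l := List.replicate (n - (j + 1)) true ++ false :: y)
          (by simp only [h.le, if_true]; rw [hl, List.replicate_succ, List.cons_append])]
        simp only [if_true, eval_incN]
        simp [h.le, show j + 1 ≤ n by omega, show j + 1 ≤ N by omega, show ¬n ≤ j by omega,
          show ¬n < j by omega]
      · rw [if_neg (by simp), eval_pop_cons (b := false) (l := y) (by simp)]
        simp
      · rw [if_pos (by simp [h])]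
        simp [show ¬j ≤ n by omega, show ¬j + 1 ≤ n by omega, h.le, h, show n < j + 1 by omega,
          show n ≤ j + 1 by omega]
  simp only [readSize, eval_block_cons, eval_block_nil, h1]
  simp [hf]

/-- Without a separator the input runs out, which leads to rejection in round `n`. -/
theorem eval_readSize_of_replicate (hi : c.inp = List.replicate n true)
    (hn : c.n = 0) (hf : c.fin = false) (hr : c.rej = false) (hN : n < N) :
    eval L N readSize env c.toHS = { c with inp := [], n := n, rej := true }.toHS := by
  have h1 : eval L N (.loop .r (.ifF .fin .skip (.popIn (block [.setF .rej true, .setF .fin true])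
      (.setF .fin true) (.inc .n)))) env c.toHS =
      { c with inp := [], n := n, fin := true, rej := true }.toHS := by
    refine eval_loop_conf (fun j => { c with
      inp := List.replicate (n - j) true
      n := min j n
      fin := decide (n < j)
      rej := decide (n < j) }) ?_ ?_ fun j hj => ?_
    · cases c
      simp_all
    · simp [hN.le, hN, Nat.sub_eq_zero_of_le hN.le]
    · rw [eval_ifFin]
      rcases lt_trichotomy j n with h | rfl | h
      · have hl : n - j = n - (j + 1) + 1 := by omega
        rw [if_neg (by simp [h.le]), eval_pop_cons (b := true)
          (l := List.replicate (n - (j + 1)) true) (by rw [← List.replicate_succ, ← hl])]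
        simp only [if_true, eval_incN]
        simp [h.le, show j + 1 ≤ n by omega, show j + 1 ≤ N by omega, show ¬n ≤ j by omega,
          show ¬n < j by omega]
      · rw [if_neg (by simp), eval_pop_nil (by simp)]
        simp
      · rw [if_pos (by simp [h])]
        simp [h.le, h, show n < j + 1 by omega, show n ≤ j + 1 by omega,
          Nat.sub_eq_zero_of_le h.le, Nat.sub_eq_zero_of_le (show n ≤ j + 1 by omega)]
  simp only [readSize, eval_block_cons, eval_block_nil, h1]
  simp [hf]

theorem eq_replicate_or (x : List Bool) : (∃ n, x = List.replicate n true) ∨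
    ∃ n y, x = List.replicate n true ++ false :: y := by
  induction x with
  | nil => exact Or.inl ⟨0, rfl⟩
  | cons b x ih =>
    cases b
    · exact Or.inr ⟨0, x, rfl⟩
    · rcases ih with ⟨n, rfl⟩ | ⟨n, y, rfl⟩
      · exact Or.inl ⟨n + 1, rfl⟩
      · exact Or.inr ⟨n + 1, y, rfl⟩

/-- The default `false` equals the initial content of the array, so the formula remains valid beyond
the end of the word. -/
theorem update_getD {y : List Bool} {t : ℕ} {b : Bool} (h : y.getD t false = b) :
    Function.update (fun p => if p < t then y.getD p false else false) t b =
      fun p => if p < t + 1 then y.getD p false else false := by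
  funext p
  rcases lt_trichotomy p t with hp | rfl | hp
  · simp [hp, hp.ne, show p < t + 1 by omega]
  · simp [← h]
  · simp [hp.ne', show ¬p < t by omega, show ¬p < t + 1 by omega]

theorem eval_readMat {y : List Bool} (hi : c.inp = y) (ha : c.adj = fun _ => false)
    (hq : c.q = 0) (hr : c.rej = false) (hy : y.length ≤ N) (hn : c.n ≤ N) :
    eval L N readMat env c.toHS = { c with
      inp := y.drop (c.n * c.n)
      adj := fun p => if p < c.n * c.n then y.getD p false else false
      rej := decide (y.length < c.n * c.n) }.toHS := by
  have h1 : eval L N (.loop .a (.ifLt (.inl .a) (.inr .n) (.loop .b (.ifLt (.inl .b) (.inr .n)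
      (.popIn (.setF .rej true) (block [.wr .adj (.inr .q) false, .inc .q])
        (block [.wr .adj (.inr .q) true, .inc .q])) .skip)) .skip)) env c.toHS = { c with
      inp := y.drop (c.n * c.n)
      adj := fun p => if p < c.n * c.n then y.getD p false else false
      rej := decide (y.length < c.n * c.n)
      q := min (c.n * c.n) y.length }.toHS := by
    -- The effect of one round depends only on the linear address `t = i * n + j`. Once the input is
    -- exhausted, `q` stops at its length and `rej` is set.
    have step : ∀ (env : Ix → ℕ) (t : ℕ), eval L N (.popIn (.setF .rej true)
        (block [.wr .adj (.inr .q) false, .inc .q]) (block [.wr .adj (.inr .q) true, .inc .q])) env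
        { c with
          inp := y.drop t
          adj := fun p => if p < t then y.getD p false else false
          rej := decide (y.length < t)
          q := min t y.length }.toHS = { c with
          inp := y.drop (t + 1)
          adj := fun p => if p < t + 1 then y.getD p false else false
          rej := decide (y.length < t + 1)
          q := min (t + 1) y.length }.toHS := by
      intro env t
      rcases lt_or_ge t y.length with h | h
      · rw [eval_pop_cons (b := y[t]) (l := y.drop (t + 1)) (List.drop_eq_getElem_cons h)]
        have hu := update_getD (y := y) (t := t) (b := y[t]) (List.getD_eq_getElem _ _ h)
        cases hb : y[t] <;>
        · rw [hb] at hu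
          simp only [Bool.false_eq_true, if_true, if_false, eval_block_cons, eval_block_nil,
            eval_wrAdj, eval_incQ, val_q, min_eq_left h.le, hu,
            min_eq_right (show t + 1 ≤ N by omega), min_eq_left (show t + 1 ≤ y.length by omega)]
          simp [show ¬y.length < t by omega, show ¬y.length < t + 1 by omega]
      · rw [eval_pop_nil (List.drop_eq_nil_of_le h), eval_setRej]
        have hu := update_getD (y := y) (t := t) (b := false) (List.getD_eq_default _ _ h)
        rw [← hu, Function.update_eq_self_iff.2 (by simp)]
        simp [List.drop_eq_nil_of_le h, List.drop_eq_nil_of_le (show y.length ≤ t + 1 by omega), h,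
          show y.length < t + 1 by omega, show y.length ≤ t + 1 by omega]
    refine eval_loop_lt_conf hn (fun i => { c with
      inp := y.drop (i * c.n)
      adj := fun p => if p < i * c.n then y.getD p false else false
      rej := decide (y.length < i * c.n)
      q := min (i * c.n) y.length }) ?_ rfl (fun _ _ _ => rfl) fun i _ => ?_
    · cases c
      simp_all
    · refine eval_loop_lt_conf hn (fun j => { c with
        inp := y.drop (i * c.n + j)
        adj := fun p => if p < i * c.n + j then y.getD p false else false
        rej := decide (y.length < i * c.n + j)
        q := min (i * c.n + j) y.length }) rfl (by rw [Nat.succ_mul]) (fun _ _ _ => rfl)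
        fun j _ => step _ _
  simp only [readMat, eval_block_cons, eval_block_nil, h1, eval_resetQ, ← hq]

theorem getLastD_take_succ {z : List Bool} {j : ℕ} (h : j < z.length) :
    (z.take (j + 1)).getLastD true = z[j] := by
  rw [List.take_succ_eq_append_getElem h, List.getLastD_concat]

/-- A word passes exactly if it is a binary expansion of admissible length. In the other case only
the rejection and the absence of queries matter. -/
theorem eval_readBits {z : List Bool} (hi : c.inp = z) (he : c.ell = fun _ => false)
    (hce : c.e = 0) (hf : c.fin = false) (hr : c.rej = false) (hz : z.length ≤ N) :
    ∃ c' : Conf, eval L N readBits env c.toHS = c'.toHS ∧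
      if z.getLastD true = true ∧ z.length ≤ c.t
      then c' = { c with
        inp := []
        ell := fun p => if p < N then z.getD p false else false
        e := z.length }
      else c'.rej = true ∧ c'.mq = c.mq := by
  have h1 : eval L N (.loop .r (.popIn .skip (block [.wr .ell (.inr .e) false, .inc .e,
      .setF .fin true]) (block [.wr .ell (.inr .e) true, .inc .e, .setF .fin false]))) env c.toHS =
      { c with
        inp := []
        ell := fun p => if p < N then z.getD p false else false
        e := z.length
        fin := !z.getLastD true }.toHS := by
    refine eval_loop_conf (fun j => { c with
      inp := z.drop j
      ell := fun p => if p < j then z.getD p false else false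
      e := min j z.length
      fin := !(z.take j).getLastD true }) ?_ ?_ fun j hj => ?_
    · cases c
      simp_all
    · simp [List.drop_eq_nil_of_le hz, List.take_of_length_le hz, hz]
    · rcases lt_or_ge j z.length with h | h
      · rw [eval_pop_cons (b := z[j]) (l := z.drop (j + 1)) (List.drop_eq_getElem_cons h)]
        have hu := update_getD (y := z) (t := j) (b := z[j]) (List.getD_eq_getElem _ _ h)
        have hl := getLastD_take_succ h
        cases hb : z[j] <;>
        · rw [hb] at hu hl
          simp only [Bool.false_eq_true, if_true, if_false, eval_block_cons, eval_block_nil,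
            eval_wrEll, eval_incE, eval_setFin, val_e, min_eq_left h.le, hu, hl,
            min_eq_right (show j + 1 ≤ N by omega), min_eq_left (show j + 1 ≤ z.length by omega),
            Bool.not_true, Bool.not_false]
      · rw [eval_pop_nil (List.drop_eq_nil_of_le h), eval_skip]
        have hu := update_getD (y := z) (t := j) (b := false) (List.getD_eq_default _ _ h)
        rw [← hu, Function.update_eq_self_iff.2 (by simp)]
        simp [List.drop_eq_nil_of_le h, List.drop_eq_nil_of_le (show z.length ≤ j + 1 by omega), h,
          List.take_of_length_le h, List.take_of_length_le (show z.length ≤ j + 1 by omega),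
          show z.length ≤ j + 1 by omega]
  simp only [readBits, eval_block_cons, eval_block_nil, h1, eval_ifFin]
  cases hb : z.getLastD true
  · simp only [Bool.not_false, if_true, eval_setRej, eval_setFin, eval_ifLt, val_t, val_e, eval_skip,
      Bool.false_eq_true, false_and, if_false]
    split_ifs <;> exact ⟨_, rfl, rfl, rfl⟩
  · simp only [Bool.not_true, Bool.false_eq_true, if_false, eval_setRej, eval_ifLt, val_t, val_e,
      eval_skip, true_and]
    by_cases h : c.t < z.length
    · rw [if_pos h]
      refine ⟨_, rfl, ?_⟩
      rw [if_neg (by omega)]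
      exact ⟨rfl, rfl⟩
    · rw [if_neg h]
      refine ⟨_, rfl, ?_⟩
      rw [if_pos (by omega), ← hf]

theorem RejectsIf.seq {A B : Prop} (hp : RejectsIf L N p env c A) (hq : RejectsIf L N q env c B) :
    RejectsIf L N (.seq p q) env c (A ∨ B) := by
  intro r
  obtain ⟨r1, e1, h1⟩ := hp r
  obtain ⟨r2, e2, h2⟩ := hq r1
  refine ⟨r2, ?_, by rw [h2, h1, or_assoc]⟩
  rw [← e2, ← e1]
  rfl

theorem rejectsIf_skip : RejectsIf L N .skip env c False := fun r => ⟨r, rfl, by simp⟩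

theorem rejectsIf_rej : RejectsIf L N (.setF .rej true) env c True := fun _ =>
  ⟨true, eval_setRej _, by simp⟩

theorem RejectsIf.ifAdj {i j : Ix} {A B : Prop} (hi : i ≠ .r ∧ i ≠ .s) (hj : j ≠ .r ∧ j ≠ .s)
    (hq0 : c.q = 0) (hN : c.n * c.n ≤ N) (hin : env i < c.n) (hjn : env j < c.n)
    (hp : RejectsIf L N p env c A) (hq : RejectsIf L N q env c B) :
    RejectsIf L N (ifAdj i j p q) env c
      (if c.adj (env i * c.n + env j) = true then A else B) := by
  intro r
  rw [eval_ifAdj (c := { c with rej := r }) hi hj hq0 hN hin hjn]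
  split_ifs
  · exact hp r
  · exact hq r

theorem rejectsIf_validate (hq : c.q = 0) (hN : c.n * c.n ≤ N) :
    RejectsIf L N validate env c (∃ i < c.n, (∃ j < c.n, c.adj (i * c.n + j) = true ∧
      c.adj (j * c.n + i) = false) ∨ c.adj (i * c.n + i) = true) := by
  have hn : c.n ≤ N := (Nat.le_mul_self _).trans hN
  refine RejectsIf.loop_lt hn fun i hi => ?_
  refine (RejectsIf.seq (RejectsIf.loop_lt hn fun j hj => RejectsIf.ifAdj (by decide) (by decide)
    hq hN (by simpa using hi) (by simpa using hj) (RejectsIf.ifAdj (by decide) (by decide)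
    hq hN (by simpa using hj) (by simpa using hi) rejectsIf_skip rejectsIf_rej) rejectsIf_skip)
    (RejectsIf.seq (RejectsIf.ifAdj (by decide) (by decide) hq hN (by simpa using hi)
      (by simpa using hi) rejectsIf_rej rejectsIf_skip) rejectsIf_skip)).congr ?_
  simp

end InducedPath

namespace SimpleGraph

/-! ### Graphs on `Fin n` as graphs on the natural numbers -/

variable {n : ℕ} {G : SimpleGraph (Fin n)}

theorem exists_map_valEmbedding {X : Finset ℕ} (hX : X ⊆ Finset.range n) :
    ∃ Y : Finset (Fin n), Y.map Fin.valEmbedding = X := by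
  refine ⟨X.attachFin fun i hi => Finset.mem_range.1 (hX hi), ?_⟩
  ext i
  simp only [Finset.mem_map, Finset.mem_attachFin, Fin.valEmbedding_apply]
  exact ⟨fun ⟨j, h1, h2⟩ => h2 ▸ h1, fun h => ⟨⟨i, Finset.mem_range.1 (hX h)⟩, h, rfl⟩⟩

theorem isPrimeSet_map_iff {Y : Finset (Fin n)} :
    G.natGraph.IsPrimeSet (Y.map Fin.valEmbedding : Finset ℕ) ↔ G.IsPrimeSet Y := by
  rw [Finset.coe_map]
  exact isPrimeSet_image_iff Fin.valEmbedding.injective (natGraph_adj G) _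

theorem map_valEmbedding_subset (Y : Finset (Fin n)) :
    Y.map Fin.valEmbedding ⊆ Finset.range n := by
  intro i hi
  obtain ⟨j, -, rfl⟩ := Finset.mem_map.1 hi
  exact Finset.mem_range.2 j.2

theorem modularWidth_eq_iff_natGraph (k : ℕ) : G.modularWidth = k ↔
    (∃ X ⊆ Finset.range n, G.natGraph.IsPrimeSet (X : Set ℕ) ∧ X.card = k) ∧
      ∀ X ⊆ Finset.range n, G.natGraph.IsPrimeSet (X : Set ℕ) → X.card ≤ k := by
  rw [modularWidth_eq_iff]
  refine and_congr ⟨?_, ?_⟩ ⟨fun h X hX hp => ?_, fun h X hp => ?_⟩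
  · rintro ⟨X, hp, hX⟩
    lift X to Finset (Fin n) using X.toFinite
    rw [Set.ncard_coe_finset] at hX
    exact ⟨_, map_valEmbedding_subset X, isPrimeSet_map_iff.2 hp, by rwa [Finset.card_map]⟩
  · rintro ⟨X, hX, hp, hk⟩
    obtain ⟨Y, rfl⟩ := exists_map_valEmbedding hX
    exact ⟨Y, isPrimeSet_map_iff.1 hp, by rwa [Set.ncard_coe_finset, ← Finset.card_map]⟩
  · obtain ⟨Y, rfl⟩ := exists_map_valEmbedding hX
    have := h Y (isPrimeSet_map_iff.1 hp)
    rw [Set.ncard_coe_finset] at this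
    rwa [Finset.card_map]
  · lift X to Finset (Fin n) using X.toFinite
    have := h _ (map_valEmbedding_subset X) (isPrimeSet_map_iff.2 hp)
    rw [Finset.card_map] at this
    rwa [Set.ncard_coe_finset]

theorem indIn_natGraph_iff {W : Type} {H : SimpleGraph W} :
    IndIn H G.natGraph (Finset.range n : Set ℕ) ↔ H.IsIndContained G := by
  constructor
  · rintro ⟨f, h1, h2, h3⟩
    have h2 : ∀ w, f w < n := fun w => by simpa using h2 w
    refine ⟨⟨⟨fun w => ⟨f w, h2 w⟩, fun x y h => h1 (congrArg Fin.val h)⟩, ?_⟩⟩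
    intro x y
    rw [h3]
    exact natGraph_adj G _ _
  · rintro ⟨f⟩
    exact ⟨fun w => f w, fun x y h => f.injective (Fin.ext h), fun w => by simp,
      fun x y => by rw [← natGraph_adj, f.map_adj_iff]⟩

/-- The copy of the path is a prime induced subgraph. -/
theorem le_modularWidth_of_pathGraph {l : ℕ} (hl : 4 ≤ l)
    (h : (pathGraph l).IsIndContained G) : l ≤ G.modularWidth := by
  obtain ⟨f⟩ := h
  have hp := (isPrimeGraph_iff_isPrimeSet_range f.injective fun x y => f.map_adj_iff.symm).1
    (isPrimeGraph_pathGraph hl)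
  have := ((modularWidth_eq_iff (G := G) _).1 rfl).2 _ hp
  rwa [← Nat.card_coe_set_eq, Nat.card_range_of_injective f.injective, Nat.card_fin] at this

/-- This justifies the rejection of long numbers: for `l ≥ 4` there are at most `l ≤ mw(G)` digits,
and for `l ≤ 3` at most two. -/
theorem length_bits_le {l : ℕ} (h : (pathGraph l).IsIndContained G) :
    l.bits.length ≤ G.modularWidth + 2 := by
  rw [Nat.size_eq_bits_len]
  rcases le_or_gt l 3 with hl | hl
  · exact (Nat.size_le.2 (show l < 2 ^ 2 by omega)).trans (by omega)
  · exact (Nat.size_le.2 Nat.lt_two_pow_self).trans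
      ((le_modularWidth_of_pathGraph hl h).trans (by omega))

open Classical in
theorem mem_longestInducedPathMW_iff {y : List Bool} {k : ℕ} :
    (List.replicate n true ++ false :: y, k) ∈ longestInducedPathMW ↔
      ∃ (G : SimpleGraph (Fin n)) (l : ℕ),
        y = matWord (fun i j => decide (G.natGraph.Adj i j)) n n ++ l.bits ∧
        G.modularWidth = k ∧ (pathGraph l).IsIndContained G := by
  constructor
  · rintro ⟨n', G, l, h, hp⟩
    obtain ⟨h, hk⟩ := Prod.mk.inj h
    rw [encodeGraphNat_eq] at h
    obtain ⟨rfl, rfl⟩ := replicate_append_false_inj h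
    exact ⟨G, l, rfl, hk.symm, hp⟩
  · rintro ⟨G, l, rfl, rfl, hp⟩
    exact ⟨n, G, l, by rw [encodeGraphNat_eq], hp⟩

theorem replicate_notMem_longestInducedPathMW {k : ℕ} :
    (List.replicate n true, k) ∉ longestInducedPathMW := by
  rintro ⟨n', G, l, h, -⟩
  have h := (Prod.mk.inj h).1
  have hf : false ∈ List.replicate n true := by
    rw [h, encodeGraphNat]
    simp
  simp at hf

end SimpleGraph

/-! ### Correctness of the whole algorithm. -/

namespace InducedPath

open LoopLang SimpleGraph

variable {N : ℕ} {env : Ix → ℕ} {c : Conf} {k n : ℕ}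

/-- The specification of the result of the algorithm. -/
def Correct (x : List Bool) (k : ℕ) (c : Conf) : Prop :=
  c.mq ≤ queryLen k (k + 3) (k + 2) ∧
    (accepts c.toHS.flag = true ↔ (x, k) ∈ longestInducedPathMW)

theorem correct_of_rej {x : List Bool} (hr : c.rej = true) (hm : c.mq = 0)
    (hx : (x, k) ∉ longestInducedPathMW) : Correct x k c := by
  refine ⟨by omega, iff_of_false ?_ hx⟩
  simp [accepts, Conf.toHS, hr]

open Classical in
theorem eval_validate_work {G : SimpleGraph (Fin n)} {l : ℕ} {x : List Bool}
    (hx : x = List.replicate n true ++ false ::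
      (matWord (fun i j => decide (G.natGraph.Adj i j)) n n ++ l.bits))
    (hs : Sound N G.natGraph l k n c) (hM : c.M = ∅) :
    ∃ c', eval queryLang N work env c.toHS = c'.toHS ∧ Correct x k c' := by
  obtain ⟨c', h1, h2, h3⟩ := hs.eval_work (env := env) hM
  refine ⟨c', h1, h2, h3.trans ?_⟩
  rw [← modularWidth_eq_iff_natGraph, indIn_natGraph_iff, hx, mem_longestInducedPathMW_iff]
  refine ⟨fun h => ⟨G, l, rfl, h.1, h.2⟩, ?_⟩
  rintro ⟨G', l', h, h1, h2⟩
  have hinj : encodeGraphNat G l = encodeGraphNat G' l' := by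
    rw [encodeGraphNat_eq, encodeGraphNat_eq, h]
  obtain ⟨-, hG, rfl⟩ := encodeGraphNat_inj hinj
  obtain rfl := eq_of_heq hG
  exact ⟨h1, h2⟩

/-- A word determines a graph if its first letters are a symmetric matrix. -/
theorem exists_graph {y : List Bool}
    (h : ¬∃ i < n, (∃ j < n, y.getD (i * n + j) false = true ∧ y.getD (j * n + i) false = false) ∨
      y.getD (i * n + i) false = true) :
    ∃ G : SimpleGraph (Fin n), ∀ i < n, ∀ j < n,
      y.getD (i * n + j) false = true ↔ G.natGraph.Adj i j := by
  push Not at h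
  obtain ⟨G, hG⟩ : ∃ G : SimpleGraph (Fin n), ∀ i j : Fin n,
      y.getD (i * n + j) false = true ↔ G.Adj i j :=
    ⟨⟨fun i j => y.getD (i * n + j) false = true,
      ⟨fun i j hij => by simpa using (h i i.2).1 j j.2 hij⟩, ⟨fun i hi => (h i i.2).2 hi⟩⟩,
      fun _ _ => Iff.rfl⟩
  exact ⟨G, fun i hi j hj => (hG ⟨i, hi⟩ ⟨j, hj⟩).trans (natGraph_adj G ⟨i, hi⟩ ⟨j, hj⟩)⟩

/-- The initial state. -/
def start (w : List Bool) : Conf :=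
  ⟨w, [], fun _ => false, fun _ => false, ∅, ∅, 0, 0, 0, 0, 0, false, false, false, false, 0⟩

theorem initHS_eq (w : List Bool) : initHS Ctr Arr Fl w = (start w).toHS := by
  simp only [initHS, start, Conf.toHS, HS.mk.injEq, true_and, and_true]
  refine ⟨?_, ?_, ?_⟩ <;> funext x <;> cases x <;> simp

/-- The state after reading the parameter, the number of vertices, the matrix and the digits. -/
def parsed (y : List Bool) (N k n : ℕ) : Conf :=
  { start [] with
    adj := fun p => if p < n * n then y.getD p false else false
    ell := fun p => if p < N then (y.drop (n * n)).getD p false else false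
    k := k
    n := n
    e := (y.drop (n * n)).length
    t := k + 2 }

open Classical in
theorem eval_parsed {y : List Bool} (hy : n * n ≤ y.length) (hyN : y.length ≤ N) (hk : k ≤ N)
    (hl : (y.drop (n * n)).getLastD true = true) (hl' : (y.drop (n * n)).length ≤ k + 2) :
    ∃ c', eval queryLang N (block [validate, .ifF .rej .skip work]) env (parsed y N k n).toHS =
      c'.toHS ∧ Correct (List.replicate n true ++ false :: y) k c' := by
  have hN : n * n ≤ N := hy.trans hyN
  have hlt : ∀ i < n, ∀ j < n, i * n + j < n * n := fun i hi j hj => by nlinarith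
  have hadj : ∀ i < n, ∀ j < n, (parsed y N k n).adj (i * n + j) = y.getD (i * n + j) false :=
    fun i hi j hj => if_pos (hlt i hi j hj)
  obtain ⟨r, h1, h2⟩ := rejectsIf_validate (L := queryLang) (env := env) (c := parsed y N k n)
    (N := N) rfl hN false
  have hbad : (∃ i < n, (∃ j < n, (parsed y N k n).adj (i * n + j) = true ∧
      (parsed y N k n).adj (j * n + i) = false) ∨ (parsed y N k n).adj (i * n + i) = true) ↔
      ∃ i < n, (∃ j < n, y.getD (i * n + j) false = true ∧ y.getD (j * n + i) false = false) ∨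
      y.getD (i * n + i) false = true := by
    refine exists_congr fun i => and_congr_right fun hi => or_congr (exists_congr fun j =>
      and_congr_right fun hj => ?_) ?_
    · rw [hadj i hi j hj, hadj j hj i hi]
    · rw [hadj i hi i hi]
  have h2 := h2.trans (or_congr_right hbad)
  simp only [eval_block_cons, eval_block_nil]
  rw [show parsed y N k n = { parsed y N k n with rej := false } from rfl, h1, eval_ifRej]
  -- Without rejection the matrix is symmetric with zero diagonal and hence comes from a graph.
  -- After a rejection an entry violates one of these properties, so the word encodes no graph.
  cases r
  · obtain ⟨G, hG⟩ := exists_graph (fun h => by simpa using h2.2 (Or.inr h))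
    obtain ⟨l, hl⟩ := exists_bits_eq hl
    simp only [Bool.false_eq_true, if_false]
    refine eval_validate_work (G := G) (l := l) ?_ ⟨⟨rfl, rfl, hN, hk, ?_, ?_, ?_, ?_, ?_⟩, rfl,
      rfl, rfl, hl ▸ hl', Nat.zero_le _, fun h => by simp [parsed, start] at h,
      fun h => by simp [parsed, start] at h⟩ rfl
    · rw [hl, ← eq_matWord (l := y.take (n * n)), List.take_append_drop]
      · simpa using hy
      · intro i hi j hj
        rw [Bool.eq_iff_iff, decide_eq_true_iff, ← hG i hi j hj, List.getD_eq_getElem?_getD,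
          List.getElem?_take_of_lt (hlt i hi j hj), List.getD_eq_getElem?_getD]
    · change (y.drop (n * n)).length ≤ N
      rw [List.length_drop]
      omega
    · intro i hi j hj
      exact (Bool.eq_iff_iff.1 (hadj i hi j hj)).trans (hG i hi j hj)
    · rw [hl]
      refine List.ext_getElem (by simp [parsed]) fun i h3 h4 => ?_
      rw [List.length_drop] at h4
      simp only [parsed, List.getElem_map, List.getElem_range]
      rw [if_pos (by omega), List.getD_eq_getElem]
    · exact Finset.empty_subset _
    · exact Finset.empty_subset _
  · refine ⟨_, if_pos rfl, correct_of_rej rfl rfl ?_⟩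
    rw [mem_longestInducedPathMW_iff]
    rintro ⟨G, l, rfl, -, -⟩
    have hg : ∀ i < n, ∀ j < n, (matWord (fun i j => decide (G.natGraph.Adj i j)) n n ++
        l.bits).getD (i * n + j) false = decide (G.natGraph.Adj i j) := by
      intro i hi j hj
      rw [List.getD_append _ _ _ _ (by rw [length_matWord]; exact hlt i hi j hj),
        matWord_getD _ hi hj]
    rcases h2.1 rfl with h | ⟨i, hi, ⟨j, hj, h3, h4⟩ | h3⟩
    · simp at h
    · rw [hg i hi j hj, decide_eq_true_iff] at h3
      rw [hg j hj i hi, decide_eq_false_iff_not] at h4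
      exact h4 h3.symm
    · rw [hg i hi i hi, decide_eq_true_iff] at h3
      exact G.natGraph.irrefl h3

/-- Each early rejection is justified by the shape of encodings, except for the bound on the digits,
which uses the modular-width. -/
theorem eval_algorithm (x : List Bool) (k : ℕ) :
    ∃ c', eval queryLang ((instanceWord x k).length + 2) algorithm env
      (initHS Ctr Arr Fl (instanceWord x k)) = c'.toHS ∧ Correct x k c' := by
  classical
  obtain ⟨N, hN⟩ : ∃ N, N = (instanceWord x k).length + 2 := ⟨_, rfl⟩
  have hN' : N = k + x.length + 3 := by
    rw [hN, instanceWord]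
    simp
    omega
  rw [← hN, initHS_eq]
  simp only [algorithm, eval_block_cons (p := readParam), eval_block_cons (p := readSize)]
  rw [eval_readParam (k := k) (x := x) rfl rfl rfl rfl (by omega)]
  rcases eq_replicate_or x with ⟨n, rfl⟩ | ⟨n, y, rfl⟩
  · rw [List.length_replicate] at hN'
    rw [eval_readSize_of_replicate (n := n) rfl rfl rfl rfl (by omega), eval_block_cons,
      eval_block_nil, eval_ifRej]
    exact ⟨_, if_pos rfl, correct_of_rej rfl rfl replicate_notMem_longestInducedPathMW⟩
  rw [List.length_append, List.length_replicate, List.length_cons] at hN'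
  rw [eval_readSize (n := n) (y := y) rfl rfl rfl (by omega), eval_block_cons, eval_block_nil,
    eval_ifRej, if_neg (by simp [start]), eval_block_cons, eval_readMat (y := y) rfl rfl rfl rfl
    (by omega) (by change n ≤ N; omega), eval_block_cons, eval_block_nil, eval_ifRej]
  rcases lt_or_ge y.length (n * n) with hy | hy
  · refine ⟨_, if_pos (by simpa using hy), correct_of_rej (by simpa using hy) rfl ?_⟩
    rw [mem_longestInducedPathMW_iff]
    rintro ⟨G, l, rfl, -, -⟩
    rw [List.length_append, length_matWord] at hy
    omega
  rw [if_neg (by simpa using hy), eval_block_cons]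
  obtain ⟨c', h1, h2⟩ := eval_readBits (L := queryLang) (N := N) (env := env)
    (z := y.drop (n * n))
    (c := { parsed y N k n with
      inp := y.drop (n * n)
      ell := fun _ => false
      e := 0 }) rfl rfl rfl rfl rfl (by rw [List.length_drop]; omega)
  have h0 : (decide (y.length < n * n)) = false := by simpa using hy
  have h1' : eval queryLang N readBits env
      { start (instanceWord (List.replicate n true ++ false :: y) k) with
        inp := y.drop (n * n)
        adj := fun p => if p < n * n then y.getD p false else false
        k := k
        n := n
        t := k + 2
        rej := decide (y.length < n * n) }.toHS = c'.toHS := by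
    rw [h0]
    exact h1
  rw [show eval queryLang N readBits env _ = c'.toHS from h1', eval_block_cons, eval_block_nil,
    eval_ifRej]
  split_ifs at h2 with hz
  · rw [h2, if_neg (by simp [parsed, start])]
    exact eval_parsed (N := N) (k := k) (n := n) (env := env) hy (by omega) (by omega) hz.1 hz.2
  · refine ⟨_, if_pos h2.1, correct_of_rej h2.1 h2.2 ?_⟩
    rw [mem_longestInducedPathMW_iff]
    rintro ⟨G, l, rfl, rfl, hp⟩
    rw [List.drop_left' (length_matWord _ _ _)] at hz
    -- For a yes-instance the digits are a binary expansion and their number is bounded through `k =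
    -- mw(G)`.
    exact hz ⟨getLastD_bits l, length_bits_le hp⟩

theorem hasTuringCompression_longestInducedPathMW :
    HasTuringCompression longestInducedPathMW fun k => queryLen k (k + 3) (k + 2) := by
  refine hasTuringCompression_of_eval wf_algorithm (L := queryLang) (acc := accepts) ?_
  rintro x k _ rfl
  obtain ⟨c', h1, h2, h3⟩ := eval_algorithm (env := fun _ => 0) x k
  rw [h1]
  exact ⟨h2, h3⟩

end InducedPath

theorem mainTheorem8 : HasPTC longestInducedPathMW := by
  open Polynomial in
  -- The polynomial is `queryLen k (k + 3) (k + 2)` written out in `k`.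
  refine ⟨X + 1 + (X + 3) + 1 + (X + 3) * (X + 3) + (X + 2) + 1, ?_⟩
  convert InducedPath.hasTuringCompression_longestInducedPathMW using 2
  simp [InducedPath.queryLen]
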